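/- **Setting.** Let $\mathcal S,\mathcal A$ be finite, $|\mathcal A|\ge 2$, $\gamma\in(0,1)$, $\mathcal P(s'|s,a)$ a transition kernel and $c(s,a)$ a cost with $|c|\le\bar c$. For each $s$ let $h(s)$ be a closed convex function on the simplex $\Delta_{|\mathcal A|}$ with values in $\mathbb R\cup\{+\infty\}$ and closed convex domain $X_s$, $|h|\le\bar h$ on $X_s$; a policy $\pi$ is feasible if $\pi(\cdot|s)\in X_s$ for all $s$, and $h^\pi(s)$ is $h(s)$ at $\pi(\cdot|s)$. Let $\pi_0$ be the uniform policy, assumed feasible, and $D_{\pi'}^\pi(s)=\mathrm{KL}(\pi(\cdot|s)\,\|\,\pi'(\cdot|s))$. For $\tau\ge0$, $$Q_\tau^\pi(s,a)=\mathbb E\Big[\sum_{t\ge0}\gamma^t\big(c(s_t,a_t)+h^\pi(s_t)+\tau D_{\pi_0}^\pi(s_t)\big)\,\Big|\,s_0=s,\,a_0=a\Big]\ \text{under }\pi,\qquad V_\tau^\pi(s)=\sum_a\pi(a|s)Q_\tau^\pi(s,a),$$ $V^\pi=V^\pi_0$. Let $\pi^*$ be a feasible policy minimizing $V^\pi(s)$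 over feasible $\pi$ for all $s$ simultaneously, $\nu^*$ its stationary distribution, $f(\pi)=\mathbb E_{s\sim\nu^*}[V^\pi(s)]$. Assume that for some $\underline\pi>0$ every feasible policy satisfies $\pi(a|s)\ge\underline\pi$ for all $s,a$, and that every feasible policy induces an irreducible aperiodic state chain, with stationary distribution $\nu(\pi)$. Put $M^\pi=\mathrm{Diag}(\nu(\pi)(s)\pi(a|s))$, $\Lambda_{\min}=(1-\gamma)\inf_\pi\lambda_{\min}(M^\pi)$, $\Lambda_{\max}=(1-\gamma)\sup_\pi\lambda_{\max}(M^\pi)$ (over feasible $\pi$). **CTD.** For $z=(s,a)$, $z'=(s',a')$ let $\tilde F^\pi_\tau(\theta,(z,z'))=\big(\theta(z)-c(z)-h^\pi(s)-\tau D^\pi_{\pi_0}(s)-\gamma\theta(z')\big)e_z$, and $F_\tau^\pi(\theta)=M^\pi(\theta-T_\tau^\pi\theta)$ with $T_\tau^\pi$ the Bellman operator of $Q_\tau^\pi$. CTD with parameters $T,\alpha,\beta_t$ starts at $\theta_1=0$ and for $t=1,\dots,T$ collects $\alpha$ successive transitions under $\pi$ and sets $\theta_{t+1}=\theta_t-\beta_t\tilde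 F_\tau^\pi(\theta_t,\zeta_t^\alpha)$, $\zeta_t^\alpha$ being the last of these transitions; it returns $\theta_{T+1}$. Call $C>0$, $\rho\in(0,1)$ *mixing constants* if for all feasible $\pi$, all $\tau\ge 0$, all $\alpha\ge1$, all starting pairs $z$ and all $\theta$, $$\|F_\tau^\pi(\theta)-\mathbb E[\tilde F_\tau^\pi(\theta,\zeta^\alpha)\mid z]\|_2\le C\rho^\alpha\|\theta-Q_\tau^\pi\|_2 .$$ **SAPMD.** Starting from $\pi_0$, iteration $k=0,1,\dots$ computes an estimate $\hat Q_k$ of $Q_{\tau_k}^{\pi_k}$ by CTD for $\pi_k$, with all iterations using consecutive transitions of one single trajectory with arbitrary starting pair, and sets, for all $s$, $$\pi_{k+1}(\cdot|s)=\operatorname*{argmin}_{p\in X_s}\ \eta_k\big[\langle\hat Q_k(s,\cdot),p\rangle+h^p(s)+\tau_kD_{\pi_0}^p(s)\big]+D_{\pi_k}^p(s).$$ With $l=\lceil\log_\gamma\frac14\rceil$ put $\tau_k=\frac{1}{\sqrt{\gamma\log|\mathcal A|}}2^{-(\lfloor k/l\rfloor+1)}$, $\eta_k=\frac{1-\gamma}{\gamma\tau_k}$,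 $b=\bar c+\bar h+\tau_0\log|\mathcal A|$, $\bar\theta=\frac{b}{1-\gamma}$, $\Theta=\sup\{\|Q_\tau^\pi\|_2:\pi\text{ feasible},0\le\tau\le\tau_0\}$, $R^2=8\Theta^2+\frac{3(\Theta^2+2b^2)}{4(1+\gamma)^2}$, $\sigma_F^2=4(1+\gamma)^2R^2+\Theta^2+2b^2$, $t_0=8\max\{\Lambda_{\max}^2,8(1+\gamma)^2\}/\Lambda_{\min}^2$, $\beta_t=\frac{2}{\Lambda_{\min}(t+t_0-1)}$, $$T_k=t_0(3\bar\theta\,2^{\lfloor k/l\rfloor+2})^{2/3}+(4t_0^2\bar\theta^2\,4^{\lfloor k/l\rfloor+2})^{1/2}+24\sigma_F^2\Lambda_{\min}^{-2}\,4^{\lfloor k/l\rfloor+2},$$ $$\alpha_k=\max\Big\{2(\lfloor\tfrac kl\rfloor+2)\log_\rho\tfrac12+\log_\rho\tfrac{\Lambda_{\min}}{24CR^2},\ (\lfloor\tfrac kl\rfloor+2)\log_\rho\tfrac12+\log_\rho\tfrac{\Lambda_{\min}}{3CR^2}\Big\};$$ iteration $k$ runs CTD with $\lceil T_k\rceil$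 updates, $\max\{1,\lceil\alpha_k\rceil\}$ transitions per update and learning rates $\beta_t$. **Proposition.** Mixing constants exist. For any mixing constants $C,\rho$ and all $k\ge0$, $$\mathbb E[f(\pi_k)-f(\pi^*)]\le2^{-\lfloor k/l\rfloor}\Big[f(\pi_0)-f(\pi^*)+\tfrac{3\sqrt{\log|\mathcal A|}}{(1-\gamma)\sqrt\gamma}+\tfrac{5}{2(1-\gamma)}\Big].$$ Consequently, an $\epsilon$-solution, i.e. $\bar\pi$ with $\mathbb E[f(\bar\pi)-f(\pi^*)]\le\epsilon$, is found in $O(\log_\gamma\epsilon)$ SAPMD iterations, and the total number of sampled pairs $(s_t,a_t)$ is $$O\Big\{\big(\log_\gamma\tfrac12\big)\big(\log_2\tfrac1\epsilon\big)\Big(\log_\rho\tfrac{\Lambda_{\min}}{CR^2}\Big)\Big(\frac{t_0\bar\theta}{(1-\gamma)\epsilon}+\frac{\sigma_F^2}{(1-\gamma)^2\Lambda_{\min}^2\epsilon^2}\Big)\Big\}.$$ Here the $O$-bounds mean: for every $\kappa\in(0,1)$ there is a constant $K$ depending only on $\kappa,\bar c,\bar h$ and $|\mathcal A|$ such that, whenever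 $\gamma\ge\kappa$ and $0<\epsilon\le\min\{1-\kappa,(1-\gamma)^\kappa\}$, some iterate $\pi_k$ with $k\le K\log_\gamma\epsilon$ is an $\epsilon$-solution and, if also $\rho\ge\kappa$ and $\Lambda_{\min}/(CR^2)\le1-\kappa$, the number of samples used to compute this $\pi_k$ is at most $K$ times the expression in braces. -/

import Mathlib

/-- A finite discounted Markov decision process with convex regularizers.
`P s a s'` is the probability of moving from `s` to `s'` under action `a`, `c` is the cost, `γ` the
discount factor.  The regularizer at state `s` is the closed convex extended-valued function of the
action distribution `p` which equals `h s p` for `p ∈ X s` and `+∞` for `p ∉ X s`; thus `X s` is the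
set of action distributions that are feasible at `s`. -/
structure RegMDP (S A : Type*) [Fintype S] [Fintype A] where
  P : S → A → S → ℝ
  P_mem : ∀ s a, P s a ∈ stdSimplex ℝ S
  c : S → A → ℝ
  γ : ℝ
  γ_pos : 0 < γ
  γ_lt_one : γ < 1
  X : S → Set (A → ℝ)
  X_subset : ∀ s, X s ⊆ stdSimplex ℝ A
  X_closed : ∀ s, IsClosed (X s)
  X_convex : ∀ s, Convex ℝ (X s)
  h : S → (A → ℝ) → ℝ
  h_convex : ∀ s, ConvexOn ℝ (X s) (h s)
  h_lsc : ∀ s, LowerSemicontinuousOn (h s) (X s)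

/-- The Kullback-Leibler divergence `KL(p ‖ q)`, i.e. the Bregman distance `D_q^p`. -/
noncomputable def klDist {A : Type*} [Fintype A] (p q : A → ℝ) : ℝ :=
  ∑ a, p a * Real.log (p a / q a)

/-- The uniform distribution, used as the initial policy at every state. -/
noncomputable def uniformDist (A : Type*) [Fintype A] : A → ℝ :=
  fun _ => 1 / (Fintype.card A : ℝ)

/-- The Euclidean norm of a finite real vector. -/
noncomputable def l2norm {ι : Type*} [Fintype ι] (x : ι → ℝ) : ℝ :=
  Real.sqrt (∑ i, x i ^ 2)

namespace RegMDP

variable {S A : Type*} [Fintype S] [Fintype A] [DecidableEq S] [DecidableEq A]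

/-- `π s a` is the probability of action `a` in state `s`; feasible policies have finite `h`. -/
def Feasible (M : RegMDP S A) (π : S → A → ℝ) : Prop :=
  ∀ s, π s ∈ M.X s

/-- Transition matrix of the state process `(s_t)` under the policy `π`. -/
noncomputable def stateMatrix (M : RegMDP S A) (π : S → A → ℝ) : Matrix S S ℝ :=
  Matrix.of fun s s' => ∑ a, π s a * M.P s a s'

/-- Transition matrix of the state-action process `(s_t, a_t)` under the policy `π`. -/
noncomputable def pairMatrix (M : RegMDP S A) (π : S → A → ℝ) : Matrix (S × A) (S × A) ℝ :=
  Matrix.of fun z z' => M.P z.1 z.2 z'.1 * π z'.1 z'.2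

/-- One-stage cost `c(s,a) + h^π(s) + τ D_{π₀}^π(s)`. -/
noncomputable def stageCost (M : RegMDP S A) (τ : ℝ) (π : S → A → ℝ) (z : S × A) : ℝ :=
  M.c z.1 z.2 + M.h z.1 (π z.1) + τ * klDist (π z.1) (uniformDist A)

/-- The perturbed action-value function `Q_τ^π(s,a)`: the expected total discounted cost from
`(s_0,a_0) = (s,a)`, the law of `(s_t,a_t)` being the row `(s,a)` of the `t`-th power of the
transition matrix.  `τ = 0` gives `Q^π`. -/
noncomputable def Q (M : RegMDP S A) (τ : ℝ) (π : S → A → ℝ) (z : S × A) : ℝ :=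
  ∑' t : ℕ, M.γ ^ t * ∑ z', (M.pairMatrix π ^ t) z z' * M.stageCost τ π z'

/-- The perturbed state-value function `V_τ^π(s)`.  `τ = 0` gives `V^π`. -/
noncomputable def V (M : RegMDP S A) (τ : ℝ) (π : S → A → ℝ) (s : S) : ℝ :=
  ∑ a, π s a * M.Q τ π (s, a)

/-- `π` minimizes the (unperturbed) value function at all states simultaneously. -/
def IsOptimal (M : RegMDP S A) (π : S → A → ℝ) : Prop :=
  M.Feasible π ∧ ∀ π', M.Feasible π' → ∀ s, M.V 0 π s ≤ M.V 0 π' s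

/-- `ν` is a stationary state distribution under the policy `π`. -/
def IsStationary (M : RegMDP S A) (π : S → A → ℝ) (ν : S → ℝ) : Prop :=
  ν ∈ stdSimplex ℝ S ∧ ∀ s', ∑ s, ν s * M.stateMatrix π s s' = ν s'

/-- The objective `f(π) = E_{s ∼ ν}[V^π(s)]`. -/
noncomputable def f (M : RegMDP S A) (ν : S → ℝ) (π : S → A → ℝ) : ℝ :=
  ∑ s, ν s * M.V 0 π s

/-- Regularity of the chains of feasible policies: action probabilities are bounded below by a
positive constant, and every feasible policy induces a single ergodic (irreducible and aperiodic)
class containing all states. -/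
def Regular (M : RegMDP S A) : Prop :=
  (∃ p₀ > 0, ∀ s, ∀ p ∈ M.X s, ∀ a, p₀ ≤ p a) ∧
    ∀ π, M.Feasible π → (M.stateMatrix π).IsPrimitive

/-- The eigenvalues `ν(π)(s) π(a|s)` of the diagonal weighting matrices
`M^π = Diag(ν(π)) ⊗ Diag(π)` of all feasible policies `π`. -/
def weights (M : RegMDP S A) : Set ℝ :=
  {x | ∃ π ν s a, M.Feasible π ∧ M.IsStationary π ν ∧ x = ν s * π s a}

/-- `Λ_min = (1-γ) λ_min(M^π)`, taken as the worst case over the feasible policies. -/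
noncomputable def Lmin (M : RegMDP S A) : ℝ := (1 - M.γ) * sInf M.weights

/-- `Λ_max = (1-γ) λ_max(M^π)`, taken as the worst case over the feasible policies. -/
noncomputable def Lmax (M : RegMDP S A) : ℝ := (1 - M.γ) * sSup M.weights

/-- Bellman operator of the policy `π` for the perturbed problem. -/
noncomputable def bellman (M : RegMDP S A) (τ : ℝ) (π : S → A → ℝ) (θ : S × A → ℝ) (z : S × A) : ℝ :=
  M.stageCost τ π z + M.γ * ∑ s', M.P z.1 z.2 s' * ∑ a', π s' a' * θ (s', a')

/-- The operator `F^π(θ) = M^π (θ - T^π θ)`, where `ν` is the stationary distribution of `π`. -/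
noncomputable def F (M : RegMDP S A) (τ : ℝ) (π : S → A → ℝ) (ν : S → ℝ) (θ : S × A → ℝ) :
    S × A → ℝ :=
  fun z => ν z.1 * π z.1 z.2 * (θ z - M.bellman τ π θ z)

/-- The stochastic operator at the transition from `z = (s_t,a_t)` to `z' = (s_{t+1},a_{t+1})`:
`(θ(z) - c(z) - h^π(s_t) - τ D_{π₀}^π(s_t) - γ θ(z')) e(z)`. -/
noncomputable def Ftilde (M : RegMDP S A) (τ : ℝ) (π : S → A → ℝ) (θ : S × A → ℝ) (z z' : S × A) :
    S × A → ℝ :=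
  Pi.single z (θ z - M.stageCost τ π z - M.γ * θ z')

/-- Conditional expectation of `Ftilde` at the `α`-th transition collected under `π` when the
collection starts from the pair `z` (the `i`-th transition leads from the `(i-1)`-st to the `i`-th
pair after `z`). -/
noncomputable def meanFtilde (M : RegMDP S A) (τ : ℝ) (π : S → A → ℝ) (θ : S × A → ℝ) (α : ℕ)
    (z : S × A) : S × A → ℝ :=
  fun y => ∑ z₁, (M.pairMatrix π ^ (α - 1)) z z₁ *
    ∑ z₂, M.pairMatrix π z₁ z₂ * M.Ftilde τ π θ z₁ z₂ y

/-- `C` and `ρ` are mixing constants of temporal difference learning: the bias of the stochastic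
operator at the `α`-th transition is at most `C ρ^α ‖θ - θ*‖₂` with `θ* = Q_τ^π`, uniformly over the
feasible policies, the starting pair and the parameters. -/
def MixingConst (M : RegMDP S A) (C ρ : ℝ) : Prop :=
  0 < C ∧ 0 < ρ ∧ ρ < 1 ∧
    ∀ π ν, M.Feasible π → M.IsStationary π ν → ∀ (τ : ℝ), 0 ≤ τ →
      ∀ (α : ℕ), 1 ≤ α → ∀ (z : S × A) (θ : S × A → ℝ),
        l2norm (M.F τ π ν θ - M.meanFtilde τ π θ α z) ≤ C * ρ ^ α * l2norm (θ - M.Q τ π)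

/-- The prox-mapping at state `s`: the minimizer over feasible `p` of
`η (⟨q, p⟩ + h^p(s) + τ D_{π₀}^p(s)) + D_{p₀}^p(s)`. -/
noncomputable def prox (M : RegMDP S A) (η τ : ℝ) (s : S) (q p₀ : A → ℝ) : A → ℝ :=
  Classical.epsilon fun p => p ∈ M.X s ∧ IsMinOn
    (fun p' => η * (∑ a, q a * p' a + M.h s p' + τ * klDist p' (uniformDist A)) + klDist p' p₀)
    (M.X s) p

end RegMDP

/-- Parameters of SAPMD with CTD evaluation: perturbations `τ k`, stepsizes `η k`, number `T k` of
CTD updates and number `α k` of transitions per CTD update in iteration `k`, and CTD learning rates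
`β t` (`t ≥ 1`). -/
structure Schedule where
  τ : ℕ → ℝ
  η : ℕ → ℝ
  T : ℕ → ℕ
  α : ℕ → ℕ
  β : ℕ → ℝ

/-- Number of samples (transitions of the single trajectory) used by the first `k` iterations. -/
def Schedule.samples (σ : Schedule) (k : ℕ) : ℕ :=
  ∑ j ∈ Finset.range k, σ.T j * σ.α j

namespace RegMDP

variable {S A : Type*} [Fintype S] [Fintype A] [DecidableEq S] [DecidableEq A]

/-- The CTD parameter vector in iteration `k` along the trajectory `w`, evaluating the policy `π`:
`ctd … t` is `θ_{t+1}`, so `θ_1 = 0`, and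
`θ_{t+1} = θ_t - β_t Ftilde(θ_t, ζ_t^α)`, where `ζ_t^α` is the last of the `α_k` transitions
collected before the update. -/
noncomputable def ctd (M : RegMDP S A) (σ : Schedule) (w : ℕ → S × A) (k : ℕ) (π : S → A → ℝ) :
    ℕ → (S × A → ℝ)
  | 0 => 0
  | t + 1 =>
      M.ctd σ w k π t - σ.β (t + 1) •
        M.Ftilde (σ.τ k) π (M.ctd σ w k π t)
          (w (σ.samples k + (t + 1) * σ.α k - 1)) (w (σ.samples k + (t + 1) * σ.α k))

/-- The SAPMD iterates `π_k` along the trajectory `w`; `π_0` is uniform and `π_{k+1}` results from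
the prox-mapping with the CTD estimate `θ_{T_k+1}` of `Q_{τ_k}^{π_k}`. -/
noncomputable def iter (M : RegMDP S A) (σ : Schedule) (w : ℕ → S × A) : ℕ → (S → A → ℝ)
  | 0 => fun _ => uniformDist A
  | k + 1 => fun s =>
      M.prox (σ.η k) (σ.τ k) s
        (fun a => M.ctd σ w k (M.iter σ w k) (σ.T k) (s, a)) (M.iter σ w k s)

/-- `Z` is a single trajectory `(s_n, a_n)` generated online by the algorithm: it starts anywhere
and, while iteration `k` is running, conditionally on the past, `s_{n+1} ∼ P(· | s_n, a_n)` and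
`a_{n+1} ∼ π_k(· | s_{n+1})`. -/
def IsTrajectory (M : RegMDP S A) (σ : Schedule) {Ω : Type*} [MeasurableSpace Ω]
    (ℙ : MeasureTheory.Measure Ω) (Z : ℕ → Ω → S × A) : Prop :=
  (∀ n z, MeasurableSet {x | Z n x = z}) ∧
    ∀ k n, σ.samples k ≤ n → n < σ.samples (k + 1) → ∀ w : ℕ → S × A,
      ℙ.real {x | ∀ i ≤ n + 1, Z i x = w i} =
        ℙ.real {x | ∀ i ≤ n, Z i x = w i} *
          (M.P (w n).1 (w n).2 (w (n + 1)).1 * M.iter σ w k (w (n + 1)).1 (w (n + 1)).2)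

/-- The epoch length `l = ⌈log_γ (1/4)⌉`. -/
noncomputable def epoch (M : RegMDP S A) : ℕ := ⌈Real.logb M.γ (1 / 4)⌉₊

/-- `τ_k = 2^{-(⌊k/l⌋+1)} / √(γ log |A|)`. -/
noncomputable def tau (M : RegMDP S A) (k : ℕ) : ℝ :=
  1 / Real.sqrt (M.γ * Real.log (Fintype.card A)) * (1 / 2) ^ (k / M.epoch + 1)

/-- The bound `c̄ + h̄ + τ_0 log |A|` on the perturbed one-stage cost. -/
noncomputable def costBound (M : RegMDP S A) (cbar hbar : ℝ) : ℝ :=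
  cbar + hbar + M.tau 0 * Real.log (Fintype.card A)

/-- `θ̄ = (c̄ + h̄ + τ_0 log |A|) / (1 - γ)`. -/
noncomputable def thetaBar (M : RegMDP S A) (cbar hbar : ℝ) : ℝ :=
  M.costBound cbar hbar / (1 - M.γ)

/-- The largest `‖θ*‖₂`, `θ* = Q_τ^π`, over the feasible policies `π` and `0 ≤ τ ≤ τ_0`. -/
noncomputable def thetaStar (M : RegMDP S A) : ℝ :=
  sSup {x | ∃ π τ, M.Feasible π ∧ 0 ≤ τ ∧ τ ≤ M.tau 0 ∧ x = l2norm (M.Q τ π)}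

/-- `R² = 8 ‖θ_1 - θ*‖₂² + 3 (‖θ*‖₂² + 2 (cost bound)²) / (4 (1+γ)²)` with `θ_1 = 0`. -/
noncomputable def Rsq (M : RegMDP S A) (cbar hbar : ℝ) : ℝ :=
  8 * M.thetaStar ^ 2 +
    3 * (M.thetaStar ^ 2 + 2 * M.costBound cbar hbar ^ 2) / (4 * (1 + M.γ) ^ 2)

/-- `σ_F² = 4 (1+γ)² R² + ‖θ*‖₂² + 2 (cost bound)²`. -/
noncomputable def sigmaFsq (M : RegMDP S A) (cbar hbar : ℝ) : ℝ :=
  4 * (1 + M.γ) ^ 2 * M.Rsq cbar hbar + M.thetaStar ^ 2 + 2 * M.costBound cbar hbar ^ 2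

/-- `t_0 = 8 max {Λ_max², 8 (1+γ)²} / Λ_min²`. -/
noncomputable def t0 (M : RegMDP S A) : ℝ :=
  8 * max (M.Lmax ^ 2) (8 * (1 + M.γ) ^ 2) / M.Lmin ^ 2

/-- The real number `T_k` of the number of CTD updates (before rounding up). -/
noncomputable def Treal (M : RegMDP S A) (cbar hbar : ℝ) (k : ℕ) : ℝ :=
  M.t0 * (3 * M.thetaBar cbar hbar * 2 ^ (k / M.epoch + 2)) ^ (2 / 3 : ℝ) +
    (4 * M.t0 ^ 2 * M.thetaBar cbar hbar ^ 2 * 4 ^ (k / M.epoch + 2)) ^ (1 / 2 : ℝ) +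
    24 * M.sigmaFsq cbar hbar / M.Lmin ^ 2 * 4 ^ (k / M.epoch + 2)

/-- The real number `α_k` of transitions per CTD update (before rounding up). -/
noncomputable def alphaReal (M : RegMDP S A) (cbar hbar C ρ : ℝ) (k : ℕ) : ℝ :=
  max
    (2 * ((k / M.epoch : ℕ) + 2) * Real.logb ρ (1 / 2) +
      Real.logb ρ (M.Lmin / (24 * C * M.Rsq cbar hbar)))
    (((k / M.epoch : ℕ) + 2) * Real.logb ρ (1 / 2) +
      Real.logb ρ (M.Lmin / (3 * C * M.Rsq cbar hbar)))

/-- The parameters: `τ_k`, `η_k = (1-γ)/(γ τ_k)`, `T_k` and `α_k` rounded up (and `α_k ≥ 1`),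
`β_t = 2 / (Λ_min (t + t_0 - 1))`. -/
noncomputable def schedule (M : RegMDP S A) (cbar hbar C ρ : ℝ) : Schedule where
  τ := M.tau
  η k := (1 - M.γ) / (M.γ * M.tau k)
  T k := ⌈M.Treal cbar hbar k⌉₊
  α k := max 1 ⌈M.alphaReal cbar hbar C ρ k⌉₊
  β t := 2 / (M.Lmin * (t + M.t0 - 1))

end RegMDP

/-!
The performance-difference identity, combined with the three-point inequality of the mirror-descent
step, shows that the potential
`∑ s, ν* s * (V_τ^π s - V_τ^π* s) + τ / (1 - γ) * ∑ s, ν* s * KL(π* s ‖ π s)`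
contracts by the factor `γ` in every iteration with `η = (1 - γ) / (γ τ)`, up to a noise term
proportional to the squared evaluation error over `τ` and a bias proportional to the decrease of
`τ`. An epoch consists of `l` iterations, and `γ ^ l ≤ 1 / 4`; since `τ` halves and the tolerated
squared error is divided by four from one epoch to the next, the expected potential halves in every
epoch.

For the evaluation errors, `F_τ^π` is `Λ_min`-strongly monotone, and `α_k` transitions make the
mixing bias small against `Λ_min`, so that the mean squared error obeys the recursion of stochastic
approximation with steps `2 / (Λ_min (t + t₀ - 1))`. Mixing constants exist because each feasible
chain dominates a multiple of the chain of the uniform policy, so that some power has all its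
entries bounded below uniformly over feasible policies (Doeblin's condition).

For the complexities, about `log₂ (B / ((1 - γ) ε))` epochs suffice, with `B` depending on
`κ`, the bounds on cost and regularizer, and the number of actions; the numbers of samples grow
geometrically from epoch to epoch, and the last epoch dominates their sum.
-/

section Expectation

variable {ι : Type*} [Fintype ι] {p q : ι → ℝ} {g : ι → ℝ} {b : ℝ}

lemma sum_mul_le_of_mem_stdSimplex (hp : p ∈ stdSimplex ℝ ι) (hg : ∀ i, g i ≤ b) :
    ∑ i, p i * g i ≤ b :=
  calc ∑ i, p i * g i ≤ ∑ i, p i * b :=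
        Finset.sum_le_sum fun i _ => mul_le_mul_of_nonneg_left (hg i) (hp.1 i)
    _ = b := by rw [← Finset.sum_mul, hp.2, one_mul]

lemma le_sum_mul_of_mem_stdSimplex (hp : p ∈ stdSimplex ℝ ι) (hg : ∀ i, b ≤ g i) :
    b ≤ ∑ i, p i * g i := by
  have h := sum_mul_le_of_mem_stdSimplex hp fun i => neg_le_neg (hg i)
  simp only [mul_neg, Finset.sum_neg_distrib] at h
  linarith

lemma abs_sum_mul_le_of_mem_stdSimplex (hp : p ∈ stdSimplex ℝ ι) (hg : ∀ i, |g i| ≤ b) :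
    |∑ i, p i * g i| ≤ b :=
  abs_le.2 ⟨le_sum_mul_of_mem_stdSimplex hp fun i => (abs_le.1 (hg i)).1,
    sum_mul_le_of_mem_stdSimplex hp fun i => (abs_le.1 (hg i)).2⟩

lemma sum_mul_sub_le_of_mem_stdSimplex (hp : p ∈ stdSimplex ℝ ι) (hq : q ∈ stdSimplex ℝ ι)
    (hg : ∀ i, |g i| ≤ b) : ∑ i, g i * (p i - q i) ≤ 2 * b := by
  have hsplit : ∑ i, g i * (p i - q i) = ∑ i, p i * g i - ∑ i, q i * g i := by
    rw [← Finset.sum_sub_distrib]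
    exact Finset.sum_congr rfl fun i _ => by ring
  have hp' := (abs_le.1 (abs_sum_mul_le_of_mem_stdSimplex hp hg)).2
  have hq' := (abs_le.1 (abs_sum_mul_le_of_mem_stdSimplex hq hg)).1
  linarith

lemma nonempty_of_mem_stdSimplex (hp : p ∈ stdSimplex ℝ ι) : Nonempty ι := by
  by_contra h
  rw [not_nonempty_iff] at h
  simpa using hp.2

end Expectation

section EuclideanNorm

variable {ι : Type*} [Fintype ι]

lemma l2norm_nonneg (x : ι → ℝ) : 0 ≤ l2norm x := Real.sqrt_nonneg _

lemma l2norm_sq (x : ι → ℝ) : l2norm x ^ 2 = ∑ i, x i ^ 2 :=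
  Real.sq_sqrt (Finset.sum_nonneg fun _ _ => sq_nonneg _)

lemma abs_le_l2norm (x : ι → ℝ) (i : ι) : |x i| ≤ l2norm x :=
  Real.abs_le_sqrt <|
    Finset.single_le_sum (f := fun i => x i ^ 2) (fun _ _ => sq_nonneg _) (Finset.mem_univ i)

lemma sum_mul_le_l2norm_mul_l2norm (x y : ι → ℝ) : ∑ i, x i * y i ≤ l2norm x * l2norm y :=
  Real.sum_mul_le_sqrt_mul_sqrt _ _ _

lemma l2norm_le_sqrt_card_mul {x : ι → ℝ} {b : ℝ} (hb : 0 ≤ b) (h : ∀ i, |x i| ≤ b) :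
    l2norm x ≤ Real.sqrt (Fintype.card ι) * b := by
  refine Real.sqrt_le_iff.2 ⟨by positivity, ?_⟩
  rw [mul_pow, Real.sq_sqrt (Nat.cast_nonneg _)]
  calc ∑ i, x i ^ 2 ≤ ∑ _i : ι, b ^ 2 :=
        Finset.sum_le_sum fun i _ => sq_le_sq' (abs_le.1 (h i)).1 (abs_le.1 (h i)).2
    _ = Fintype.card ι * b ^ 2 := by simp

lemma sum_sq_section_le_l2norm_sq {κ : Type*} [Fintype κ] (x : ι × κ → ℝ) (i : ι) :
    ∑ j, x (i, j) ^ 2 ≤ l2norm x ^ 2 := by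
  rw [l2norm_sq, Fintype.sum_prod_type]
  exact Finset.single_le_sum (f := fun i => ∑ j, x (i, j) ^ 2)
    (fun _ _ => Finset.sum_nonneg fun _ _ => sq_nonneg _) (Finset.mem_univ i)

end EuclideanNorm

section Discounted

open Matrix

variable {ι : Type*} [Fintype ι] {P : Matrix ι ι ℝ} {γ : ℝ}

lemma sum_stationary_mul_eq {ν : ι → ℝ} (hν : ∀ j, ∑ i, ν i * P i j = ν j) (v : ι → ℝ) :
    ∑ i, ν i * ∑ j, P i j * v j = ∑ i, ν i * v i := by
  simp only [Finset.mul_sum, ← mul_assoc]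
  rw [Finset.sum_comm]
  simp only [← Finset.sum_mul, hν]

lemma sum_stationary_mul_eq_of_eq_add_discounted {ν : ι → ℝ} (hν : ∀ j, ∑ i, ν i * P i j = ν j)
    {v g : ι → ℝ} (hv : ∀ i, v i = g i + γ * ∑ j, P i j * v j) :
    ∑ i, ν i * g i = (1 - γ) * ∑ i, ν i * v i := by
  have hg : ∑ i, ν i * g i = ∑ i, ν i * v i - γ * ∑ i, ν i * ∑ j, P i j * v j := by
    rw [Finset.mul_sum, ← Finset.sum_sub_distrib]
    refine Finset.sum_congr rfl fun i _ => ?_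
    linear_combination -ν i * hv i
  rw [hg, sum_stationary_mul_eq hν]
  ring

variable [DecidableEq ι]

/-- The expected total discounted cost, as a function of the initial state, of a Markov chain with
transition matrix `P`, stage cost `g` and discount factor `γ`. -/
noncomputable def discountedSum (γ : ℝ) (P : Matrix ι ι ℝ) (g : ι → ℝ) (i : ι) : ℝ :=
  ∑' t : ℕ, γ ^ t * ∑ j, (P ^ t) i j * g j

lemma row_mem_stdSimplex (hP : P ∈ rowStochastic ℝ ι) (i : ι) : P i ∈ stdSimplex ℝ ι :=
  ⟨fun _ => nonneg_of_mem_rowStochastic hP, sum_row_of_mem_rowStochastic hP i⟩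

lemma abs_discounted_le (hP : P ∈ rowStochastic ℝ ι) (hγ₀ : 0 ≤ γ) {g : ι → ℝ} {b : ℝ}
    (hg : ∀ j, |g j| ≤ b) (i : ι) (t : ℕ) : |γ ^ t * ∑ j, (P ^ t) i j * g j| ≤ b * γ ^ t := by
  rw [abs_mul, abs_of_nonneg (pow_nonneg hγ₀ t), mul_comm]
  exact mul_le_mul_of_nonneg_right
    (abs_sum_mul_le_of_mem_stdSimplex (row_mem_stdSimplex (pow_mem hP t) i) hg) (pow_nonneg hγ₀ t)

lemma summable_discounted (hP : P ∈ rowStochastic ℝ ι) (hγ₀ : 0 ≤ γ) (hγ₁ : γ < 1) (g : ι → ℝ)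
    (i : ι) : Summable fun t : ℕ => γ ^ t * ∑ j, (P ^ t) i j * g j :=
  .of_norm_bounded ((summable_geometric_of_lt_one hγ₀ hγ₁).mul_left (l2norm g)) fun t =>
    abs_discounted_le hP hγ₀ (abs_le_l2norm g) i t

lemma abs_discountedSum_le (hP : P ∈ rowStochastic ℝ ι) (hγ₀ : 0 ≤ γ) (hγ₁ : γ < 1) {g : ι → ℝ}
    {b : ℝ} (hg : ∀ j, |g j| ≤ b) (i : ι) : |discountedSum γ P g i| ≤ b / (1 - γ) := by
  rw [div_eq_mul_inv, ← tsum_geometric_of_lt_one hγ₀ hγ₁, ← tsum_mul_left]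
  exact tsum_of_norm_bounded ((summable_geometric_of_lt_one hγ₀ hγ₁).mul_left b).hasSum
    fun t => (Real.norm_eq_abs _).trans_le (abs_discounted_le hP hγ₀ hg i t)

lemma discountedSum_eq_add (hP : P ∈ rowStochastic ℝ ι) (hγ₀ : 0 ≤ γ) (hγ₁ : γ < 1) (g : ι → ℝ)
    (i : ι) : discountedSum γ P g i = g i + γ * ∑ k, P i k * discountedSum γ P g k := by
  have hs := summable_discounted hP hγ₀ hγ₁ g
  have htail (t : ℕ) : γ ^ (t + 1) * ∑ j, (P ^ (t + 1)) i j * g j =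
      γ * ∑ k, P i k * (γ ^ t * ∑ j, (P ^ t) k j * g j) := by
    simp_rw [pow_succ' P, Matrix.mul_apply, Finset.sum_mul, Finset.mul_sum]
    rw [Finset.sum_comm]
    exact Finset.sum_congr rfl fun k _ => Finset.sum_congr rfl fun j _ => by ring
  simp only [discountedSum]
  rw [(hs i).tsum_eq_zero_add]
  simp_rw [htail, ← tsum_mul_left]
  rw [← Summable.tsum_finsetSum fun k _ => (hs k).mul_left (P i k), ← tsum_mul_left]
  simp [Matrix.one_apply]

lemma le_div_of_eq_add_discounted (hP : P ∈ rowStochastic ℝ ι) (hγ₀ : 0 ≤ γ) (hγ₁ : γ < 1)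
    {v g : ι → ℝ} {e : ℝ} (hv : ∀ i, v i = g i + γ * ∑ j, P i j * v j) (hg : ∀ i, g i ≤ e)
    (i : ι) : v i ≤ e / (1 - γ) := by
  have : Nonempty ι := ⟨i⟩
  obtain ⟨m, hm⟩ := Finite.exists_max v
  have hrow := sum_mul_le_of_mem_stdSimplex (row_mem_stdSimplex hP m) hm
  refine (hm i).trans ?_
  rw [le_div_iff₀ (sub_pos.2 hγ₁)]
  nlinarith [hv m, hg m, mul_le_mul_of_nonneg_left hrow hγ₀]

lemma le_add_of_eq_add_discounted (hP : P ∈ rowStochastic ℝ ι) (hγ₀ : 0 ≤ γ) (hγ₁ : γ < 1)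
    {v g : ι → ℝ} {e : ℝ} (hv : ∀ i, v i = g i + γ * ∑ j, P i j * v j) (hg : ∀ i, g i ≤ e)
    (i : ι) : v i ≤ g i + γ * (e / (1 - γ)) := by
  rw [hv i]
  gcongr
  exact sum_mul_le_of_mem_stdSimplex (row_mem_stdSimplex hP i)
    (le_div_of_eq_add_discounted hP hγ₀ hγ₁ hv hg)

end Discounted

section Divergence

variable {A : Type*} [Fintype A] {p q r : A → ℝ}

lemma sub_add_sq_div_four_le_mul_log_div {x y : ℝ} (hx₀ : 0 ≤ x) (hx₁ : x ≤ 1) (hy₀ : 0 < y)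
    (hy₁ : y ≤ 1) : x - y + (x - y) ^ 2 / 4 ≤ x * Real.log (x / y) := by
  rcases hx₀.eq_or_lt with rfl | hx
  · nlinarith
  -- `log (√y / √x) ≤ √y / √x - 1` gives `x log (x / y) ≥ x - y + (√x - √y) ^ 2`.
  obtain ⟨u, hu, rfl⟩ : ∃ u : ℝ, 0 < u ∧ u ^ 2 = x :=
    ⟨Real.sqrt x, Real.sqrt_pos.2 hx, Real.sq_sqrt hx.le⟩
  obtain ⟨v, hv, rfl⟩ : ∃ v : ℝ, 0 < v ∧ v ^ 2 = y :=
    ⟨Real.sqrt y, Real.sqrt_pos.2 hy₀, Real.sq_sqrt hy₀.le⟩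
  have hlog : Real.log (u ^ 2 / v ^ 2) = -(2 * Real.log (v / u)) := by
    rw [← div_pow, Real.log_pow, Real.log_div hu.ne' hv.ne', Real.log_div hv.ne' hu.ne']
    push_cast
    ring
  have hlog_le : u ^ 2 * Real.log (v / u) ≤ u * v - u ^ 2 := by
    calc u ^ 2 * Real.log (v / u) ≤ u ^ 2 * (v / u - 1) :=
          mul_le_mul_of_nonneg_left (Real.log_le_sub_one_of_pos (div_pos hv hu)) (sq_nonneg u)
      _ = u * v - u ^ 2 := by field_simp
  have hu₁ : u ≤ 1 := by nlinarith
  have hv₁ : v ≤ 1 := by nlinarith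
  have huv : (u + v) ^ 2 ≤ 4 := by nlinarith
  rw [hlog]
  nlinarith [mul_le_mul_of_nonneg_left huv (sq_nonneg (u - v))]

lemma sum_sq_sub_div_four_le_klDist (hp : p ∈ stdSimplex ℝ A) (hq : q ∈ stdSimplex ℝ A)
    (hq₀ : ∀ a, 0 < q a) : (∑ a, (p a - q a) ^ 2) / 4 ≤ klDist p q := by
  have h : ∑ a, (p a - q a + (p a - q a) ^ 2 / 4) ≤ klDist p q :=
    Finset.sum_le_sum fun a _ => sub_add_sq_div_four_le_mul_log_div (hp.1 a)
      (mem_Icc_of_mem_stdSimplex hp a).2 (hq₀ a) (mem_Icc_of_mem_stdSimplex hq a).2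
  rwa [Finset.sum_add_distrib, Finset.sum_sub_distrib, hp.2, hq.2, sub_self, zero_add,
    ← Finset.sum_div] at h

lemma klDist_nonneg (hp : p ∈ stdSimplex ℝ A) (hq : q ∈ stdSimplex ℝ A) (hq₀ : ∀ a, 0 < q a) :
    0 ≤ klDist p q :=
  le_trans (by positivity) (sum_sq_sub_div_four_le_klDist hp hq hq₀)

lemma klDist_self (p : A → ℝ) : klDist p p = 0 :=
  Finset.sum_eq_zero fun a _ => by
    rcases eq_or_ne (p a) 0 with h | h <;> simp [h]

lemma uniformDist_pos (a : A) : 0 < uniformDist A a :=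
  have : Nonempty A := ⟨a⟩
  one_div_pos.2 (Nat.cast_pos.2 Fintype.card_pos)

lemma uniformDist_mem_stdSimplex [Nonempty A] : uniformDist A ∈ stdSimplex ℝ A :=
  ⟨fun a => (uniformDist_pos a).le, by simp [uniformDist]⟩

lemma klDist_uniformDist_nonneg (hp : p ∈ stdSimplex ℝ A) :
    0 ≤ klDist p (uniformDist A) :=
  have := nonempty_of_mem_stdSimplex hp
  klDist_nonneg hp uniformDist_mem_stdSimplex uniformDist_pos

lemma klDist_uniformDist_le (hp : p ∈ stdSimplex ℝ A) :
    klDist p (uniformDist A) ≤ Real.log (Fintype.card A) := by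
  have := nonempty_of_mem_stdSimplex hp
  refine sum_mul_le_of_mem_stdSimplex hp fun a => ?_
  obtain ⟨hp₀, hp₁⟩ := mem_Icc_of_mem_stdSimplex hp a
  rw [uniformDist, div_div_eq_mul_div, div_one]
  rcases hp₀.eq_or_lt with h | h
  · simpa [← h] using Real.log_natCast_nonneg (Fintype.card A)
  · have hcard : (0 : ℝ) < Fintype.card A := Nat.cast_pos.2 Fintype.card_pos
    exact Real.log_le_log (mul_pos h hcard) (mul_le_of_le_one_left hcard.le hp₁)

lemma continuous_klDist_left (hq : ∀ a, 0 < q a) : Continuous fun p => klDist p q := by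
  have h : (fun p => klDist p q) =
      fun p : A → ℝ => ∑ a, q a * (p a / q a * Real.log (p a / q a)) := by
    funext p
    exact Finset.sum_congr rfl fun a _ => by rw [← mul_assoc, mul_div_cancel₀ _ (hq a).ne']
  rw [h]
  exact continuous_finsetSum _ fun a _ => continuous_const.mul <|
    Real.continuous_mul_log.comp ((continuous_apply a).div_const _)

lemma continuousAt_klDist_right (hp : ∀ a, p a ≠ 0) (hq : ∀ a, q a ≠ 0) :
    ContinuousAt (klDist p) q := by
  have h (a : A) : ContinuousAt (fun r : A → ℝ => p a * Real.log (p a / r a)) q :=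
    continuousAt_const.mul <|
      (continuousAt_const.div (continuous_apply a).continuousAt (hq a)).log
        (div_ne_zero (hp a) (hq a))
  exact tendsto_finsetSum _ fun a _ => h a

/-- The negative Shannon entropy, the mirror map whose Bregman distance is `klDist`. -/
noncomputable def negEntropy (p : A → ℝ) : ℝ :=
  ∑ a, p a * Real.log (p a)

lemma klDist_eq_negEntropy_sub (hp : ∀ a, 0 < p a) (hq : ∀ a, 0 < q a) :
    klDist p q = negEntropy p - ∑ a, p a * Real.log (q a) := by
  rw [klDist, negEntropy, ← Finset.sum_sub_distrib]
  exact Finset.sum_congr rfl fun a _ => by rw [Real.log_div (hp a).ne' (hq a).ne', mul_sub]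

lemma negEntropy_add_smul {s t : ℝ} (hp : ∀ a, 0 < p a) (hq : ∀ a, 0 < q a)
    (hr : ∀ a, 0 < (s • p + t • q) a) :
    negEntropy (s • p + t • q) = s * negEntropy p + t * negEntropy q -
      s * klDist p (s • p + t • q) - t * klDist q (s • p + t • q) := by
  rw [klDist_eq_negEntropy_sub hp hr, klDist_eq_negEntropy_sub hq hr, negEntropy]
  simp only [Pi.add_apply, Pi.smul_apply, smul_eq_mul, add_mul, mul_assoc,
    Finset.sum_add_distrib, ← Finset.mul_sum]
  ring

-- Compare the minimizer `p` with `(1 - t) p + t q`, divide by `t` and let `t → 0`.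
lemma three_point_negEntropy {X : Set (A → ℝ)} (hX : X ⊆ stdSimplex ℝ A)
    (hX₀ : ∀ p ∈ X, ∀ a, 0 < p a) {ψ : (A → ℝ) → ℝ} (hψ : ConvexOn ℝ X ψ) {c : ℝ} (hc : 0 ≤ c)
    (hp : p ∈ X) (hmin : IsMinOn (fun p => ψ p + c * negEntropy p) X p) (hq : q ∈ X) :
    ψ p + c * negEntropy p + c * klDist q p ≤ ψ q + c * negEntropy q := by
  let r (t : ℝ) : A → ℝ := (1 - t) • p + t • q
  have hle (t : ℝ) (ht : t ∈ Set.Ioc (0 : ℝ) 1) :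
      ψ p + c * negEntropy p + c * klDist q (r t) ≤ ψ q + c * negEntropy q := by
    have ht' : 0 ≤ 1 - t := sub_nonneg.2 ht.2
    have hr : r t ∈ X := hψ.1 hp hq ht' ht.1.le (by ring)
    have hconv : ψ (r t) ≤ (1 - t) * ψ p + t * ψ q := hψ.2 hp hq ht' ht.1.le (by ring)
    have hent := negEntropy_add_smul (hX₀ p hp) (hX₀ q hq) (hX₀ _ hr)
    have hkl := klDist_nonneg (hX hp) (hX hr) (hX₀ _ hr)
    have hopt : ψ p + c * negEntropy p ≤ ψ (r t) + c * negEntropy (r t) := hmin hr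
    refine le_of_mul_le_mul_left ?_ ht.1
    nlinarith [mul_nonneg hc (mul_nonneg ht' hkl)]
  have hlim : Filter.Tendsto (fun t => ψ p + c * negEntropy p + c * klDist q (r t))
      (nhdsWithin 0 (Set.Ioi 0)) (nhds (ψ p + c * negEntropy p + c * klDist q p)) := by
    have hr : Filter.Tendsto r (nhdsWithin 0 (Set.Ioi 0)) (nhds p) := by
      have : Continuous r := by fun_prop
      simpa [r] using (this.tendsto 0).mono_left nhdsWithin_le_nhds
    have hkl := continuousAt_klDist_right (fun a => (hX₀ q hq a).ne') fun a => (hX₀ p hp a).ne'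
    exact ((hkl.tendsto.comp hr).const_mul c).const_add _
  exact le_of_tendsto hlim <| Filter.eventually_of_mem (Ioc_mem_nhdsGT zero_lt_one) hle

end Divergence

namespace RegMDP

variable {S A : Type*} [Fintype S] [Fintype A] {M : RegMDP S A} {π π' : S → A → ℝ} {τ : ℝ}

lemma one_sub_γ_pos (M : RegMDP S A) : 0 < 1 - M.γ := sub_pos.2 M.γ_lt_one

lemma Feasible.mem_stdSimplex (hπ : M.Feasible π) (s : S) : π s ∈ stdSimplex ℝ A :=
  M.X_subset s (hπ s)

lemma Feasible.nonneg (hπ : M.Feasible π) (s : S) (a : A) : 0 ≤ π s a :=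
  (hπ.mem_stdSimplex s).1 a

lemma Feasible.sum_eq_one (hπ : M.Feasible π) (s : S) : ∑ a, π s a = 1 :=
  (hπ.mem_stdSimplex s).2

lemma sum_pairMatrix_mul (M : RegMDP S A) (π : S → A → ℝ) (θ : S × A → ℝ) (z : S × A) :
    ∑ z', M.pairMatrix π z z' * θ z' = ∑ s', M.P z.1 z.2 s' * ∑ a', π s' a' * θ (s', a') := by
  simp only [pairMatrix, Matrix.of_apply, Fintype.sum_prod_type, Finset.mul_sum, mul_assoc]

lemma sum_stateMatrix_mul (M : RegMDP S A) (π : S → A → ℝ) (v : S → ℝ) (s : S) :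
    ∑ s', M.stateMatrix π s s' * v s' = ∑ a, π s a * ∑ s', M.P s a s' * v s' := by
  simp only [stateMatrix, Matrix.of_apply, Finset.sum_mul, Finset.mul_sum, mul_assoc]
  rw [Finset.sum_comm]

lemma bellman_eq (M : RegMDP S A) (τ : ℝ) (π : S → A → ℝ) (θ : S × A → ℝ) (z : S × A) :
    M.bellman τ π θ z = M.stageCost τ π z + M.γ * ∑ z', M.pairMatrix π z z' * θ z' := by
  rw [bellman, sum_pairMatrix_mul]

section Value

variable [DecidableEq S]

lemma Feasible.stateMatrix_mem_rowStochastic (hπ : M.Feasible π) :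
    M.stateMatrix π ∈ Matrix.rowStochastic ℝ S := by
  rw [Matrix.mem_rowStochastic_iff_sum]
  refine ⟨fun s s' => Finset.sum_nonneg fun a _ => mul_nonneg (hπ.nonneg _ _) ((M.P_mem _ _).1 _),
    fun s => ?_⟩
  simpa [(M.P_mem _ _).2, hπ.sum_eq_one] using M.sum_stateMatrix_mul π (fun _ => 1) s

variable [DecidableEq A]

lemma Feasible.pairMatrix_mem_rowStochastic (hπ : M.Feasible π) :
    M.pairMatrix π ∈ Matrix.rowStochastic ℝ (S × A) := by
  rw [Matrix.mem_rowStochastic_iff_sum]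
  refine ⟨fun z z' => mul_nonneg ((M.P_mem _ _).1 _) (hπ.nonneg _ _), fun z => ?_⟩
  simpa [(M.P_mem _ _).2, hπ.sum_eq_one] using M.sum_pairMatrix_mul π (fun _ => 1) z

lemma Feasible.Q_eq (hπ : M.Feasible π) (z : S × A) :
    M.Q τ π z = M.stageCost τ π z + M.γ * ∑ z', M.pairMatrix π z z' * M.Q τ π z' :=
  discountedSum_eq_add hπ.pairMatrix_mem_rowStochastic M.γ_pos.le M.γ_lt_one _ z

lemma Feasible.Q_eq_V (hπ : M.Feasible π) (s : S) (a : A) :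
    M.Q τ π (s, a) = M.stageCost τ π (s, a) + M.γ * ∑ s', M.P s a s' * M.V τ π s' := by
  rw [hπ.Q_eq, sum_pairMatrix_mul]
  rfl

lemma Feasible.abs_Q_le (hπ : M.Feasible π) {b : ℝ} (hb : ∀ z, |M.stageCost τ π z| ≤ b)
    (z : S × A) : |M.Q τ π z| ≤ b / (1 - M.γ) :=
  abs_discountedSum_le hπ.pairMatrix_mem_rowStochastic M.γ_pos.le M.γ_lt_one hb z

/-- The perturbed advantage of playing `p` instead of `π` at the single stage spent in `s`. -/
noncomputable def advantage (M : RegMDP S A) (τ : ℝ) (π : S → A → ℝ) (s : S) (p : A → ℝ) : ℝ :=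
  ∑ a, M.Q τ π (s, a) * (p a - π s a) + (M.h s p - M.h s (π s)) +
    τ * (klDist p (uniformDist A) - klDist (π s) (uniformDist A))

lemma advantage_self (M : RegMDP S A) (τ : ℝ) (π : S → A → ℝ) (s : S) :
    M.advantage τ π s (π s) = 0 := by
  simp [advantage]

lemma V_sub_V_eq_advantage_add (hπ : M.Feasible π) (hπ' : M.Feasible π') (s : S) :
    M.V τ π' s - M.V τ π s =
      M.advantage τ π s (π' s) +
        M.γ * ∑ s', M.stateMatrix π' s s' * (M.V τ π' s' - M.V τ π s') := by
  have hQ (a : A) : M.Q τ π' (s, a) - M.Q τ π (s, a) =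
      (M.h s (π' s) - M.h s (π s)) +
        τ * (klDist (π' s) (uniformDist A) - klDist (π s) (uniformDist A)) +
        M.γ * ∑ s', M.P s a s' * (M.V τ π' s' - M.V τ π s') := by
    simp only [hπ.Q_eq_V, hπ'.Q_eq_V, stageCost, mul_sub, Finset.sum_sub_distrib]
    ring
  have hV : M.V τ π' s - M.V τ π s = ∑ a, π' s a * (M.Q τ π' (s, a) - M.Q τ π (s, a)) +
      ∑ a, M.Q τ π (s, a) * (π' s a - π s a) := by
    simp only [V, ← Finset.sum_sub_distrib, ← Finset.sum_add_distrib]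
    exact Finset.sum_congr rfl fun a _ => by ring
  rw [hV]
  simp only [hQ, mul_add, Finset.sum_add_distrib, ← Finset.sum_mul, hπ'.sum_eq_one,
    sum_stateMatrix_mul, advantage, one_mul, Finset.mul_sum, mul_left_comm M.γ]
  ring

end Value

section Prox

variable {η : ℝ} {s : S} {q p₀ : A → ℝ}

/-- The function minimized over `M.X s` by `M.prox η τ s q p₀`. -/
noncomputable def proxObj (M : RegMDP S A) (η τ : ℝ) (s : S) (q p₀ p : A → ℝ) : ℝ :=
  η * (∑ a, q a * p a + M.h s p + τ * klDist p (uniformDist A)) + klDist p p₀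

lemma prox_spec (hη : 0 ≤ η) (hp₀ : p₀ ∈ M.X s) (hpos : ∀ a, 0 < p₀ a) :
    M.prox η τ s q p₀ ∈ M.X s ∧ IsMinOn (M.proxObj η τ s q p₀) (M.X s) (M.prox η τ s q p₀) := by
  refine Classical.epsilon_spec (p := fun p => p ∈ M.X s ∧ IsMinOn (M.proxObj η τ s q p₀) (M.X s) p)
    (LowerSemicontinuousOn.exists_isMinOn ⟨p₀, hp₀⟩
      ((isCompact_stdSimplex ℝ A).of_isClosed_subset (M.X_closed s) (M.X_subset s)) ?_)
  have hsmooth : Continuous fun p : A → ℝ =>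
      η * (∑ a, q a * p a + τ * klDist p (uniformDist A)) + klDist p p₀ := by
    have := continuous_klDist_left (uniformDist_pos (A := A))
    have := continuous_klDist_left hpos
    fun_prop
  have hreg : LowerSemicontinuousOn (fun p => η * M.h s p) (M.X s) :=
    (continuous_const_mul η).comp_lowerSemicontinuousOn (M.h_lsc s)
      (fun _ _ h => mul_le_mul_of_nonneg_left h hη)
  convert (hsmooth.lowerSemicontinuous.lowerSemicontinuousOn (M.X s)).add hreg using 2 with p
  simp only [proxObj]
  ring

lemma proxObj_prox_add_klDist_le (hη : 0 ≤ η) (hτ : 0 ≤ τ)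
    (hX : ∀ p ∈ M.X s, ∀ a, 0 < p a) (hp₀ : p₀ ∈ M.X s) {p : A → ℝ} (hp : p ∈ M.X s) :
    M.proxObj η τ s q p₀ (M.prox η τ s q p₀) + (1 + η * τ) * klDist p (M.prox η τ s q p₀) ≤
      M.proxObj η τ s q p₀ p := by
  obtain ⟨hmem, hmin⟩ := M.prox_spec (τ := τ) (q := q) hη hp₀ (hX p₀ hp₀)
  let ψ (p : A → ℝ) : ℝ :=
    ∑ a, (η * q a - η * τ * Real.log (uniformDist A a) - Real.log (p₀ a)) * p a + η * M.h s p
  have hobj : ∀ p ∈ M.X s, M.proxObj η τ s q p₀ p = ψ p + (1 + η * τ) * negEntropy p := by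
    intro p hp
    rw [proxObj, klDist_eq_negEntropy_sub (hX p hp) uniformDist_pos,
      klDist_eq_negEntropy_sub (hX p hp) (hX p₀ hp₀)]
    simp only [ψ, sub_mul, Finset.sum_sub_distrib, mul_assoc, ← Finset.mul_sum,
      mul_comm (Real.log _)]
    ring
  have hψ : ConvexOn ℝ (M.X s) ψ :=
    ((Fintype.linearCombination ℝ (M := ℝ) fun a => η * q a -
      η * τ * Real.log (uniformDist A a) - Real.log (p₀ a)).convexOn (M.X_convex s)).congr
        (fun p _ => by simp [Fintype.linearCombination_apply, mul_comm])
      |>.add ((M.h_convex s).smul hη)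
  have hmin' : IsMinOn (fun p => ψ p + (1 + η * τ) * negEntropy p) (M.X s)
      (M.prox η τ s q p₀) := by
    intro p hp
    simpa only [Set.mem_ofPred_eq, ← hobj p hp, ← hobj _ hmem] using hmin hp
  rw [hobj p hp, hobj _ hmem]
  exact three_point_negEntropy (M.X_subset s) hX hψ (by positivity) hmem hmin' hp

end Prox

end RegMDP

section Young

variable {ι : Type*} [Fintype ι]

lemma neg_mul_sum_mul_le (η : ℝ) (x y : ι → ℝ) :
    -(η * ∑ i, x i * y i) ≤ η ^ 2 * ∑ i, x i ^ 2 + (∑ i, y i ^ 2) / 4 := by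
  rw [Finset.mul_sum, Finset.mul_sum, Finset.sum_div, ← Finset.sum_neg_distrib,
    ← Finset.sum_add_distrib]
  exact Finset.sum_le_sum fun i _ => by nlinarith [sq_nonneg (η * x i + y i / 2)]

end Young

namespace RegMDP

variable {S A : Type*} [Fintype S] [Fintype A] {M : RegMDP S A} {π πs : S → A → ℝ} {τ η : ℝ}
  {ν : S → ℝ} {θ : S × A → ℝ}

/-- The policy mirror descent update of `π` with stepsize `η`, perturbation `τ` and estimate `θ` of
the action-value function. -/
noncomputable def mirrorUpdate (M : RegMDP S A) (η τ : ℝ) (π : S → A → ℝ) (θ : S × A → ℝ) :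
    S → A → ℝ :=
  fun s => M.prox η τ s (fun a => θ (s, a)) (π s)

lemma Feasible.mirrorUpdate (hπ : M.Feasible π)
    (hpos : ∀ s, ∀ p ∈ M.X s, ∀ a, 0 < p a) (hη : 0 ≤ η) :
    M.Feasible (M.mirrorUpdate η τ π θ) := fun s =>
  (prox_spec hη (hπ s) (hpos s _ (hπ s))).1

variable [DecidableEq S] [DecidableEq A]

lemma advantage_mirrorUpdate_add_le (hpos : ∀ s, ∀ p ∈ M.X s, ∀ a, 0 < p a)
    (hπ : M.Feasible π) (hη : 0 ≤ η) (hτ : 0 ≤ τ) {s : S} {p : A → ℝ} (hp : p ∈ M.X s) :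
    η * M.advantage τ π s (M.mirrorUpdate η τ π θ s) +
        (1 + η * τ) * klDist p (M.mirrorUpdate η τ π θ s) ≤
      η * M.advantage τ π s p + η * ∑ a, (θ - M.Q τ π) (s, a) * (p a - π s a) +
        η ^ 2 * l2norm (θ - M.Q τ π) ^ 2 + klDist p (π s) := by
  have hprox : M.proxObj η τ s (fun a => θ (s, a)) (π s) (M.mirrorUpdate η τ π θ s) +
      (1 + η * τ) * klDist p (M.mirrorUpdate η τ π θ s) ≤
      M.proxObj η τ s (fun a => θ (s, a)) (π s) p :=
    proxObj_prox_add_klDist_le hη hτ (hpos s) (hπ s) hp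
  have hfeas : M.Feasible (M.mirrorUpdate η τ π θ) := hπ.mirrorUpdate hpos hη
  set p' := M.mirrorUpdate η τ π θ s
  set δ := θ - M.Q τ π with hδ
  have hsplit (r : A → ℝ) : ∑ a, θ (s, a) * r a = ∑ a, M.Q τ π (s, a) * (r a - π s a) +
      ∑ a, δ (s, a) * (r a - π s a) + ∑ a, θ (s, a) * π s a := by
    simp only [← Finset.sum_add_distrib]
    refine Finset.sum_congr rfl fun a _ => ?_
    simp only [hδ, Pi.sub_apply]
    ring
  have hyoung := neg_mul_sum_mul_le η (fun a => δ (s, a)) fun a => p' a - π s a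
  have hpinsker := sum_sq_sub_div_four_le_klDist (hfeas.mem_stdSimplex s) (hπ.mem_stdSimplex s)
    (hpos s _ (hπ s))
  have hsection := mul_le_mul_of_nonneg_left (sum_sq_section_le_l2norm_sq δ s) (sq_nonneg η)
  simp only [proxObj, hsplit p, hsplit p'] at hprox
  simp only [advantage]
  linarith

lemma advantage_mirrorUpdate_le (hpos : ∀ s, ∀ p ∈ M.X s, ∀ a, 0 < p a)
    (hπ : M.Feasible π) (hη : 0 < η) (hτ : 0 ≤ τ) (s : S) :
    M.advantage τ π s (M.mirrorUpdate η τ π θ s) ≤ η * l2norm (θ - M.Q τ π) ^ 2 := by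
  have hstep := advantage_mirrorUpdate_add_le (θ := θ) hpos hπ hη.le hτ (hπ s)
  have hfeas : M.Feasible (M.mirrorUpdate η τ π θ) := hπ.mirrorUpdate hpos hη.le
  have hkl := klDist_nonneg (hπ.mem_stdSimplex s) (hfeas.mem_stdSimplex s) (hpos s _ (hfeas s))
  simp only [advantage_self, klDist_self, sub_self, mul_zero, Finset.sum_const_zero, zero_add,
    add_zero] at hstep
  refine le_of_mul_le_mul_left ?_ hη
  nlinarith [mul_nonneg (add_nonneg zero_le_one (mul_nonneg hη.le hτ)) hkl]

lemma V_mirrorUpdate_sub_V_le (hpos : ∀ s, ∀ p ∈ M.X s, ∀ a, 0 < p a)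
    (hπ : M.Feasible π) (hη : 0 < η) (hτ : 0 ≤ τ) {s : S} {p : A → ℝ} (hp : p ∈ M.X s) :
    M.V τ (M.mirrorUpdate η τ π θ) s - M.V τ π s ≤
      M.advantage τ π s p + 2 * l2norm (θ - M.Q τ π) +
        η * l2norm (θ - M.Q τ π) ^ 2 / (1 - M.γ) +
        (klDist p (π s) - (1 + η * τ) * klDist p (M.mirrorUpdate η τ π θ s)) / η := by
  have hfeas : M.Feasible (M.mirrorUpdate η τ π θ) := hπ.mirrorUpdate hpos hη.le
  have hadv := advantage_mirrorUpdate_add_le (θ := θ) hpos hπ hη.le hτ hp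
  have hdisc := le_add_of_eq_add_discounted hfeas.stateMatrix_mem_rowStochastic M.γ_pos.le
    M.γ_lt_one (V_sub_V_eq_advantage_add (τ := τ) hπ hfeas)
    (advantage_mirrorUpdate_le hpos hπ hη hτ) s
  have herr := sum_mul_sub_le_of_mem_stdSimplex (M.X_subset s hp) (hπ.mem_stdSimplex s)
    fun a => abs_le_l2norm (θ - M.Q τ π) (s, a)
  set δ := l2norm (θ - M.Q τ π)
  have hgeom : η * δ ^ 2 + M.γ * (η * δ ^ 2 / (1 - M.γ)) = η * δ ^ 2 / (1 - M.γ) := by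
    field_simp [M.one_sub_γ_pos.ne']
    ring
  have hadv' : M.advantage τ π s (M.mirrorUpdate η τ π θ s) ≤ M.advantage τ π s p + 2 * δ +
      η * δ ^ 2 + (klDist p (π s) - (1 + η * τ) * klDist p (M.mirrorUpdate η τ π θ s)) / η := by
    refine le_of_mul_le_mul_left ?_ hη
    rw [mul_add, mul_div_cancel₀ _ hη.ne']
    nlinarith [mul_le_mul_of_nonneg_left herr hη.le]
  linarith

/-- The Lyapunov function of mirror descent: the perturbed optimality gap of `π` relative to `πs`,
averaged over `ν`, plus the weighted divergence between the two policies. -/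
noncomputable def potential (M : RegMDP S A) (ν : S → ℝ) (πs : S → A → ℝ) (τ : ℝ)
    (π : S → A → ℝ) : ℝ :=
  ∑ s, ν s * (M.V τ π s - M.V τ πs s) + τ / (1 - M.γ) * ∑ s, ν s * klDist (πs s) (π s)

lemma IsStationary.sum_advantage_eq (hν : M.IsStationary πs ν) (hπ : M.Feasible π)
    (hπs : M.Feasible πs) : ∑ s, ν s * M.advantage τ π s (πs s) =
      -((1 - M.γ) * ∑ s, ν s * (M.V τ π s - M.V τ πs s)) := by
  rw [sum_stationary_mul_eq_of_eq_add_discounted hν.2 (V_sub_V_eq_advantage_add (τ := τ) hπ hπs),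
    ← mul_neg, ← Finset.sum_neg_distrib]
  simp only [← mul_neg, neg_sub]

lemma potential_mirrorUpdate_le (hpos : ∀ s, ∀ p ∈ M.X s, ∀ a, 0 < p a)
    (hπ : M.Feasible π) (hπs : M.Feasible πs) (hν : M.IsStationary πs ν) (hτ : 0 < τ) :
    M.potential ν πs τ (M.mirrorUpdate ((1 - M.γ) / (M.γ * τ)) τ π θ) ≤
      M.γ * M.potential ν πs τ π +
        (2 * l2norm (θ - M.Q τ π) + l2norm (θ - M.Q τ π) ^ 2 / (M.γ * τ)) := by
  have hγ := M.γ_pos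
  have hγ' := M.one_sub_γ_pos
  set η := (1 - M.γ) / (M.γ * τ) with hη
  have hητ : 1 + η * τ = 1 / M.γ := by
    rw [hη]
    field_simp
    ring
  set π' := M.mirrorUpdate η τ π θ
  set δ := l2norm (θ - M.Q τ π)
  have hstate (s : S) : M.V τ π' s - M.V τ π s ≤ M.advantage τ π s (πs s) +
      (2 * δ + δ ^ 2 / (M.γ * τ)) + M.γ * (τ / (1 - M.γ)) * klDist (πs s) (π s) -
        τ / (1 - M.γ) * klDist (πs s) (π' s) := by
    have hV : M.V τ π' s - M.V τ π s ≤ M.advantage τ π s (πs s) + 2 * δ + η * δ ^ 2 / (1 - M.γ) +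
        (klDist (πs s) (π s) - (1 + η * τ) * klDist (πs s) (π' s)) / η :=
      V_mirrorUpdate_sub_V_le hpos hπ (by positivity) hτ.le (hπs s)
    refine hV.trans_eq ?_
    rw [hητ, hη]
    field_simp
    ring
  have hsum := Finset.sum_le_sum fun s (_ : s ∈ Finset.univ) =>
    mul_le_mul_of_nonneg_left (hstate s) (hν.1.1 s)
  have hadv := hν.sum_advantage_eq (τ := τ) hπ hπs
  simp only [potential]
  simp only [mul_add, mul_sub, Finset.sum_add_distrib, Finset.sum_sub_distrib, ← Finset.sum_mul,
    hν.1.2, one_mul, mul_left_comm (ν _), ← Finset.mul_sum] at hsum hadv ⊢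
  linarith

end RegMDP

section Stationary

open Matrix

variable {ι : Type*} [Fintype ι] {P : Matrix ι ι ℝ} {μ : ι → ℝ}

lemma sum_stationary_mul_mul_le (hP₀ : ∀ i j, 0 ≤ P i j) (hP₁ : ∀ i, ∑ j, P i j = 1)
    (hμ₀ : ∀ i, 0 ≤ μ i) (hμP : ∀ j, ∑ i, μ i * P i j = μ j) (x : ι → ℝ) :
    ∑ i, μ i * ∑ j, P i j * (x i * x j) ≤ ∑ i, μ i * x i ^ 2 := by
  have hrow (i : ι) : ∑ j, P i j * (x i * x j) ≤ x i ^ 2 / 2 + ∑ j, P i j * (x j ^ 2 / 2) :=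
    calc ∑ j, P i j * (x i * x j) ≤ ∑ j, P i j * (x i ^ 2 / 2 + x j ^ 2 / 2) :=
          Finset.sum_le_sum fun j _ => mul_le_mul_of_nonneg_left
            (by linarith [two_mul_le_add_sq (x i) (x j)]) (hP₀ i j)
      _ = x i ^ 2 / 2 + ∑ j, P i j * (x j ^ 2 / 2) := by
          simp only [mul_add, Finset.sum_add_distrib, ← Finset.sum_mul, hP₁, one_mul]
  calc ∑ i, μ i * ∑ j, P i j * (x i * x j)
      ≤ ∑ i, μ i * (x i ^ 2 / 2 + ∑ j, P i j * (x j ^ 2 / 2)) :=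
        Finset.sum_le_sum fun i _ => mul_le_mul_of_nonneg_left (hrow i) (hμ₀ i)
    _ = ∑ i, μ i * (x i ^ 2 / 2) + ∑ i, μ i * (x i ^ 2 / 2) := by
        simp only [mul_add, Finset.sum_add_distrib, sum_stationary_mul_eq hμP]
    _ = ∑ i, μ i * x i ^ 2 := by
        rw [← Finset.sum_add_distrib]
        exact Finset.sum_congr rfl fun i _ => by ring

variable [DecidableEq ι]

-- The absolute value of a left fixed vector is again fixed, because `P` preserves total mass.
lemma exists_stationary_of_mem_rowStochastic [Nonempty ι] (hP : P ∈ rowStochastic ℝ ι) :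
    ∃ ν ∈ stdSimplex ℝ ι, ∀ j, ∑ i, ν i * P i j = ν j := by
  obtain ⟨v, hv₀, hv⟩ : ∃ v ≠ 0, v ᵥ* (P - 1) = 0 := by
    refine exists_vecMul_eq_zero_iff.2 (exists_mulVec_eq_zero_iff.1 ⟨1, one_ne_zero, ?_⟩)
    rw [sub_mulVec, (mem_rowStochastic.1 hP).2, one_mulVec, sub_self]
  have hvP (j : ι) : ∑ i, v i * P i j = v j := by
    have h := congrFun hv j
    rwa [vecMul_sub, vecMul_one, Pi.sub_apply, Pi.zero_apply, sub_eq_zero] at h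
  have hle (j : ι) : |v j| ≤ ∑ i, |v i| * P i j :=
    calc |v j| = |∑ i, v i * P i j| := by rw [hvP]
      _ ≤ ∑ i, |v i * P i j| := Finset.abs_sum_le_sum_abs _ _
      _ = ∑ i, |v i| * P i j := by
          simp only [abs_mul, abs_of_nonneg (nonneg_of_mem_rowStochastic hP)]
  have hsum : ∑ j, ∑ i, |v i| * P i j = ∑ j, |v j| := by
    rw [Finset.sum_comm]
    simp only [← Finset.mul_sum, sum_row_of_mem_rowStochastic hP, mul_one]
  have heq (j : ι) : |v j| = ∑ i, |v i| * P i j :=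
    (Finset.sum_eq_sum_iff_of_le fun j _ => hle j).1 hsum.symm j (Finset.mem_univ j)
  have hpos : 0 < ∑ i, |v i| := by
    obtain ⟨i, hi⟩ := Function.ne_iff.1 hv₀
    exact Finset.sum_pos' (fun _ _ => abs_nonneg _) ⟨i, Finset.mem_univ i, abs_pos.2 hi⟩
  refine ⟨fun i => |v i| / ∑ i, |v i|, ⟨fun i => by positivity, ?_⟩, fun j => ?_⟩
  · rw [← Finset.sum_div, div_self hpos.ne']
  · simp only [div_mul_eq_mul_div]
    rw [← Finset.sum_div, ← heq j]

lemma sum_stationary_mul_pow_eq (hμP : ∀ j, ∑ i, μ i * P i j = μ j) (n : ℕ) (j : ι) :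
    ∑ i, μ i * (P ^ n) i j = μ j := by
  induction n with
  | zero => simp [Matrix.one_apply]
  | succ n ih =>
    simp only [pow_succ', Matrix.mul_apply]
    rw [sum_stationary_mul_eq hμP, ih]

-- Splitting off `ε μ` from each row of `P ^ n` leaves a nonnegative matrix with row sums `1 - ε`.
lemma abs_pow_mul_add_sub_stationary_le (hP : P ∈ rowStochastic ℝ ι) (hμ : μ ∈ stdSimplex ℝ ι)
    (hμP : ∀ j, ∑ i, μ i * P i j = μ j) {n : ℕ} {ε : ℝ} (hε : 0 ≤ ε)
    (hmin : ∀ i j, ε ≤ (P ^ n) i j) (q r : ℕ) (i j : ι) :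
    |(P ^ (q * n + r)) i j - μ j| ≤ (1 - ε) ^ q := by
  induction q generalizing i with
  | zero =>
    have hP' := mem_Icc_of_mem_stdSimplex (row_mem_stdSimplex (pow_mem hP r) i) j
    have hμ' := mem_Icc_of_mem_stdSimplex hμ j
    rw [zero_mul, zero_add, pow_zero, abs_le]
    constructor <;> linarith [hP'.1, hP'.2, hμ'.1, hμ'.2]
  | succ q ih =>
    have hsum := sum_row_of_mem_rowStochastic (pow_mem hP n)
    have hsplit : (P ^ ((q + 1) * n + r)) i j - μ j =
        ∑ k, ((P ^ n) i k - ε * μ k) * ((P ^ (q * n + r)) k j - μ j) := by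
      rw [show (q + 1) * n + r = n + (q * n + r) by ring, pow_add P n, Matrix.mul_apply]
      simp only [sub_mul, mul_sub, Finset.sum_sub_distrib, ← Finset.sum_mul, hsum, mul_assoc,
        ← Finset.mul_sum, sum_stationary_mul_pow_eq hμP, hμ.2]
      ring
    have hnonneg (k : ι) : 0 ≤ (P ^ n) i k - ε * μ k := by
      nlinarith [hmin i k, (mem_Icc_of_mem_stdSimplex hμ k).2]
    rw [hsplit]
    calc |∑ k, ((P ^ n) i k - ε * μ k) * ((P ^ (q * n + r)) k j - μ j)|
        ≤ ∑ k, ((P ^ n) i k - ε * μ k) * (1 - ε) ^ q := by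
          refine (Finset.abs_sum_le_sum_abs _ _).trans (Finset.sum_le_sum fun k _ => ?_)
          rw [abs_mul, abs_of_nonneg (hnonneg k)]
          exact mul_le_mul_of_nonneg_left (ih k) (hnonneg k)
      _ = (1 - ε) ^ (q + 1) := by
          rw [← Finset.sum_mul, Finset.sum_sub_distrib, ← Finset.mul_sum, hsum, hμ.2, pow_succ]
          ring

lemma abs_pow_sub_stationary_le (hP : P ∈ rowStochastic ℝ ι) (hμ : μ ∈ stdSimplex ℝ ι)
    (hμP : ∀ j, ∑ i, μ i * P i j = μ j) {n : ℕ} (hn : 0 < n) {ρ : ℝ} (hρ₀ : 0 < ρ) (hρ₁ : ρ ≤ 1)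
    (hmin : ∀ i j, 1 - ρ ^ n ≤ (P ^ n) i j) (t : ℕ) (i j : ι) :
    |(P ^ t) i j - μ j| ≤ ρ ^ t / ρ ^ n := by
  have h := abs_pow_mul_add_sub_stationary_le hP hμ hμP
    (sub_nonneg.2 (pow_le_one₀ hρ₀.le hρ₁)) hmin (t / n) (t % n) i j
  rw [Nat.div_add_mod', sub_sub_cancel, ← pow_mul] at h
  refine h.trans ?_
  rw [le_div_iff₀ (pow_pos hρ₀ n), ← pow_add]
  refine pow_le_pow_of_le_one hρ₀.le hρ₁ ?_
  have := Nat.div_add_mod t n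
  have := Nat.mod_lt t hn
  omega

lemma pow_mul_pow_apply_le {B : Matrix ι ι ℝ} {c : ℝ} (hc : 0 ≤ c) (hB : ∀ i j, 0 ≤ B i j)
    (h : ∀ i j, c * B i j ≤ P i j) (n : ℕ) (i j : ι) : c ^ n * (B ^ n) i j ≤ (P ^ n) i j := by
  have hBn (n : ℕ) (i j : ι) : 0 ≤ (B ^ n) i j := Matrix.pow_apply_nonneg hB n i j
  induction n generalizing j with
  | zero => simp
  | succ n ih =>
    simp only [pow_succ, Matrix.mul_apply, Finset.mul_sum]
    refine Finset.sum_le_sum fun k _ => ?_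
    have hnonneg : 0 ≤ c ^ n * (B ^ n) i k := mul_nonneg (pow_nonneg hc n) (hBn n i k)
    calc c ^ n * c * ((B ^ n) i k * B k j) = c ^ n * (B ^ n) i k * (c * B k j) := by ring
      _ ≤ (P ^ n) i k * P k j :=
        mul_le_mul (ih k) (h k j) (mul_nonneg hc (hB k j)) (hnonneg.trans (ih k))

end Stationary

namespace RegMDP

variable {S A : Type*} [Fintype S] [Fintype A] {M : RegMDP S A} {π π₀ : S → A → ℝ} {ν : S → ℝ}
  {τ : ℝ}

lemma IsStationary.pair_mem_stdSimplex (hν : M.IsStationary π ν) (hπ : M.Feasible π) :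
    (fun z : S × A => ν z.1 * π z.1 z.2) ∈ stdSimplex ℝ (S × A) := by
  refine ⟨fun z => mul_nonneg (hν.1.1 _) (hπ.nonneg _ _), ?_⟩
  simp only [Fintype.sum_prod_type, ← Finset.mul_sum, hπ.sum_eq_one, mul_one]
  exact hν.1.2

lemma IsStationary.sum_mul_pairMatrix (hν : M.IsStationary π ν) (z' : S × A) :
    ∑ z : S × A, ν z.1 * π z.1 z.2 * M.pairMatrix π z z' = ν z'.1 * π z'.1 z'.2 := by
  rw [← hν.2 z'.1]
  simp only [Fintype.sum_prod_type, pairMatrix, stateMatrix, Matrix.of_apply, Finset.mul_sum,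
    Finset.sum_mul, mul_assoc]

lemma weights_subset_Icc (M : RegMDP S A) : M.weights ⊆ Set.Icc 0 1 := by
  rintro x ⟨π, ν, s, a, hπ, hν, rfl⟩
  exact mem_Icc_of_mem_stdSimplex (hν.pair_mem_stdSimplex hπ) (s, a)

lemma sInf_weights_le {x : ℝ} (hx : x ∈ M.weights) : sInf M.weights ≤ x :=
  csInf_le ⟨0, fun _ h => (M.weights_subset_Icc h).1⟩ hx

lemma Lmax_nonneg (M : RegMDP S A) : 0 ≤ M.Lmax :=
  mul_nonneg M.one_sub_γ_pos.le (Real.sSup_nonneg fun _ hx => (M.weights_subset_Icc hx).1)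

lemma Lmax_le_one (M : RegMDP S A) : M.Lmax ≤ 1 :=
  mul_le_one₀ (by linarith [M.γ_pos]) (Real.sSup_nonneg fun _ hx => (M.weights_subset_Icc hx).1)
    (Real.sSup_le (fun _ hx => (M.weights_subset_Icc hx).2) zero_le_one)

lemma Feasible.exists_isStationary [Nonempty S] (hπ : M.Feasible π) :
    ∃ ν, M.IsStationary π ν := by
  classical
  exact exists_stationary_of_mem_rowStochastic hπ.stateMatrix_mem_rowStochastic

lemma Feasible.weights_nonempty [Nonempty S] (hπ : M.Feasible π) : M.weights.Nonempty := by
  obtain ⟨ν, hν⟩ := hπ.exists_isStationary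
  let s : S := Classical.arbitrary S
  obtain ⟨a⟩ := nonempty_of_mem_stdSimplex (hπ.mem_stdSimplex s)
  exact ⟨_, π, ν, s, a, hπ, hν, rfl⟩

lemma Feasible.Lmin_le_one [Nonempty S] (hπ : M.Feasible π) : M.Lmin ≤ 1 := by
  obtain ⟨x, hx⟩ := hπ.weights_nonempty
  exact mul_le_one₀ (by linarith [M.γ_pos])
    (Real.sInf_nonneg fun _ hx => (M.weights_subset_Icc hx).1)
    ((sInf_weights_le hx).trans (M.weights_subset_Icc hx).2)

variable [DecidableEq S]

lemma Regular.pos (hM : M.Regular) (s : S) (p : A → ℝ) (hp : p ∈ M.X s) (a : A) : 0 < p a := by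
  obtain ⟨⟨p₀, hp₀, h⟩, -⟩ := hM
  exact hp₀.trans_le (h s p hp a)

-- All policies are dominated by a multiple of `π₀`, so a power of its chain minorizes all others.
lemma Regular.exists_le_stateMatrix_pow [Nonempty S] (hM : M.Regular) (hπ₀ : M.Feasible π₀) :
    ∃ ε > 0, ∃ n, ∀ π, M.Feasible π → ∀ s s', ε ≤ (M.stateMatrix π ^ n) s s' := by
  obtain ⟨⟨p₀, hp₀, hX⟩, hprim⟩ := hM
  obtain ⟨n, -, hn⟩ := (hprim _ hπ₀).exists_pos_pow
  obtain ⟨⟨i, j⟩, hij⟩ := Finite.exists_min fun z : S × S => (M.stateMatrix π₀ ^ n) z.1 z.2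
  refine ⟨p₀ ^ n * (M.stateMatrix π₀ ^ n) i j, mul_pos (pow_pos hp₀ n) (hn i j), n,
    fun π hπ s s' => ?_⟩
  have hdom (s s' : S) : p₀ * M.stateMatrix π₀ s s' ≤ M.stateMatrix π s s' := by
    simp only [stateMatrix, Matrix.of_apply, Finset.mul_sum, ← mul_assoc]
    refine Finset.sum_le_sum fun a _ => mul_le_mul_of_nonneg_right ?_ ((M.P_mem s a).1 s')
    have hle := (mem_Icc_of_mem_stdSimplex (hπ₀.mem_stdSimplex s) a).2
    exact (mul_le_of_le_one_right hp₀.le hle).trans (hX s _ (hπ s) a)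
  calc p₀ ^ n * (M.stateMatrix π₀ ^ n) i j ≤ p₀ ^ n * (M.stateMatrix π₀ ^ n) s s' :=
        mul_le_mul_of_nonneg_left (hij (s, s')) (pow_nonneg hp₀.le n)
    _ ≤ (M.stateMatrix π ^ n) s s' := pow_mul_pow_apply_le hp₀.le
        (fun _ _ => Matrix.nonneg_of_mem_rowStochastic hπ₀.stateMatrix_mem_rowStochastic) hdom
        n s s'

lemma Regular.exists_le_weights [Nonempty S] (hM : M.Regular) (hπ₀ : M.Feasible π₀) :
    ∃ ε > 0, ∀ x ∈ M.weights, ε ≤ x := by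
  obtain ⟨ε, hε, n, hn⟩ := hM.exists_le_stateMatrix_pow hπ₀
  obtain ⟨⟨p₀, hp₀, hX⟩, -⟩ := hM
  refine ⟨ε * p₀, mul_pos hε hp₀, ?_⟩
  rintro x ⟨π, ν, s, a, hπ, hν, rfl⟩
  have hνs : ε ≤ ν s := by
    rw [← sum_stationary_mul_pow_eq hν.2 n s]
    exact le_sum_mul_of_mem_stdSimplex hν.1 fun s' => hn π hπ s' s
  exact mul_le_mul hνs (hX s _ (hπ s) a) hp₀.le (hε.le.trans hνs)

lemma Regular.Lmin_pos [Nonempty S] (hM : M.Regular) (hπ₀ : M.Feasible π₀) : 0 < M.Lmin := by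
  obtain ⟨ε, hε, h⟩ := hM.exists_le_weights hπ₀
  exact mul_pos M.one_sub_γ_pos (hε.trans_le (le_csInf hπ₀.weights_nonempty h))

variable [DecidableEq A]

lemma pairMatrix_pow_succ_apply (M : RegMDP S A) (π : S → A → ℝ) (n : ℕ) (z z' : S × A) :
    (M.pairMatrix π ^ (n + 1)) z z' =
      (∑ s, M.P z.1 z.2 s * (M.stateMatrix π ^ n) s z'.1) * π z'.1 z'.2 := by
  induction n generalizing z with
  | zero => simp [Matrix.one_apply, pairMatrix]
  | succ n ih =>
    rw [pow_succ', Matrix.mul_apply,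
      M.sum_pairMatrix_mul π fun y => (M.pairMatrix π ^ (n + 1)) y z',
      Finset.sum_mul]
    refine Finset.sum_congr rfl fun s _ => ?_
    rw [pow_succ' (M.stateMatrix π), Matrix.mul_apply, sum_stateMatrix_mul, mul_assoc,
      Finset.sum_mul]
    simp only [ih, mul_assoc]

lemma Regular.exists_le_pairMatrix_pow [Nonempty S] (hM : M.Regular) (hπ₀ : M.Feasible π₀) :
    ∃ ε > 0, ∃ n > 0, ∀ π, M.Feasible π → ∀ z z', ε ≤ (M.pairMatrix π ^ n) z z' := by
  obtain ⟨ε, hε, n, hn⟩ := hM.exists_le_stateMatrix_pow hπ₀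
  obtain ⟨⟨p₀, hp₀, hX⟩, -⟩ := hM
  refine ⟨ε * p₀, mul_pos hε hp₀, n + 1, n.succ_pos, fun π hπ z z' => ?_⟩
  rw [pairMatrix_pow_succ_apply]
  have hmean := le_sum_mul_of_mem_stdSimplex (M.P_mem z.1 z.2) fun s => hn π hπ s z'.1
  exact mul_le_mul hmean (hX _ _ (hπ _) _) hp₀.le (hε.le.trans hmean)

lemma Regular.exists_abs_pairMatrix_pow_sub_le [Nonempty S] (hM : M.Regular)
    (hπ₀ : M.Feasible π₀) : ∃ C > 0, ∃ ρ > 0, ρ < 1 ∧ ∀ π ν, M.Feasible π → M.IsStationary π ν →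
      ∀ (t : ℕ) (z z' : S × A),
        |(M.pairMatrix π ^ t) z z' - ν z'.1 * π z'.1 z'.2| ≤ C * ρ ^ t := by
  obtain ⟨ε, hε, n, hn, hmin⟩ := hM.exists_le_pairMatrix_pow hπ₀
  set ε' := min ε (1 / 2)
  have hε' : 0 < ε' := by positivity
  have hε'_lt : ε' < 1 := (min_le_right _ _).trans_lt (by norm_num)
  set ρ : ℝ := (1 - ε') ^ (1 / (n : ℝ)) with hρ
  have hρ₀ : 0 < ρ := Real.rpow_pos_of_pos (by linarith) _
  have hρ₁ : ρ < 1 := Real.rpow_lt_one (by linarith) (by linarith) (by positivity)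
  have hρn : ρ ^ n = 1 - ε' := by
    rw [hρ, one_div, Real.rpow_inv_natCast_pow (by linarith) hn.ne']
  refine ⟨(ρ ^ n)⁻¹, by positivity, ρ, hρ₀, hρ₁, fun π ν hπ hν t z z' => ?_⟩
  rw [← div_eq_inv_mul]
  refine abs_pow_sub_stationary_le hπ.pairMatrix_mem_rowStochastic (hν.pair_mem_stdSimplex hπ)
    hν.sum_mul_pairMatrix hn hρ₀ hρ₁.le (fun z z' => ?_) t z z'
  rw [hρn, sub_sub_cancel]
  exact (min_le_left _ _).trans (hmin π hπ z z')

lemma Feasible.sub_bellman_eq (hπ : M.Feasible π) (θ : S × A → ℝ) (z : S × A) :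
    θ z - M.bellman τ π θ z = (θ - M.Q τ π) z -
      M.γ * ∑ z', M.pairMatrix π z z' * (θ - M.Q τ π) z' := by
  rw [bellman_eq, Pi.sub_apply, hπ.Q_eq z]
  simp only [Pi.sub_apply, mul_sub, Finset.sum_sub_distrib]
  ring

lemma Feasible.abs_sub_bellman_le (hπ : M.Feasible π) (θ : S × A → ℝ) (z : S × A) :
    |θ z - M.bellman τ π θ z| ≤ 2 * l2norm (θ - M.Q τ π) := by
  rw [hπ.sub_bellman_eq]
  have hmean := abs_sum_mul_le_of_mem_stdSimplex
    (row_mem_stdSimplex hπ.pairMatrix_mem_rowStochastic z) (abs_le_l2norm (θ - M.Q τ π))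
  calc |(θ - M.Q τ π) z - M.γ * ∑ z', M.pairMatrix π z z' * (θ - M.Q τ π) z'|
      ≤ |(θ - M.Q τ π) z| + |M.γ * ∑ z', M.pairMatrix π z z' * (θ - M.Q τ π) z'| := abs_sub _ _
    _ ≤ l2norm (θ - M.Q τ π) + 1 * l2norm (θ - M.Q τ π) := by
        rw [abs_mul, abs_of_pos M.γ_pos]
        exact add_le_add (abs_le_l2norm _ z)
          (mul_le_mul M.γ_lt_one.le hmean (abs_nonneg _) zero_le_one)
    _ = 2 * l2norm (θ - M.Q τ π) := by ring

lemma Feasible.meanFtilde_eq (hπ : M.Feasible π) (θ : S × A → ℝ) (α : ℕ) (z y : S × A) :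
    M.meanFtilde τ π θ α z y =
      (M.pairMatrix π ^ (α - 1)) z y * (θ y - M.bellman τ π θ y) := by
  have hrow := Matrix.sum_row_of_mem_rowStochastic hπ.pairMatrix_mem_rowStochastic y
  rw [meanFtilde, Finset.sum_eq_single y]
  · congr 1
    simp only [Ftilde, Pi.single_eq_same, mul_sub, Finset.sum_sub_distrib, ← Finset.sum_mul, hrow,
      bellman_eq, mul_left_comm _ M.γ, ← Finset.mul_sum]
    ring
  · intro z₁ _ hz
    simp [Ftilde, Pi.single_eq_of_ne hz.symm]
  · simp

lemma Feasible.Lmin_mul_l2norm_sq_le (hπ : M.Feasible π) (hν : M.IsStationary π ν)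
    (θ : S × A → ℝ) :
    M.Lmin * l2norm (θ - M.Q τ π) ^ 2 ≤ ∑ z, (θ - M.Q τ π) z * M.F τ π ν θ z := by
  set δ := θ - M.Q τ π with hδ
  set μ : S × A → ℝ := fun z => ν z.1 * π z.1 z.2 with hμ
  have hF : ∑ z, δ z * M.F τ π ν θ z = ∑ z, μ z * δ z ^ 2 -
      M.γ * ∑ z, μ z * ∑ z', M.pairMatrix π z z' * (δ z * δ z') := by
    rw [Finset.mul_sum, ← Finset.sum_sub_distrib]
    refine Finset.sum_congr rfl fun z _ => ?_
    simp only [F, hπ.sub_bellman_eq, mul_left_comm _ (δ z), ← Finset.mul_sum, ← hδ, hμ]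
    ring
  have hcross := sum_stationary_mul_mul_le
    (fun _ _ => Matrix.nonneg_of_mem_rowStochastic hπ.pairMatrix_mem_rowStochastic)
    (Matrix.sum_row_of_mem_rowStochastic hπ.pairMatrix_mem_rowStochastic)
    (hν.pair_mem_stdSimplex hπ).1 hν.sum_mul_pairMatrix δ
  have hdiag : sInf M.weights * l2norm δ ^ 2 ≤ ∑ z, μ z * δ z ^ 2 := by
    rw [l2norm_sq, Finset.mul_sum]
    exact Finset.sum_le_sum fun z _ => mul_le_mul_of_nonneg_right
      (sInf_weights_le ⟨π, ν, z.1, z.2, hπ, hν, rfl⟩) (sq_nonneg _)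
  rw [hF, Lmin]
  nlinarith [mul_le_mul_of_nonneg_left hcross M.γ_pos.le,
    mul_le_mul_of_nonneg_left hdiag M.one_sub_γ_pos.le]

lemma Regular.exists_mixingConst (hM : M.Regular) (hπ₀ : M.Feasible π₀) :
    ∃ C ρ, M.MixingConst C ρ := by
  rcases isEmpty_or_nonempty S with hS | hS
  · exact ⟨1, 1 / 2, by norm_num, by norm_num, by norm_num,
      fun _ _ _ _ _ _ _ _ z => isEmptyElim z.1⟩
  have := nonempty_of_mem_stdSimplex (hπ₀.mem_stdSimplex (Classical.arbitrary S))
  obtain ⟨C, hC, ρ, hρ₀, hρ₁, hmix⟩ := hM.exists_abs_pairMatrix_pow_sub_le hπ₀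
  refine ⟨Real.sqrt (Fintype.card (S × A)) * (2 * C / ρ), ρ, by positivity, hρ₀, hρ₁,
    fun π ν hπ hν τ _ α hα z θ => ?_⟩
  obtain ⟨t, rfl⟩ : ∃ t, α = t + 1 := ⟨α - 1, by omega⟩
  have hδ := l2norm_nonneg (θ - M.Q τ π)
  refine (l2norm_le_sqrt_card_mul (b := C * ρ ^ t * (2 * l2norm (θ - M.Q τ π))) (by positivity)
    fun y => ?_).trans_eq (by rw [pow_succ]; field_simp)
  rw [Pi.sub_apply, hπ.meanFtilde_eq, F, ← sub_mul, abs_mul, abs_sub_comm]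
  exact mul_le_mul (hmix π ν hπ hν t z y) (hπ.abs_sub_bellman_le θ y) (abs_nonneg _)
    (by positivity)

end RegMDP

section FinitePaths

open MeasureTheory

variable {E Ω : Type*} {Z : ℕ → Ω → E}

/-- The infinite path that stays at its last value after having followed the finite path `v`; it is
a representative of the cylinder of all paths starting with `v`. -/
def extendPath {n : ℕ} (v : Fin (n + 1) → E) (i : ℕ) : E := v ⟨min i n, by omega⟩

lemma eq_extendPath_iff {n : ℕ} (v : Fin (n + 1) → E) (w : ℕ → E) :
    (∀ i ≤ n, w i = extendPath v i) ↔ (fun i : Fin (n + 1) => w i) = v := by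
  constructor
  · intro h
    funext i
    have hi : min i.1 n = i.1 := by omega
    simp only [h i (by omega), extendPath, hi]
  · rintro rfl i hi
    simp only [extendPath, min_eq_left hi]

lemma extendPath_snoc_of_le {n : ℕ} (v : Fin (n + 1) → E) (z : E) {i : ℕ} (hi : i ≤ n) :
    extendPath (Fin.snoc (α := fun _ => E) v z) i = extendPath v i := by
  have hlt : min i (n + 1) < n + 1 := by omega
  simp only [extendPath, Fin.snoc, hlt, ↓reduceDIte, cast_eq]
  congr 1
  ext
  simp
  omega

lemma extendPath_snoc_last {n : ℕ} (v : Fin (n + 1) → E) (z : E) :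
    extendPath (Fin.snoc (α := fun _ => E) v z) (n + 1) = z := by
  simp [extendPath, Fin.snoc]

lemma eq_sum_indicator_path [Fintype E] (Z : ℕ → Ω → E) {n : ℕ} {g : (ℕ → E) → ℝ}
    (hg : DependsOn g (Set.Iic n)) (x : Ω) :
    g (fun i => Z i x) = ∑ v : Fin (n + 1) → E,
      {x | ∀ i ≤ n, Z i x = extendPath v i}.indicator (fun _ => g (extendPath v)) x := by
  rw [Finset.sum_eq_single fun i : Fin (n + 1) => Z i x]
  · have h := (eq_extendPath_iff (fun i : Fin (n + 1) => Z i x) fun i => Z i x).2 rfl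
    rw [Set.indicator_of_mem (by exact h)]
    exact hg fun i hi => h i hi
  · intro v _ hv
    refine Set.indicator_of_notMem (fun h => hv ?_) _
    exact ((eq_extendPath_iff v fun i => Z i x).1 h).symm
  · simp

variable [MeasurableSpace Ω]

lemma measurableSet_path (hZ : ∀ n z, MeasurableSet {x | Z n x = z}) (n : ℕ) (w : ℕ → E) :
    MeasurableSet {x | ∀ i ≤ n, Z i x = w i} := by
  simp only [Set.ofPred_forall]
  exact .iInter fun i => .iInter fun _ => hZ i _

variable {μ : Measure Ω} [IsFiniteMeasure μ]

lemma integrable_path [Finite E] (hZ : ∀ n z, MeasurableSet {x | Z n x = z}) {n : ℕ}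
    {g : (ℕ → E) → ℝ} (hg : DependsOn g (Set.Iic n)) :
    Integrable (fun x => g fun i => Z i x) μ := by
  cases nonempty_fintype E
  simp only [eq_sum_indicator_path Z hg]
  exact integrable_finsetSum _ fun v _ =>
    (integrable_const _).indicator (measurableSet_path hZ n (extendPath v))

variable [Fintype E]

lemma integral_path (hZ : ∀ n z, MeasurableSet {x | Z n x = z}) {n : ℕ} {g : (ℕ → E) → ℝ}
    (hg : DependsOn g (Set.Iic n)) :
    ∫ x, g (fun i => Z i x) ∂μ = ∑ v : Fin (n + 1) → E,
      μ.real {x | ∀ i ≤ n, Z i x = extendPath v i} * g (extendPath v) := by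
  have hcyl (v : Fin (n + 1) → E) := measurableSet_path hZ n (extendPath v)
  simp only [eq_sum_indicator_path Z hg]
  rw [integral_finsetSum _ fun v _ => (integrable_const _).indicator (hcyl v)]
  exact Finset.sum_congr rfl fun v _ => by rw [integral_indicator_const _ (hcyl v), smul_eq_mul]

lemma integral_path_succ (hZ : ∀ n z, MeasurableSet {x | Z n x = z}) {n : ℕ}
    {κ H : (ℕ → E) → E → ℝ} (hκ : DependsOn κ (Set.Iic n)) (hH : DependsOn H (Set.Iic n))
    (hcond : ∀ w : ℕ → E, μ.real {x | ∀ i ≤ n + 1, Z i x = w i} =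
      μ.real {x | ∀ i ≤ n, Z i x = w i} * κ w (w (n + 1))) :
    ∫ x, H (fun i => Z i x) (Z (n + 1) x) ∂μ =
      ∫ x, ∑ z, κ (fun i => Z i x) z * H (fun i => Z i x) z ∂μ := by
  have hsucc : DependsOn (fun w => H w (w (n + 1))) (Set.Iic (n + 1)) := fun w w' h => by
    simp only [h (n + 1) Set.self_mem_Iic,
      hH fun i hi => h i (Set.Iic_subset_Iic.2 n.le_succ hi)]
  have hmean : DependsOn (fun w => ∑ z, κ w z * H w z) (Set.Iic n) := fun w w' h => by
    simp only [hκ h, hH h]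
  have hcyl (v : Fin (n + 1) → E) (z : E) :
      {x | ∀ i ≤ n, Z i x = extendPath (Fin.snoc (α := fun _ => E) v z) i} =
        {x | ∀ i ≤ n, Z i x = extendPath v i} :=
    Set.ext fun x => forall₂_congr fun i hi => by rw [extendPath_snoc_of_le v z hi]
  rw [integral_path hZ hsucc, integral_path hZ hmean,
    ← (Fin.snocEquiv fun _ : Fin (n + 1 + 1) => E).sum_comp, Fintype.sum_prod_type_right]
  refine Finset.sum_congr rfl fun v _ => ?_
  rw [Finset.mul_sum]
  refine Finset.sum_congr rfl fun z _ => ?_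
  change μ.real {x | ∀ i ≤ n + 1, Z i x = extendPath (Fin.snoc (α := fun _ => E) v z) i} *
    H (extendPath (Fin.snoc (α := fun _ => E) v z))
      (extendPath (Fin.snoc (α := fun _ => E) v z) (n + 1)) = _
  rw [hcond, hcyl, extendPath_snoc_last, hκ fun i hi => extendPath_snoc_of_le v z hi,
    hH fun i hi => extendPath_snoc_of_le v z hi, mul_assoc]

end FinitePaths

lemma Schedule.samples_succ (σ : Schedule) (k : ℕ) :
    σ.samples (k + 1) = σ.samples k + σ.T k * σ.α k := Finset.sum_range_succ _ _

namespace RegMDP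

open MeasureTheory

variable {S A : Type*} [Fintype S] [Fintype A] [DecidableEq S] [DecidableEq A] {M : RegMDP S A}
  {σ : Schedule}

lemma ctd_congr (M : RegMDP S A) (k : ℕ) (π : S → A → ℝ) (t : ℕ) {w w' : ℕ → S × A}
    (h : ∀ i ≤ σ.samples k + t * σ.α k, w i = w' i) : M.ctd σ w k π t = M.ctd σ w' k π t := by
  induction t with
  | zero => rfl
  | succ t ih =>
    have hsucc : (t + 1) * σ.α k = t * σ.α k + σ.α k := by ring
    rw [ctd, ctd, ih fun i hi => h i (by omega), h _ le_rfl, h _ (by omega)]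

lemma iter_congr (M : RegMDP S A) (k : ℕ) {w w' : ℕ → S × A}
    (h : ∀ i ≤ σ.samples k, w i = w' i) : M.iter σ w k = M.iter σ w' k := by
  induction k with
  | zero => rfl
  | succ k ih =>
    rw [σ.samples_succ] at h
    simp only [iter, ih fun i hi => h i (by omega), M.ctd_congr k (M.iter σ w' k) (σ.T k) h]

/-- The CTD parameter vector of iteration `k` after `t` updates along the trajectory `w`. -/
noncomputable def ctdIterate (M : RegMDP S A) (σ : Schedule) (k t : ℕ) (w : ℕ → S × A) :
    S × A → ℝ :=
  M.ctd σ w k (M.iter σ w k) t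

lemma dependsOn_ctdIterate (M : RegMDP S A) (σ : Schedule) (k t : ℕ) :
    DependsOn (M.ctdIterate σ k t) (Set.Iic (σ.samples k + t * σ.α k)) := fun w w' h => by
  rw [ctdIterate, ctdIterate, M.iter_congr k fun i hi => h i (hi.trans (Nat.le_add_right _ _))]
  exact M.ctd_congr k _ t h

variable {Ω : Type*} [MeasurableSpace Ω] {μ : Measure Ω} [IsFiniteMeasure μ] {Z : ℕ → Ω → S × A}

lemma IsTrajectory.integral_succ (hZ : M.IsTrajectory σ μ Z) {k n : ℕ} (hk : σ.samples k ≤ n)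
    (hk' : n < σ.samples (k + 1)) {H : (ℕ → S × A) → S × A → ℝ} (hH : DependsOn H (Set.Iic n)) :
    ∫ x, H (fun i => Z i x) (Z (n + 1) x) ∂μ =
      ∫ x, ∑ z, M.pairMatrix (M.iter σ (fun i => Z i x) k) (Z n x) z * H (fun i => Z i x) z ∂μ :=
  integral_path_succ (κ := fun w z => M.pairMatrix (M.iter σ w k) (w n) z) hZ.1
    (fun w w' h => by
      simp only [M.iter_congr k fun i hi => h i (hi.trans hk), h n Set.self_mem_Iic])
    hH (hZ.2 k n hk hk')

lemma IsTrajectory.integral_add (hZ : M.IsTrajectory σ μ Z) {k n : ℕ} (hk : σ.samples k ≤ n)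
    (j : ℕ) (hk' : n + j ≤ σ.samples (k + 1)) {H : (ℕ → S × A) → S × A → ℝ}
    (hH : DependsOn H (Set.Iic n)) :
    ∫ x, H (fun i => Z i x) (Z (n + j) x) ∂μ =
      ∫ x, ∑ z, (M.pairMatrix (M.iter σ (fun i => Z i x) k) ^ j) (Z n x) z *
        H (fun i => Z i x) z ∂μ := by
  induction j generalizing H with
  | zero => simp [Matrix.one_apply]
  | succ j ih =>
    have hmean : DependsOn (fun (w : ℕ → S × A) (y : S × A) =>
        ∑ z, M.pairMatrix (M.iter σ w k) y z * H w z) (Set.Iic n) := fun w w' h => by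
      simp only [M.iter_congr k fun i hi => h i (hi.trans hk), hH h]
    rw [← add_assoc, hZ.integral_succ (by omega : σ.samples k ≤ n + j) (by omega)
      (hH.mono (Set.Iic_subset_Iic.2 (by omega))), ih (by omega) hmean]
    refine integral_congr_ae (ae_of_all _ fun x => ?_)
    simp only [pow_succ, Matrix.mul_apply, Finset.mul_sum, Finset.sum_mul, mul_assoc]
    rw [Finset.sum_comm]

lemma IsTrajectory.integral_transition (hZ : M.IsTrajectory σ μ Z) {k n α : ℕ} (hα : 1 ≤ α)
    (hk : σ.samples k ≤ n) (hk' : n + α ≤ σ.samples (k + 1))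
    {H : (ℕ → S × A) → S × A → S × A → ℝ} (hH : DependsOn H (Set.Iic n)) :
    ∫ x, H (fun i => Z i x) (Z (n + α - 1) x) (Z (n + α) x) ∂μ =
      ∫ x, ∑ y, (M.pairMatrix (M.iter σ (fun i => Z i x) k) ^ (α - 1)) (Z n x) y *
        ∑ z, M.pairMatrix (M.iter σ (fun i => Z i x) k) y z * H (fun i => Z i x) y z ∂μ := by
  obtain ⟨j, rfl⟩ : ∃ j, α = j + 1 := ⟨α - 1, by omega⟩
  have hlast : DependsOn (fun (w : ℕ → S × A) z => H w (w (n + j)) z) (Set.Iic (n + j)) :=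
    fun w w' h => by
      simp only [hH fun i hi => h i (le_trans hi (Nat.le_add_right n j)),
        h (n + j) Set.self_mem_Iic]
  have hmean : DependsOn (fun (w : ℕ → S × A) (y : S × A) =>
      ∑ z, M.pairMatrix (M.iter σ w k) y z * H w y z) (Set.Iic n) := fun w w' h => by
    simp only [M.iter_congr k fun i hi => h i (hi.trans hk), hH h]
  rw [← add_assoc, Nat.add_sub_cancel, Nat.add_sub_cancel,
    hZ.integral_succ (by omega : σ.samples k ≤ n + j) (by omega) hlast]
  exact hZ.integral_add hk j (by omega) hmean

end RegMDP

lemma stochastic_approximation_rate {a : ℕ → ℝ} {t₀ D B : ℝ} (ht₀ : 3 ≤ t₀) (hD : 0 ≤ D)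
    (hB : 0 ≤ B) {T : ℕ} (h0 : a 0 ≤ B)
    (h : ∀ t < T, a (t + 1) ≤ (1 - 3 / (t + t₀)) * a t + 2 * D / (t + t₀) ^ 2) :
    ∀ t ≤ T, a t ≤ t₀ ^ 2 * B / (t + t₀) ^ 2 + D / (t + t₀) := by
  intro t ht
  induction t with
  | zero =>
    rw [Nat.cast_zero, zero_add, mul_div_cancel_left₀ _ (by positivity)]
    exact h0.trans (le_add_of_nonneg_right (by positivity))
  | succ t ih =>
    have hn : 3 ≤ (t : ℝ) + t₀ := by linarith [Nat.cast_nonneg (α := ℝ) t]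
    have hstep := h t (by omega)
    have hprev := ih (by omega)
    rw [Nat.cast_succ, add_right_comm]
    set n : ℝ := t + t₀
    set E := t₀ ^ 2 * B
    have hinitial : (1 - 3 / n) * (E / n ^ 2) ≤ E / (n + 1) ^ 2 := by
      have hrw : (1 - 3 / n) * (E / n ^ 2) = E * (n - 3) / n ^ 3 := by field_simp
      rw [hrw, div_le_div_iff₀ (by positivity) (by positivity), mul_assoc]
      exact mul_le_mul_of_nonneg_left (by nlinarith) (by positivity)
    have hnoise : (1 - 3 / n) * (D / n) + 2 * D / n ^ 2 ≤ D / (n + 1) := by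
      have hrw : (1 - 3 / n) * (D / n) + 2 * D / n ^ 2 = D * (n - 1) / n ^ 2 := by
        field_simp
        ring
      rw [hrw, div_le_div_iff₀ (by positivity) (by positivity), mul_assoc]
      exact mul_le_mul_of_nonneg_left (by nlinarith) hD
    have hfactor : 0 ≤ 1 - 3 / n := sub_nonneg.2 ((div_le_one (by linarith)).2 hn)
    linarith [mul_le_mul_of_nonneg_left hprev hfactor, mul_add (1 - 3 / n) (E / n ^ 2) (D / n)]

namespace RegMDP

variable {S A : Type*} [Fintype S] [Fintype A] [DecidableEq S] [DecidableEq A]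
  {M : RegMDP S A} {π : S → A → ℝ} {ν : S → ℝ} {τ b Θ C ρ : ℝ}

lemma l2norm_sub_smul_Ftilde_sq (M : RegMDP S A) (τ : ℝ) (π : S → A → ℝ) (θ δ : S × A → ℝ) (β : ℝ)
    (y z : S × A) :
    l2norm (δ - β • M.Ftilde τ π θ y z) ^ 2 =
      l2norm δ ^ 2 - 2 * β * ∑ i, δ i * M.Ftilde τ π θ y z i +
        β ^ 2 * (θ y - M.stageCost τ π y - M.γ * θ z) ^ 2 := by
  have hsq : ∑ i, M.Ftilde τ π θ y z i ^ 2 = (θ y - M.stageCost τ π y - M.γ * θ z) ^ 2 := by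
    simp [Ftilde, Pi.single_apply, ite_pow]
  rw [← hsq, l2norm_sq, l2norm_sq, Finset.mul_sum, Finset.mul_sum, ← Finset.sum_sub_distrib,
    ← Finset.sum_add_distrib]
  refine Finset.sum_congr rfl fun i _ => ?_
  simp only [Pi.sub_apply, Pi.smul_apply, smul_eq_mul]
  ring

lemma sum_mul_meanFtilde (M : RegMDP S A) (τ : ℝ) (π : S → A → ℝ) (θ δ : S × A → ℝ) (α : ℕ)
    (z₀ : S × A) :
    ∑ i, δ i * M.meanFtilde τ π θ α z₀ i =
      ∑ y, (M.pairMatrix π ^ (α - 1)) z₀ y * ∑ z, M.pairMatrix π y z *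
        ∑ i, δ i * M.Ftilde τ π θ y z i := by
  simp only [meanFtilde, Finset.mul_sum]
  rw [Finset.sum_comm]
  refine Finset.sum_congr rfl fun y _ => ?_
  rw [Finset.sum_comm]
  refine Finset.sum_congr rfl fun z _ => Finset.sum_congr rfl fun i _ => ?_
  ring

lemma td_error_sq_le (hb : ∀ z, |M.stageCost τ π z| ≤ b) (hΘ : l2norm (M.Q τ π) ≤ Θ)
    (θ : S × A → ℝ) (y z : S × A) :
    (θ y - M.stageCost τ π y - M.γ * θ z) ^ 2 ≤
      2 * (1 + M.γ) ^ 2 * l2norm (θ - M.Q τ π) ^ 2 + (4 * (1 + M.γ) ^ 2 * Θ ^ 2 + 4 * b ^ 2) := by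
  have hγ := M.γ_pos
  have hδy := abs_le.1 (abs_le_l2norm (θ - M.Q τ π) y)
  have hδz := abs_le.1 (abs_le_l2norm (θ - M.Q τ π) z)
  have hQy := abs_le.1 ((abs_le_l2norm (M.Q τ π) y).trans hΘ)
  have hQz := abs_le.1 ((abs_le_l2norm (M.Q τ π) z).trans hΘ)
  have hcost := abs_le.1 (hb y)
  simp only [Pi.sub_apply] at hδy hδz
  set d := l2norm (θ - M.Q τ π)
  have habs : |θ y - M.stageCost τ π y - M.γ * θ z| ≤ (1 + M.γ) * d + ((1 + M.γ) * Θ + b) := by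
    rw [abs_le]
    constructor <;> nlinarith
  have hsq := sq_le_sq' (abs_le.1 habs).1 (abs_le.1 habs).2
  nlinarith [sq_nonneg ((1 + M.γ) * d - ((1 + M.γ) * Θ + b)), sq_nonneg ((1 + M.γ) * Θ - b)]

lemma MixingConst.mul_l2norm_sq_le_sum_mul_meanFtilde (hmix : M.MixingConst C ρ)
    (hπ : M.Feasible π) (hν : M.IsStationary π ν) (hτ : 0 ≤ τ) {α : ℕ} (hα : 1 ≤ α)
    (θ : S × A → ℝ) (z₀ : S × A) :
    (M.Lmin - C * ρ ^ α) * l2norm (θ - M.Q τ π) ^ 2 ≤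
      ∑ i, (θ - M.Q τ π) i * M.meanFtilde τ π θ α z₀ i := by
  have hmono := hπ.Lmin_mul_l2norm_sq_le (τ := τ) hν θ
  set δ := θ - M.Q τ π
  have hbias : ∑ i, δ i * (M.F τ π ν θ - M.meanFtilde τ π θ α z₀) i ≤
      l2norm δ * (C * ρ ^ α * l2norm δ) :=
    (sum_mul_le_l2norm_mul_l2norm _ _).trans <|
      mul_le_mul_of_nonneg_left (hmix.2.2.2 π ν hπ hν τ hτ α hα z₀ θ) (l2norm_nonneg δ)
  simp only [Pi.sub_apply (M.F τ π ν θ), mul_sub (δ _), Finset.sum_sub_distrib] at hbias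
  linarith

lemma MixingConst.expected_update_le (hmix : M.MixingConst C ρ) (hπ : M.Feasible π)
    (hν : M.IsStationary π ν) (hτ : 0 ≤ τ) {α : ℕ} (hα : 1 ≤ α)
    (hb : ∀ z, |M.stageCost τ π z| ≤ b) (hΘ : l2norm (M.Q τ π) ≤ Θ) {β : ℝ} (hβ : 0 ≤ β)
    (θ : S × A → ℝ) (z₀ : S × A) :
    ∑ y, (M.pairMatrix π ^ (α - 1)) z₀ y * ∑ z, M.pairMatrix π y z *
        l2norm (θ - β • M.Ftilde τ π θ y z - M.Q τ π) ^ 2 ≤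
      (1 - 2 * β * (M.Lmin - C * ρ ^ α) + β ^ 2 * (2 * (1 + M.γ) ^ 2)) *
          l2norm (θ - M.Q τ π) ^ 2 +
        β ^ 2 * (4 * (1 + M.γ) ^ 2 * Θ ^ 2 + 4 * b ^ 2) := by
  have hdrift := hmix.mul_l2norm_sq_le_sum_mul_meanFtilde hπ hν hτ hα θ z₀
  obtain ⟨hP, hPsum⟩ := Matrix.mem_rowStochastic_iff_sum.1 hπ.pairMatrix_mem_rowStochastic
  obtain ⟨hPα, hPαsum⟩ :=
    Matrix.mem_rowStochastic_iff_sum.1 (pow_mem hπ.pairMatrix_mem_rowStochastic (α - 1))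
  set δ := θ - M.Q τ π with hδ
  set c := l2norm δ ^ 2 + β ^ 2 * (2 * (1 + M.γ) ^ 2 * l2norm δ ^ 2 +
    (4 * (1 + M.γ) ^ 2 * Θ ^ 2 + 4 * b ^ 2)) with hc
  have hsample (y z : S × A) : l2norm (θ - β • M.Ftilde τ π θ y z - M.Q τ π) ^ 2 ≤
      c - 2 * β * ∑ i, δ i * M.Ftilde τ π θ y z i := by
    rw [sub_right_comm, ← hδ, l2norm_sub_smul_Ftilde_sq]
    linarith [mul_le_mul_of_nonneg_left (td_error_sq_le hb hΘ θ y z) (sq_nonneg β)]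
  calc _ ≤ ∑ y, (M.pairMatrix π ^ (α - 1)) z₀ y * ∑ z, M.pairMatrix π y z *
        (c - 2 * β * ∑ i, δ i * M.Ftilde τ π θ y z i) := by
        gcongr with y _ z _
        exacts [hPα z₀ y, hP y z, hsample y z]
    _ = c - 2 * β * ∑ i, δ i * M.meanFtilde τ π θ α z₀ i := by
        simp only [mul_sub, Finset.sum_sub_distrib, ← Finset.sum_mul, hPsum, hPαsum, one_mul,
          mul_left_comm _ (2 * β), ← Finset.mul_sum (a := 2 * β), sum_mul_meanFtilde]
    _ ≤ c - 2 * β * ((M.Lmin - C * ρ ^ α) * l2norm δ ^ 2) := by gcongr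
    _ = _ := by rw [hc]; ring

end RegMDP

lemma log_card_pos {α : Type*} [Fintype α] [Nontrivial α] : 0 < Real.log (Fintype.card α) :=
  Real.log_pos (by exact_mod_cast Fintype.one_lt_card)

namespace RegMDP

variable {S A : Type*} [Fintype S] [Fintype A]

lemma epoch_pos (M : RegMDP S A) : 0 < M.epoch :=
  Nat.ceil_pos.2 (Real.logb_pos_of_base_lt_one M.γ_pos M.γ_lt_one (by norm_num) (by norm_num))

lemma γ_pow_epoch_le (M : RegMDP S A) : M.γ ^ M.epoch ≤ 1 / 4 := by
  rw [← Real.rpow_natCast]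
  exact (Real.logb_le_iff_le_rpow_of_base_lt_one M.γ_pos M.γ_lt_one (by norm_num)).1 (Nat.le_ceil _)

lemma tau_antitone (M : RegMDP S A) : Antitone M.tau := fun j k hjk => by
  rw [tau, tau]
  gcongr ?_ * ?_
  exact pow_le_pow_of_le_one (by norm_num) (by norm_num)
    (Nat.succ_le_succ (Nat.div_le_div_right hjk))

lemma tau_mul_log (M : RegMDP S A) (k : ℕ) :
    M.tau k * Real.log (Fintype.card A) =
      Real.sqrt (Real.log (Fintype.card A)) / Real.sqrt M.γ * (1 / 2) ^ (k / M.epoch + 1) := by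
  rw [tau, Real.sqrt_mul M.γ_pos.le]
  nth_rw 3 [← Real.div_sqrt]
  ring

lemma one_div_γ_mul_tau (M : RegMDP S A) (k : ℕ) :
    1 / (M.γ * M.tau k) =
      Real.sqrt (Real.log (Fintype.card A)) / Real.sqrt M.γ * 2 ^ (k / M.epoch + 1) := by
  rw [tau, Real.sqrt_mul M.γ_pos.le, one_div_pow, div_eq_mul_one_div _ (Real.sqrt M.γ),
    ← Real.sqrt_div_self']
  simp only [one_div, mul_inv, inv_inv]
  ring

lemma tau_pos [Nontrivial A] (M : RegMDP S A) (k : ℕ) : 0 < M.tau k := by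
  have := M.γ_pos
  have := log_card_pos (α := A)
  unfold tau
  positivity

lemma t0_eq (M : RegMDP S A) : M.t0 = 64 * (1 + M.γ) ^ 2 / M.Lmin ^ 2 := by
  have hγ := M.γ_pos
  rw [t0, max_eq_right (by nlinarith [M.Lmax_nonneg, M.Lmax_le_one])]
  ring

/-- The standing assumptions: nonempty state space, bounded costs and regularizers, feasibility of
the uniform policy, and regularity of the chains of all feasible policies. -/
structure Admissible [DecidableEq S] (M : RegMDP S A) (cbar hbar : ℝ) : Prop where
  nonempty : Nonempty S
  abs_cost_le : ∀ s a, |M.c s a| ≤ cbar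
  abs_reg_le : ∀ s, ∀ p ∈ M.X s, |M.h s p| ≤ hbar
  uniform_mem : ∀ s, uniformDist A ∈ M.X s
  regular : M.Regular

namespace Admissible

variable [DecidableEq S] {M : RegMDP S A} {π : S → A → ℝ} {τ cbar hbar C ρ : ℝ}

lemma cbar_nonneg (h : M.Admissible cbar hbar) : 0 ≤ cbar :=
  have ⟨s⟩ := h.nonempty
  have ⟨a⟩ := nonempty_of_mem_stdSimplex (M.X_subset s (h.uniform_mem s))
  (abs_nonneg _).trans (h.abs_cost_le s a)

lemma hbar_nonneg (h : M.Admissible cbar hbar) : 0 ≤ hbar :=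
  have ⟨s⟩ := h.nonempty
  (abs_nonneg _).trans (h.abs_reg_le s _ (h.uniform_mem s))

lemma Lmin_pos (h : M.Admissible cbar hbar) : 0 < M.Lmin :=
  have := h.nonempty
  h.regular.Lmin_pos h.uniform_mem

lemma Lmin_le_one (h : M.Admissible cbar hbar) : M.Lmin ≤ 1 :=
  have := h.nonempty
  Feasible.Lmin_le_one h.uniform_mem

lemma abs_stageCost_le_costBound (h : M.Admissible cbar hbar) (hπ : M.Feasible π)
    (hτ₀ : 0 ≤ τ) (hτ₁ : τ ≤ M.tau 0) (z : S × A) :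
    |M.stageCost τ π z| ≤ M.costBound cbar hbar := by
  have hkl₀ := klDist_uniformDist_nonneg (hπ.mem_stdSimplex z.1)
  have hkl₁ := klDist_uniformDist_le (hπ.mem_stdSimplex z.1)
  rw [stageCost, costBound]
  refine (abs_add_le _ _).trans (add_le_add ((abs_add_le _ _).trans (add_le_add
    (h.abs_cost_le _ _) (h.abs_reg_le _ _ (hπ _)))) ?_)
  rw [abs_of_nonneg (by positivity)]
  gcongr
  exact hτ₀.trans hτ₁

lemma le_t0 (h : M.Admissible cbar hbar) : 64 ≤ M.t0 := by
  have hΛ := h.Lmin_pos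
  rw [t0_eq, le_div_iff₀ (by positivity)]
  nlinarith [h.Lmin_le_one, M.γ_pos]

variable [Nontrivial A]

lemma le_costBound (h : M.Admissible cbar hbar) : 2 / 5 ≤ M.costBound cbar hbar := by
  have hlog : Real.log 2 ≤ Real.log (Fintype.card A) :=
    Real.log_le_log (by norm_num) (by exact_mod_cast Fintype.one_lt_card)
  have hsqrt : 4 / 5 ≤ Real.sqrt (Real.log (Fintype.card A)) :=
    Real.le_sqrt_of_sq_le (by linarith [Real.log_two_gt_d9])
  have hdiv : Real.sqrt (Real.log (Fintype.card A)) ≤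
      Real.sqrt (Real.log (Fintype.card A)) / Real.sqrt M.γ :=
    le_div_self (Real.sqrt_nonneg _) (Real.sqrt_pos.2 M.γ_pos) (Real.sqrt_le_one.2 M.γ_lt_one.le)
  rw [costBound, tau_mul_log, Nat.zero_div, zero_add, pow_one]
  linarith [h.cbar_nonneg, h.hbar_nonneg]

lemma le_thetaBar (h : M.Admissible cbar hbar) : 2 / 5 ≤ M.thetaBar cbar hbar :=
  h.le_costBound.trans <|
    le_div_self (by linarith [h.le_costBound]) M.one_sub_γ_pos (by linarith [M.γ_pos])

lemma thetaBar_pos (h : M.Admissible cbar hbar) : 0 < M.thetaBar cbar hbar := by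
  linarith [h.le_thetaBar]

variable [DecidableEq A]

lemma l2norm_Q_le_thetaStar (h : M.Admissible cbar hbar) (hπ : M.Feasible π) (hτ₀ : 0 ≤ τ)
    (hτ₁ : τ ≤ M.tau 0) : l2norm (M.Q τ π) ≤ M.thetaStar := by
  refine le_csSup ⟨Real.sqrt (Fintype.card (S × A)) * (M.costBound cbar hbar / (1 - M.γ)), ?_⟩
    ⟨π, τ, hπ, hτ₀, hτ₁, rfl⟩
  rintro _ ⟨π, τ, hπ, hτ₀, hτ₁, rfl⟩
  exact l2norm_le_sqrt_card_mul h.thetaBar_pos.le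
    (hπ.abs_Q_le (h.abs_stageCost_le_costBound hπ hτ₀ hτ₁))

lemma le_Rsq (h : M.Admissible cbar hbar) : 1 / 20 ≤ M.Rsq cbar hbar := by
  have hγ := M.γ_pos
  have hγ₁ := M.γ_lt_one
  calc (1 : ℝ) / 20 ≤ 3 * (2 * (2 / 5) ^ 2) / (4 * (1 + 1) ^ 2) := by norm_num
    _ ≤ 3 * (M.thetaStar ^ 2 + 2 * M.costBound cbar hbar ^ 2) / (4 * (1 + M.γ) ^ 2) := by
        gcongr
        nlinarith [sq_nonneg M.thetaStar, h.le_costBound]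
    _ ≤ M.Rsq cbar hbar := le_add_of_nonneg_left (by positivity)

lemma Lmin_div_pos (h : M.Admissible cbar hbar) (hC : 0 < C) :
    0 < M.Lmin / (C * M.Rsq cbar hbar) :=
  div_pos h.Lmin_pos (mul_pos hC (by linarith [h.le_Rsq]))

lemma sigmaFsq_pos (h : M.Admissible cbar hbar) : 0 < M.sigmaFsq cbar hbar := by
  have hR := h.le_Rsq
  have hγ := M.γ_pos
  have hsq : 0 < 4 * (1 + M.γ) ^ 2 * M.Rsq cbar hbar := by positivity
  unfold sigmaFsq
  nlinarith [sq_nonneg M.thetaStar, sq_nonneg (M.costBound cbar hbar)]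

lemma mixing_bias_le (h : M.Admissible cbar hbar) (hmix : M.MixingConst C ρ) (k : ℕ) :
    C * ρ ^ (M.schedule cbar hbar C ρ).α k ≤ M.Lmin / 16 := by
  obtain ⟨hC, hρ, hρ₁, -⟩ := hmix
  have hΛ := h.Lmin_pos
  have hR := h.le_Rsq
  set x := M.Lmin / (24 * C * M.Rsq cbar hbar) with hx
  have hx₀ : 0 < x := by positivity
  have hlogb : Real.logb ρ ((1 / 2) ^ (2 * (k / M.epoch + 2)) * x) ≤
      (M.schedule cbar hbar C ρ).α k := by
    rw [Real.logb_mul (by positivity) hx₀.ne', Real.logb_pow]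
    push_cast
    refine (le_max_left _ _ : _ ≤ M.alphaReal cbar hbar C ρ k).trans ((Nat.le_ceil _).trans ?_)
    exact Nat.cast_le.2 (le_max_right 1 _)
  have hρα : ρ ^ (M.schedule cbar hbar C ρ).α k ≤ (1 / 2) ^ (2 * (k / M.epoch + 2)) * x := by
    rw [← Real.rpow_natCast]
    exact (Real.logb_le_iff_le_rpow_of_base_lt_one hρ hρ₁ (by positivity)).1 hlogb
  have hpow : ((1 : ℝ) / 2) ^ (2 * (k / M.epoch + 2)) ≤ (1 / 2) ^ 4 :=
    pow_le_pow_of_le_one (by norm_num) (by norm_num)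
      (Nat.mul_le_mul_left 2 (Nat.le_add_left 2 _))
  calc C * ρ ^ (M.schedule cbar hbar C ρ).α k ≤ C * ((1 / 2) ^ 4 * x) := by
        gcongr
        exact hρα.trans (by gcongr)
    _ = M.Lmin / (384 * M.Rsq cbar hbar) := by rw [hx]; field_simp; norm_num
    _ ≤ M.Lmin / 16 := by gcongr; linarith

end Admissible

lemma sigmaFsq_eq [DecidableEq S] [DecidableEq A] (M : RegMDP S A) (cbar hbar : ℝ) :
    M.sigmaFsq cbar hbar = 32 * (1 + M.γ) ^ 2 * M.thetaStar ^ 2 + 4 * M.thetaStar ^ 2 +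
      8 * M.costBound cbar hbar ^ 2 := by
  have hγ := M.γ_pos
  unfold sigmaFsq Rsq
  field_simp
  ring

end RegMDP

lemma epoch_recursion_le {x : ℕ → ℝ} {γ W N L : ℝ} {l : ℕ} (hγ : 0 < γ) (hl : 0 < l)
    (hγl : γ ^ l ≤ 1 / 4) (hN : 0 ≤ N) (hL : 0 ≤ L) (hW : 2 * N + L ≤ W) (h0 : x 0 ≤ W + N)
    (h : ∀ k, x (k + 1) ≤ γ * x k + (1 / 2) ^ (k / l) * ((1 - γ) * N) +
      L * ((1 / 2) ^ (k / l + 1) - (1 / 2) ^ ((k + 1) / l + 1))) (k : ℕ) :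
    x k ≤ (1 / 2) ^ (k / l) * (γ ^ (k % l) * W + N) := by
  induction k with
  | zero => simpa using h0
  | succ k ih =>
    have hstep := h k
    have hmod := Nat.mod_lt k hl
    have hdiv := Nat.div_add_mod k l
    have hhalf : (0 : ℝ) < (1 / 2) ^ (k / l) := by positivity
    have ihγ := mul_le_mul_of_nonneg_left ih hγ.le
    by_cases hlast : k % l + 1 = l
    · obtain ⟨hquot, hrem⟩ : (k + 1) / l = k / l + 1 ∧ (k + 1) % l = 0 :=
        (Nat.div_mod_unique hl).2 ⟨by rw [mul_add, mul_one]; omega, hl⟩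
      have hquarter : γ * γ ^ (k % l) ≤ 1 / 4 := by rwa [← pow_succ', hlast]
      have hW₀ : 0 ≤ W := by linarith
      have hcontract := mul_le_mul_of_nonneg_left (mul_le_mul_of_nonneg_right hquarter hW₀) hhalf.le
      rw [hquot] at hstep
      rw [hquot, hrem]
      simp only [pow_succ, pow_zero] at hstep ⊢
      nlinarith
    · obtain ⟨hquot, hrem⟩ : (k + 1) / l = k / l ∧ (k + 1) % l = k % l + 1 :=
        (Nat.div_mod_unique hl).2 ⟨by omega, by omega⟩
      rw [hquot] at hstep
      rw [hquot, hrem, pow_succ]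
      nlinarith

namespace RegMDP

open MeasureTheory

variable {S A : Type*} [Fintype S] [Fintype A] [DecidableEq S]
  {M : RegMDP S A} {π : S → A → ℝ} {cbar hbar C ρ : ℝ}

lemma Admissible.sgd_contraction_le (h : M.Admissible cbar hbar) {δ n : ℝ} (hδ : δ ≤ M.Lmin / 16)
    (hn : M.t0 ≤ n) :
    1 - 2 * (2 / (M.Lmin * n)) * (M.Lmin - δ) +
      (2 / (M.Lmin * n)) ^ 2 * (2 * (1 + M.γ) ^ 2) ≤ 1 - 3 / n := by
  have hΛ := h.Lmin_pos
  have hn₀ : 0 < n := by linarith [h.le_t0]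
  have hdrift : 15 / 4 / n ≤ 2 * (2 / (M.Lmin * n)) * (M.Lmin - δ) := by
    calc 15 / 4 / n = 2 * (2 / (M.Lmin * n)) * (M.Lmin - M.Lmin / 16) := by field_simp; norm_num
      _ ≤ 2 * (2 / (M.Lmin * n)) * (M.Lmin - δ) := by gcongr
  have hvar : (2 / (M.Lmin * n)) ^ 2 * (2 * (1 + M.γ) ^ 2) ≤ 1 / 8 / n := by
    calc (2 / (M.Lmin * n)) ^ 2 * (2 * (1 + M.γ) ^ 2) = 1 / 8 * (M.t0 / n) / n := by
          rw [t0_eq]; field_simp; ring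
      _ ≤ 1 / 8 * 1 / n := by gcongr; exact (div_le_one hn₀).2 hn
      _ = 1 / 8 / n := by rw [mul_one]
  have hsum : 15 / 4 / n - 1 / 8 / n - 3 / n = 5 / 8 / n := by ring
  have hpos : 0 < 5 / 8 / n := by positivity
  linarith

variable [DecidableEq A]

lemma sgd_noise_le (M : RegMDP S A) (cbar hbar n : ℝ) :
    (2 / (M.Lmin * n)) ^ 2 *
        (4 * (1 + M.γ) ^ 2 * M.thetaStar ^ 2 + 4 * M.costBound cbar hbar ^ 2) ≤
      2 * (M.sigmaFsq cbar hbar / M.Lmin ^ 2) / n ^ 2 := by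
  calc _ = 2 * ((8 * (1 + M.γ) ^ 2 * M.thetaStar ^ 2 + 8 * M.costBound cbar hbar ^ 2) /
          M.Lmin ^ 2) / n ^ 2 := by ring
    _ ≤ _ := by
        rw [sigmaFsq_eq]
        gcongr
        nlinarith [sq_nonneg M.thetaStar, sq_nonneg ((1 + M.γ) * M.thetaStar)]

lemma Feasible.V_sub_V_tau (hπ : M.Feasible π) (τ τ' : ℝ) (s : S) :
    M.V τ π s - M.V τ' π s = (τ - τ') * klDist (π s) (uniformDist A) +
      M.γ * ∑ s', M.stateMatrix π s s' * (M.V τ π s' - M.V τ' π s') := by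
  have hQ (a : A) : M.Q τ π (s, a) - M.Q τ' π (s, a) =
      (τ - τ') * klDist (π s) (uniformDist A) +
        M.γ * ∑ s', M.P s a s' * (M.V τ π s' - M.V τ' π s') := by
    simp only [hπ.Q_eq_V, stageCost, mul_sub, Finset.sum_sub_distrib]
    ring
  have hV : M.V τ π s - M.V τ' π s = ∑ a, π s a * (M.Q τ π (s, a) - M.Q τ' π (s, a)) := by
    simp only [V, mul_sub, Finset.sum_sub_distrib]
  rw [hV, sum_stateMatrix_mul]
  simp only [hQ, mul_add, Finset.sum_add_distrib, ← Finset.sum_mul, hπ.sum_eq_one, one_mul,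
    mul_left_comm _ M.γ, ← Finset.mul_sum]

lemma Feasible.V_sub_V_tau_le (hπ : M.Feasible π) {τ τ' : ℝ} (hτ : τ' ≤ τ) (s : S) :
    M.V τ π s - M.V τ' π s ≤ (τ - τ') * Real.log (Fintype.card A) / (1 - M.γ) :=
  le_div_of_eq_add_discounted hπ.stateMatrix_mem_rowStochastic M.γ_pos.le M.γ_lt_one
    (hπ.V_sub_V_tau τ τ') (fun s => mul_le_mul_of_nonneg_left
      (klDist_uniformDist_le (hπ.mem_stdSimplex s)) (sub_nonneg.2 hτ)) s

lemma Feasible.V_tau_mono (hπ : M.Feasible π) {τ τ' : ℝ} (hτ : τ' ≤ τ) (s : S) :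
    M.V τ' π s ≤ M.V τ π s := by
  have hdiff := le_div_of_eq_add_discounted (e := 0) hπ.stateMatrix_mem_rowStochastic M.γ_pos.le
    M.γ_lt_one (hπ.V_sub_V_tau τ' τ) (fun s => mul_nonpos_of_nonpos_of_nonneg (sub_nonpos.2 hτ)
      (klDist_uniformDist_nonneg (hπ.mem_stdSimplex s))) s
  rwa [zero_div, sub_nonpos] at hdiff

/-- The squared `ℓ²` error of the estimate of `Q_{τ_k}^{π_k}` after `t` temporal difference updates
in iteration `k`, along the sample path `w`. -/
noncomputable def sqError (M : RegMDP S A) (σ : Schedule) (k t : ℕ) (w : ℕ → S × A) : ℝ :=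
  l2norm (M.ctdIterate σ k t w - M.Q (σ.τ k) (M.iter σ w k)) ^ 2

/-- The squared error after the next update, as a function of the transition `y → z` on which that
update is based. -/
noncomputable def nextSqError (M : RegMDP S A) (σ : Schedule) (k t : ℕ) (w : ℕ → S × A)
    (y z : S × A) : ℝ :=
  l2norm (M.ctdIterate σ k t w - σ.β (t + 1) •
    M.Ftilde (σ.τ k) (M.iter σ w k) (M.ctdIterate σ k t w) y z - M.Q (σ.τ k) (M.iter σ w k)) ^ 2

/-- The conditional expectation of `nextSqError` given the path up to the current update. -/
noncomputable def meanNextSqError (M : RegMDP S A) (σ : Schedule) (k t : ℕ) (w : ℕ → S × A) : ℝ :=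
  ∑ y, (M.pairMatrix (M.iter σ w k) ^ (σ.α k - 1)) (w (σ.samples k + t * σ.α k)) y *
    ∑ z, M.pairMatrix (M.iter σ w k) y z * M.nextSqError σ k t w y z

section dependence

variable (M) (σ : Schedule) (k t : ℕ)

lemma dependsOn_iter_of_samples_le {n : ℕ} (hn : σ.samples k ≤ n) :
    DependsOn (fun w => M.iter σ w k) (Set.Iic n) :=
  fun _ _ h => M.iter_congr k fun i hi => h i (hi.trans hn)

lemma dependsOn_sqError : DependsOn (M.sqError σ k t) (Set.Iic (σ.samples k + t * σ.α k)) := by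
  intro w w' h
  rw [sqError, sqError, M.dependsOn_ctdIterate σ k t h,
    show M.iter σ w k = _ from M.dependsOn_iter_of_samples_le σ k (Nat.le_add_right _ _) h]

lemma dependsOn_nextSqError :
    DependsOn (M.nextSqError σ k t) (Set.Iic (σ.samples k + t * σ.α k)) := by
  intro w w' h
  funext y z
  rw [nextSqError, nextSqError, M.dependsOn_ctdIterate σ k t h,
    show M.iter σ w k = _ from M.dependsOn_iter_of_samples_le σ k (Nat.le_add_right _ _) h]

lemma dependsOn_meanNextSqError :
    DependsOn (M.meanNextSqError σ k t) (Set.Iic (σ.samples k + t * σ.α k)) := by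
  intro w w' h
  rw [meanNextSqError, meanNextSqError, M.dependsOn_nextSqError σ k t h, h _ Set.self_mem_Iic,
    show M.iter σ w k = _ from M.dependsOn_iter_of_samples_le σ k (Nat.le_add_right _ _) h]

lemma sqError_succ (w : ℕ → S × A) : M.sqError σ k (t + 1) w =
    M.nextSqError σ k t w (w (σ.samples k + t * σ.α k + σ.α k - 1))
      (w (σ.samples k + t * σ.α k + σ.α k)) := by
  rw [sqError, ctdIterate, ctd, add_mul, one_mul, ← add_assoc]
  rfl

end dependence

namespace Admissible

variable [Nontrivial A]

lemma iter_feasible (h : M.Admissible cbar hbar) (w : ℕ → S × A) (k : ℕ) :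
    M.Feasible (M.iter (M.schedule cbar hbar C ρ) w k) := by
  induction k with
  | zero => exact h.uniform_mem
  | succ k ih =>
    exact ih.mirrorUpdate h.regular.pos
      (div_pos M.one_sub_γ_pos (mul_pos M.γ_pos (M.tau_pos k))).le

lemma meanNextSqError_le (h : M.Admissible cbar hbar) (hmix : M.MixingConst C ρ) (k t : ℕ)
    (w : ℕ → S × A) :
    M.meanNextSqError (M.schedule cbar hbar C ρ) k t w ≤
      (1 - 3 / (t + M.t0)) * M.sqError (M.schedule cbar hbar C ρ) k t w +
        2 * (M.sigmaFsq cbar hbar / M.Lmin ^ 2) / (t + M.t0) ^ 2 := by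
  set σ := M.schedule cbar hbar C ρ with hσ
  have := h.nonempty
  have hΛ := h.Lmin_pos
  have ht₀ := h.le_t0
  have hn : M.t0 ≤ t + M.t0 := le_add_of_nonneg_left (Nat.cast_nonneg t)
  have hβ : σ.β (t + 1) = 2 / (M.Lmin * (t + M.t0)) := by
    simp only [hσ, schedule]
    push_cast
    ring_nf
  have hfeas : M.Feasible (M.iter σ w k) := h.iter_feasible w k
  have hτ₀ : 0 ≤ σ.τ k := (M.tau_pos k).le
  have hτ₁ : σ.τ k ≤ M.tau 0 := M.tau_antitone k.zero_le
  obtain ⟨ν, hν⟩ := hfeas.exists_isStationary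
  have hupdate := hmix.expected_update_le hfeas hν hτ₀ (le_max_left 1 _ : 1 ≤ σ.α k)
    (h.abs_stageCost_le_costBound hfeas hτ₀ hτ₁) (h.l2norm_Q_le_thetaStar hfeas hτ₀ hτ₁)
    (by rw [hβ]; positivity : 0 ≤ σ.β (t + 1)) (M.ctdIterate σ k t w)
    (w (σ.samples k + t * σ.α k))
  rw [hβ] at hupdate
  rw [meanNextSqError]
  simp only [nextSqError, hβ]
  exact hupdate.trans (add_le_add (mul_le_mul_of_nonneg_right
    (h.sgd_contraction_le (h.mixing_bias_le hmix k) hn) (sq_nonneg _)) (M.sgd_noise_le _ _ _))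

variable {Ω : Type*} [MeasurableSpace Ω] {μ : Measure Ω} [IsProbabilityMeasure μ]
  {Z : ℕ → Ω → S × A}

lemma integral_sqError_succ_le (h : M.Admissible cbar hbar) (hmix : M.MixingConst C ρ)
    (hZ : M.IsTrajectory (M.schedule cbar hbar C ρ) μ Z) {k t : ℕ}
    (ht : t < (M.schedule cbar hbar C ρ).T k) :
    ∫ x, M.sqError (M.schedule cbar hbar C ρ) k (t + 1) (fun i => Z i x) ∂μ ≤
      (1 - 3 / (t + M.t0)) *
          ∫ x, M.sqError (M.schedule cbar hbar C ρ) k t (fun i => Z i x) ∂μ +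
        2 * (M.sigmaFsq cbar hbar / M.Lmin ^ 2) / (t + M.t0) ^ 2 := by
  set σ := M.schedule cbar hbar C ρ
  have hsamples : σ.samples k + t * σ.α k + σ.α k ≤ σ.samples (k + 1) := by
    rw [σ.samples_succ, add_assoc, ← Nat.succ_mul]
    exact Nat.add_le_add_left (Nat.mul_le_mul_right _ ht) _
  have hint : Integrable (fun x => (1 - 3 / (t + M.t0)) * M.sqError σ k t fun i => Z i x) μ :=
    (integrable_path hZ.1 (M.dependsOn_sqError σ k t)).const_mul _
  calc ∫ x, M.sqError σ k (t + 1) (fun i => Z i x) ∂μ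
      = ∫ x, M.meanNextSqError σ k t (fun i => Z i x) ∂μ := by
        simp only [sqError_succ]
        exact hZ.integral_transition (le_max_left _ _) (Nat.le_add_right _ _) hsamples
          (M.dependsOn_nextSqError σ k t)
    _ ≤ ∫ x, ((1 - 3 / (t + M.t0)) * M.sqError σ k t (fun i => Z i x) +
          2 * (M.sigmaFsq cbar hbar / M.Lmin ^ 2) / (t + M.t0) ^ 2) ∂μ :=
        integral_mono (integrable_path hZ.1 (M.dependsOn_meanNextSqError σ k t))
          (hint.add (integrable_const _)) fun x => h.meanNextSqError_le hmix k t _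
    _ = _ := by
        rw [integral_add hint (integrable_const _), integral_const_mul, integral_const,
          probReal_univ, one_smul]

lemma le_schedule_T (h : M.Admissible cbar hbar) (k : ℕ) :
    24 * M.sigmaFsq cbar hbar / M.Lmin ^ 2 * 4 ^ (k / M.epoch + 2) ≤
      (M.schedule cbar hbar C ρ).T k := by
  have hθ := h.thetaBar_pos
  have ht₀ := h.le_t0
  refine (le_add_of_nonneg_left ?_ : _ ≤ M.Treal cbar hbar k).trans (Nat.le_ceil _)
  positivity

lemma integral_sqError_zero_le (h : M.Admissible cbar hbar)
    (hZ : M.IsTrajectory (M.schedule cbar hbar C ρ) μ Z) (k : ℕ) :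
    ∫ x, M.sqError (M.schedule cbar hbar C ρ) k 0 (fun i => Z i x) ∂μ ≤ M.thetaStar ^ 2 := by
  refine (integral_mono (integrable_path hZ.1 (M.dependsOn_sqError _ k 0))
    (integrable_const (M.thetaStar ^ 2)) fun x => ?_).trans_eq (by simp)
  have hQ := h.l2norm_Q_le_thetaStar (h.iter_feasible (C := C) (ρ := ρ) (fun i => Z i x) k)
    (M.tau_pos k).le (M.tau_antitone k.zero_le)
  have hneg (q : S × A → ℝ) : l2norm (0 - q) = l2norm q := by simp [l2norm]
  simp only [sqError, ctdIterate, ctd, hneg]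
  exact pow_le_pow_left₀ (l2norm_nonneg _) hQ 2

lemma rate_le {q T : ℝ} (h : M.Admissible cbar hbar) (hq : 0 < q)
    (hT : 24 * M.sigmaFsq cbar hbar / M.Lmin ^ 2 * q ≤ T) :
    M.t0 ^ 2 * M.thetaStar ^ 2 / (T + M.t0) ^ 2 +
      M.sigmaFsq cbar hbar / M.Lmin ^ 2 / (T + M.t0) ≤ 1 / (16 * q) := by
  have hΛ := h.Lmin_pos
  have ht₀ := h.le_t0
  have hσ := h.sigmaFsq_pos
  have hT₀ : 0 < T := lt_of_lt_of_le (by positivity) hT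
  have hΘT : 12 * M.t0 * M.thetaStar ^ 2 * q ≤ T := by
    calc 12 * M.t0 * M.thetaStar ^ 2 * q =
          24 * (32 * (1 + M.γ) ^ 2 * M.thetaStar ^ 2) / M.Lmin ^ 2 * q := by rw [t0_eq]; ring
      _ ≤ 24 * M.sigmaFsq cbar hbar / M.Lmin ^ 2 * q := by
          rw [sigmaFsq_eq]
          gcongr
          nlinarith [sq_nonneg M.thetaStar, sq_nonneg (M.costBound cbar hbar)]
      _ ≤ T := hT
  have hinit : M.t0 ^ 2 * M.thetaStar ^ 2 / (T + M.t0) ^ 2 ≤ 1 / (48 * q) := by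
    rw [div_le_div_iff₀ (by positivity) (by positivity)]
    nlinarith [mul_le_mul_of_nonneg_left hΘT (by linarith : 0 ≤ 4 * M.t0), sq_nonneg (T - M.t0)]
  have hnoise : M.sigmaFsq cbar hbar / M.Lmin ^ 2 / (T + M.t0) ≤ 1 / (24 * q) := by
    rw [div_le_div_iff₀ (by positivity) (by positivity)]
    calc _ = 24 * M.sigmaFsq cbar hbar / M.Lmin ^ 2 * q := by ring
      _ ≤ 1 * (T + M.t0) := by linarith
  calc _ ≤ 1 / (48 * q) + 1 / (24 * q) := add_le_add hinit hnoise
    _ = 1 / (16 * q) := by field_simp; norm_num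

lemma integral_sqError_le (h : M.Admissible cbar hbar) (hmix : M.MixingConst C ρ)
    (hZ : M.IsTrajectory (M.schedule cbar hbar C ρ) μ Z) (k : ℕ) :
    ∫ x, M.sqError (M.schedule cbar hbar C ρ) k ((M.schedule cbar hbar C ρ).T k)
      (fun i => Z i x) ∂μ ≤ (1 / 4) ^ (k / M.epoch + 4) := by
  have hσ := h.sigmaFsq_pos
  refine (stochastic_approximation_rate
    (a := fun t => ∫ x, M.sqError (M.schedule cbar hbar C ρ) k t (fun i => Z i x) ∂μ)
    (by linarith [h.le_t0] : 3 ≤ M.t0) (by positivity) (sq_nonneg _)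
    (h.integral_sqError_zero_le hZ k) (fun t ht => h.integral_sqError_succ_le hmix hZ ht) _
    le_rfl).trans ((h.rate_le (by positivity) (h.le_schedule_T k)).trans_eq ?_)
  rw [one_div_pow, pow_add _ _ 4, pow_add _ _ 2]
  ring_nf

end Admissible

end RegMDP

lemma two_mul_le_sq_div_add (d : ℝ) {c : ℝ} (hc : 0 < c) : 2 * d ≤ d ^ 2 / c + c := by
  rw [div_add' _ _ _ hc.ne', le_div_iff₀ hc]
  nlinarith [sq_nonneg (d - c)]

namespace RegMDP

open MeasureTheory

variable {S A : Type*} [Fintype S] [Fintype A] {M : RegMDP S A} {π πs : S → A → ℝ} {ν : S → ℝ}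
  {τ τ' cbar hbar C ρ : ℝ}

/-- The factor `√log |A| / ((1-γ) √γ)` in the bound `tauBias * 2^{-(⌊k/l⌋+1)}` on the change of the
value functions caused by the perturbation `τ_k`. -/
noncomputable def tauBias (M : RegMDP S A) : ℝ :=
  Real.sqrt (Real.log (Fintype.card A)) / ((1 - M.γ) * Real.sqrt M.γ)

/-- The accumulated effect `noiseLevel * 2^{-⌊k/l⌋}` of the evaluation errors on the potential
consists of the second-order term `1 / (8 (1-γ))` and a term proportional to the perturbation. -/
noncomputable def noiseLevel (M : RegMDP S A) : ℝ :=
  1 / 8 / (1 - M.γ) + M.tauBias / 128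

lemma tauBias_nonneg (M : RegMDP S A) : 0 ≤ M.tauBias :=
  div_nonneg (Real.sqrt_nonneg _) (mul_nonneg M.one_sub_γ_pos.le (Real.sqrt_nonneg _))

lemma noiseLevel_nonneg (M : RegMDP S A) : 0 ≤ M.noiseLevel := by
  have := M.one_sub_γ_pos
  have := M.tauBias_nonneg
  unfold noiseLevel
  positivity

lemma tau_mul_log_div (M : RegMDP S A) (k : ℕ) :
    M.tau k * Real.log (Fintype.card A) / (1 - M.γ) =
      M.tauBias * (1 / 2) ^ (k / M.epoch + 1) := by
  rw [tau_mul_log, tauBias, mul_comm (1 - M.γ), ← div_div]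
  ring

lemma evaluation_noise_eq (M : RegMDP S A) (k : ℕ) :
    (1 / 4) ^ (k / M.epoch + 4) * (2 ^ (k / M.epoch + 4) + 1 / (M.γ * M.tau k)) +
      (1 / 2) ^ (k / M.epoch + 4) = (1 / 2) ^ (k / M.epoch) * ((1 - M.γ) * M.noiseLevel) := by
  have hγ := M.one_sub_γ_pos
  have hquarter : ((1 : ℝ) / 4) ^ (k / M.epoch + 4) =
      (1 / 2) ^ (k / M.epoch + 4) * (1 / 2) ^ (k / M.epoch + 4) := by
    rw [← mul_pow]; norm_num
  have hcancel : ((1 : ℝ) / 2) ^ (k / M.epoch) * 2 ^ (k / M.epoch) = 1 := by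
    rw [← mul_pow]; norm_num
  have hlevel : (1 - M.γ) * M.noiseLevel =
      1 / 8 + Real.sqrt (Real.log (Fintype.card A)) / Real.sqrt M.γ / 128 := by
    rw [noiseLevel, tauBias]
    field_simp
  rw [one_div_γ_mul_tau, hlevel, hquarter]
  simp only [pow_add]
  linear_combination ((1 / 2) ^ (k / M.epoch) *
    (1 / 16 + Real.sqrt (Real.log (Fintype.card A)) / Real.sqrt M.γ / 128)) * hcancel

variable [DecidableEq S] [DecidableEq A]

lemma Feasible.potential_tau_le (hπ : M.Feasible π) (hpos : ∀ s a, 0 < π s a)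
    (hπs : M.Feasible πs) (hν : ν ∈ stdSimplex ℝ S) (hτ : τ' ≤ τ) :
    M.potential ν πs τ' π ≤
      M.potential ν πs τ π + (τ - τ') * Real.log (Fintype.card A) / (1 - M.γ) := by
  have hgap := sum_mul_le_of_mem_stdSimplex hν fun s => (by
    linarith [hπ.V_tau_mono hτ s, hπs.V_sub_V_tau_le hτ s] :
      (M.V τ' π s - M.V τ' πs s) - (M.V τ π s - M.V τ πs s) ≤
        (τ - τ') * Real.log (Fintype.card A) / (1 - M.γ))
  simp only [mul_sub (ν _) (_ - _), Finset.sum_sub_distrib] at hgap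
  have hkl : 0 ≤ ∑ s, ν s * klDist (πs s) (π s) := Finset.sum_nonneg fun s _ =>
    mul_nonneg (hν.1 s) (klDist_nonneg (hπs.mem_stdSimplex s) (hπ.mem_stdSimplex s) (hpos s))
  have hdist := mul_le_mul_of_nonneg_right
    (div_le_div_of_nonneg_right hτ M.one_sub_γ_pos.le) hkl
  unfold potential
  linarith

lemma potential_zero : M.potential ν πs 0 π = M.f ν π - M.f ν πs := by
  simp [potential, f, mul_sub]

lemma potential_uniformDist_le (hu : M.Feasible fun _ => uniformDist A) (hπs : M.Feasible πs)
    (hν : ν ∈ stdSimplex ℝ S) (hτ : 0 ≤ τ) :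
    M.potential ν πs τ (fun _ => uniformDist A) ≤
      M.f ν (fun _ => uniformDist A) - M.f ν πs +
        2 * (τ * Real.log (Fintype.card A) / (1 - M.γ)) := by
  have hgap := sum_mul_le_of_mem_stdSimplex hν fun s => (by
    have hle := hu.V_sub_V_tau_le hτ s
    rw [sub_zero] at hle
    linarith [hπs.V_tau_mono hτ s] :
      (M.V τ (fun _ => uniformDist A) s - M.V τ πs s) -
        (M.V 0 (fun _ => uniformDist A) s - M.V 0 πs s) ≤
          τ * Real.log (Fintype.card A) / (1 - M.γ))
  simp only [mul_sub (ν _) (_ - _), Finset.sum_sub_distrib] at hgap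
  have hkl := mul_le_mul_of_nonneg_left
    (sum_mul_le_of_mem_stdSimplex hν fun s => klDist_uniformDist_le (hπs.mem_stdSimplex s))
    (div_nonneg hτ M.one_sub_γ_pos.le)
  rw [div_mul_eq_mul_div _ _ (Real.log _)] at hkl
  rw [← potential_zero]
  simp only [potential, zero_div, zero_mul, add_zero]
  linarith

variable {Ω : Type*} [MeasurableSpace Ω] {μ : Measure Ω} [IsProbabilityMeasure μ]
  {Z : ℕ → Ω → S × A}

lemma IsTrajectory.integrable_iter {σ : Schedule} (hZ : M.IsTrajectory σ μ Z)
    (g : (S → A → ℝ) → ℝ) (k : ℕ) : Integrable (fun x => g (M.iter σ (fun n => Z n x) k)) μ :=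
  integrable_path (g := fun w => g (M.iter σ w k)) hZ.1
    fun _ _ h => congrArg g (M.dependsOn_iter_of_samples_le σ k le_rfl h)

namespace Admissible

variable [Nontrivial A]

lemma potential_iter_succ_le (h : M.Admissible cbar hbar) (hπs : M.Feasible πs)
    (hν : M.IsStationary πs ν) (k : ℕ) (w : ℕ → S × A) :
    M.potential ν πs (M.tau (k + 1)) (M.iter (M.schedule cbar hbar C ρ) w (k + 1)) ≤
      M.γ * M.potential ν πs (M.tau k) (M.iter (M.schedule cbar hbar C ρ) w k) +
        M.sqError (M.schedule cbar hbar C ρ) k ((M.schedule cbar hbar C ρ).T k) w *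
          (2 ^ (k / M.epoch + 4) + 1 / (M.γ * M.tau k)) +
        ((1 / 2) ^ (k / M.epoch + 4) +
          (M.tau k - M.tau (k + 1)) * Real.log (Fintype.card A) / (1 - M.γ)) := by
  set σ := M.schedule cbar hbar C ρ
  have hnext : M.Feasible (M.iter σ w (k + 1)) := h.iter_feasible w (k + 1)
  have hshrink := hnext.potential_tau_le (fun s => h.regular.pos s _ (hnext s)) hπs hν.1
    (M.tau_antitone k.le_succ)
  set d := l2norm (M.ctdIterate σ k (σ.T k) w - M.Q (M.tau k) (M.iter σ w k))
  have hmirror : M.potential ν πs (M.tau k) (M.iter σ w (k + 1)) ≤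
      M.γ * M.potential ν πs (M.tau k) (M.iter σ w k) + (2 * d + d ^ 2 / (M.γ * M.tau k)) :=
    potential_mirrorUpdate_le h.regular.pos (h.iter_feasible w k) hπs hν (M.tau_pos k)
  have hnoise := two_mul_le_sq_div_add d (by positivity : (0 : ℝ) < (1 / 2) ^ (k / M.epoch + 4))
  rw [one_div_pow, div_div_eq_mul_div, div_one] at hnoise
  rw [div_eq_mul_one_div (d ^ 2)] at hmirror
  rw [show M.sqError σ k (σ.T k) w = d ^ 2 from rfl, one_div_pow]
  linarith

lemma integral_potential_succ_le (h : M.Admissible cbar hbar) (hmix : M.MixingConst C ρ)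
    (hZ : M.IsTrajectory (M.schedule cbar hbar C ρ) μ Z) (hπs : M.Feasible πs)
    (hν : M.IsStationary πs ν) (k : ℕ) :
    ∫ x, M.potential ν πs (M.tau (k + 1))
        (M.iter (M.schedule cbar hbar C ρ) (fun n => Z n x) (k + 1)) ∂μ ≤
      M.γ * ∫ x, M.potential ν πs (M.tau k)
          (M.iter (M.schedule cbar hbar C ρ) (fun n => Z n x) k) ∂μ +
        (1 / 2) ^ (k / M.epoch) * ((1 - M.γ) * M.noiseLevel) +
        M.tauBias * ((1 / 2) ^ (k / M.epoch + 1) - (1 / 2) ^ ((k + 1) / M.epoch + 1)) := by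
  set σ := M.schedule cbar hbar C ρ
  set c : ℝ := 2 ^ (k / M.epoch + 4) + 1 / (M.γ * M.tau k)
  set e : ℝ := (1 / 2) ^ (k / M.epoch + 4) +
    (M.tau k - M.tau (k + 1)) * Real.log (Fintype.card A) / (1 - M.γ)
  have hc₀ : 0 ≤ c := by
    have := M.γ_pos
    have := M.tau_pos k
    positivity
  have hpot : Integrable (fun x => M.γ * M.potential ν πs (M.tau k)
      (M.iter σ (fun n => Z n x) k)) μ :=
    (hZ.integrable_iter (M.potential ν πs (M.tau k)) k).const_mul _
  have herr : Integrable (fun x => M.sqError σ k (σ.T k) (fun i => Z i x) * c) μ :=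
    (integrable_path hZ.1 (M.dependsOn_sqError σ k _)).mul_const _
  have hsum : Integrable (fun x => M.γ * M.potential ν πs (M.tau k)
      (M.iter σ (fun n => Z n x) k) + M.sqError σ k (σ.T k) (fun i => Z i x) * c) μ :=
    hpot.add herr
  calc _ ≤ ∫ x, (M.γ * M.potential ν πs (M.tau k) (M.iter σ (fun n => Z n x) k) +
          M.sqError σ k (σ.T k) (fun i => Z i x) * c + e) ∂μ :=
        integral_mono (hZ.integrable_iter (M.potential ν πs (M.tau (k + 1))) (k + 1))
          (hsum.add (integrable_const _))
          fun x => h.potential_iter_succ_le hπs hν k fun n => Z n x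
    _ = M.γ * ∫ x, M.potential ν πs (M.tau k) (M.iter σ (fun n => Z n x) k) ∂μ +
          (∫ x, M.sqError σ k (σ.T k) (fun i => Z i x) ∂μ) * c + e := by
        rw [integral_add hsum (integrable_const _), integral_add hpot herr,
          integral_const_mul, integral_mul_const, integral_const, probReal_univ, one_smul]
    _ ≤ M.γ * ∫ x, M.potential ν πs (M.tau k) (M.iter σ (fun n => Z n x) k) ∂μ +
          (1 / 4) ^ (k / M.epoch + 4) * c + e := by
        gcongr
        exact h.integral_sqError_le hmix hZ k
    _ = _ := by
        rw [← evaluation_noise_eq, mul_sub M.tauBias, ← tau_mul_log_div, ← tau_mul_log_div]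
        ring

lemma integral_potential_le (h : M.Admissible cbar hbar) (hmix : M.MixingConst C ρ)
    (hZ : M.IsTrajectory (M.schedule cbar hbar C ρ) μ Z) (hπs : M.Feasible πs)
    (hν : M.IsStationary πs ν) (hf : M.f ν πs ≤ M.f ν fun _ => uniformDist A) (k : ℕ) :
    ∫ x, M.potential ν πs (M.tau k)
        (M.iter (M.schedule cbar hbar C ρ) (fun n => Z n x) k) ∂μ ≤
      (1 / 2) ^ (k / M.epoch) * (M.f ν (fun _ => uniformDist A) - M.f ν πs + M.tauBias +
        3 * M.noiseLevel) := by
  have hN := M.noiseLevel_nonneg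
  have hL := M.tauBias_nonneg
  have hγ : M.γ ^ (k % M.epoch) ≤ 1 := pow_le_one₀ M.γ_pos.le M.γ_lt_one.le
  set W := M.f ν (fun _ => uniformDist A) - M.f ν πs + M.tauBias + 2 * M.noiseLevel
  have hW₀ : 2 * M.noiseLevel + M.tauBias ≤ W := by linarith
  have hrec := epoch_recursion_le (W := W)
    (x := fun k => ∫ x, M.potential ν πs (M.tau k)
      (M.iter (M.schedule cbar hbar C ρ) (fun n => Z n x) k) ∂μ)
    M.γ_pos M.epoch_pos M.γ_pow_epoch_le hN hL hW₀ (by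
      simp only [iter, integral_const, probReal_univ, one_smul]
      have hinit := potential_uniformDist_le h.uniform_mem hπs hν.1 (M.tau_pos 0).le
      rw [tau_mul_log_div, Nat.zero_div, zero_add, pow_one] at hinit
      linarith) (h.integral_potential_succ_le hmix hZ hπs hν) k
  have hγW := mul_le_mul_of_nonneg_right hγ (by linarith : 0 ≤ W)
  refine hrec.trans (mul_le_mul_of_nonneg_left ?_ (by positivity))
  linarith

lemma integral_f_sub_le (h : M.Admissible cbar hbar) (hmix : M.MixingConst C ρ)
    (hZ : M.IsTrajectory (M.schedule cbar hbar C ρ) μ Z) (hπs : M.Feasible πs)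
    (hν : M.IsStationary πs ν) (hf : M.f ν πs ≤ M.f ν fun _ => uniformDist A) (k : ℕ) :
    ∫ x, (M.f ν (M.iter (M.schedule cbar hbar C ρ) (fun n => Z n x) k) - M.f ν πs) ∂μ ≤
      (1 / 2) ^ (k / M.epoch) *
        (M.f ν (fun _ => uniformDist A) - M.f ν πs +
          3 * Real.sqrt (Real.log (Fintype.card A)) / ((1 - M.γ) * Real.sqrt M.γ) +
          5 / (2 * (1 - M.γ))) := by
  set σ := M.schedule cbar hbar C ρ
  have hgap (x : Ω) : M.f ν (M.iter σ (fun n => Z n x) k) - M.f ν πs ≤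
      M.potential ν πs (M.tau k) (M.iter σ (fun n => Z n x) k) +
        M.tauBias * (1 / 2) ^ (k / M.epoch + 1) := by
    have hfeas : M.Feasible (M.iter σ (fun n => Z n x) k) := h.iter_feasible _ k
    have hle := hfeas.potential_tau_le (fun s => h.regular.pos s _ (hfeas s)) hπs hν.1
      (M.tau_pos k).le
    rwa [potential_zero, sub_zero, tau_mul_log_div] at hle
  have hpot := hZ.integrable_iter (M.potential ν πs (M.tau k)) k
  have hconst : M.tauBias + 3 * M.noiseLevel + M.tauBias / 2 ≤
      3 * Real.sqrt (Real.log (Fintype.card A)) / ((1 - M.γ) * Real.sqrt M.γ) +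
        5 / (2 * (1 - M.γ)) := by
    have h₀ : 0 ≤ 1 / 8 / (1 - M.γ) := div_nonneg (by norm_num) M.one_sub_γ_pos.le
    have h₁ : 5 / (2 * (1 - M.γ)) = 20 * (1 / 8 / (1 - M.γ)) := by rw [← div_div]; ring
    rw [mul_div_assoc, ← tauBias, h₁, noiseLevel]
    linarith [M.tauBias_nonneg]
  calc _ ≤ ∫ x, (M.potential ν πs (M.tau k) (M.iter σ (fun n => Z n x) k) +
          M.tauBias * (1 / 2) ^ (k / M.epoch + 1)) ∂μ :=
        integral_mono (hZ.integrable_iter (fun π => M.f ν π - M.f ν πs) k)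
          (hpot.add (integrable_const _)) hgap
    _ = ∫ x, M.potential ν πs (M.tau k) (M.iter σ (fun n => Z n x) k) ∂μ +
          M.tauBias * (1 / 2) ^ (k / M.epoch + 1) := by
        rw [integral_add hpot (integrable_const _), integral_const, probReal_univ, one_smul]
    _ ≤ (1 / 2) ^ (k / M.epoch) * (M.f ν (fun _ => uniformDist A) - M.f ν πs +
          (M.tauBias + 3 * M.noiseLevel + M.tauBias / 2)) := by
        rw [pow_succ]
        linarith [h.integral_potential_le hmix hZ hπs hν hf k]
    _ ≤ _ := by
        rw [add_assoc (_ - _)]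
        gcongr

end Admissible

end RegMDP

lemma sum_pow_div_le {y : ℝ} (hy : 2 ≤ y) {l : ℕ} (hl : 0 < l) (m : ℕ) :
    ∑ j ∈ Finset.range (m * l), y ^ (j / l) ≤ l * y ^ m := by
  induction m with
  | zero => simp
  | succ m ih =>
    have hepoch : ∑ j ∈ Finset.range l, y ^ ((m * l + j) / l) = l * y ^ m := by
      rw [Finset.sum_congr rfl fun j hj => by
        rw [add_comm, Nat.add_mul_div_right _ _ hl, Nat.div_eq_of_lt (Finset.mem_range.1 hj),
          zero_add], Finset.sum_const, Finset.card_range, nsmul_eq_mul]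
    have hnonneg : (0 : ℝ) ≤ l * y ^ m := by positivity
    rw [add_mul, one_mul, Finset.sum_range_add, hepoch, pow_succ]
    nlinarith

lemma logb_eq_neg_log_div_neg_log (b x : ℝ) : Real.logb b x = -Real.log x / -Real.log b := by
  rw [neg_div_neg_eq, Real.logb]

lemma logb_one_div_eq_log_div_neg_log (b x : ℝ) :
    Real.logb b (1 / x) = Real.log x / -Real.log b := by
  rw [logb_eq_neg_log_div_neg_log, one_div, Real.log_inv, neg_neg]

lemma logb_one_half_mul_logb_two_one_div (b x : ℝ) :
    Real.logb b (1 / 2) * Real.logb 2 (1 / x) = -Real.log x / -Real.log b := by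
  rw [logb_one_div_eq_log_div_neg_log, one_div, Real.logb, Real.log_inv, mul_comm,
    div_mul_div_cancel₀ (Real.log_pos one_lt_two).ne']

lemma neg_log_pos_of_mem_Ioo {x : ℝ} (hx₀ : 0 < x) (hx₁ : x < 1) : 0 < -Real.log x :=
  neg_pos.2 (Real.log_neg hx₀ hx₁)

section Constants

variable {B g ε κ : ℝ}

/-- The constant, relative to `log (1/ε)`, in the bound on the number of epochs that make the
error `B 2^{-m} / (1-γ)` at most `ε`. -/
noncomputable def epochConst (B κ : ℝ) : ℝ :=
  (Real.log B / -Real.log (1 - κ) + 1 / κ + 1) / Real.log 2 + 1 / -Real.log (1 - κ)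

/-- The constant, relative to the product of `log (1/ε)` and `log_ρ (Λ_min / (C R²))`, in the bound
on the number of transitions per update during the first `E log (1/ε)` epochs. -/
noncomputable def blockConst (E κ : ℝ) : ℝ :=
  2 * E / -Real.log (1 - κ) + 8 / (-Real.log (1 - κ)) ^ 2 + 1 / -Real.log (1 - κ) +
    -Real.log κ / (-Real.log (1 - κ)) ^ 2

/-- The constant of the iteration and sample complexities, valid for both: it is the sum of the
constants obtained for either. -/
noncomputable def complexityConst (B κ : ℝ) : ℝ :=
  epochConst B κ * (Real.log 4 + -Real.log κ) +
    blockConst (epochConst B κ) κ * (Real.log 4 + -Real.log κ) * (48 * B + 1536 * B ^ 2)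

lemma epochConst_pos (hB : 1 ≤ B) (hκ₀ : 0 < κ) (hκ₁ : κ < 1) : 0 < epochConst B κ := by
  have hq₀ := neg_log_pos_of_mem_Ioo (sub_pos.2 hκ₁) (sub_lt_self 1 hκ₀)
  have hlogB := Real.log_nonneg hB
  unfold epochConst
  positivity

lemma blockConst_pos {E : ℝ} (hE : 0 < E) (hκ₀ : 0 < κ) (hκ₁ : κ < 1) : 0 < blockConst E κ := by
  have hq₀ := neg_log_pos_of_mem_Ioo (sub_pos.2 hκ₁) (sub_lt_self 1 hκ₀)
  have hlogκ := neg_log_pos_of_mem_Ioo hκ₀ hκ₁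
  unfold blockConst
  positivity

lemma log_four_add_neg_log_pos (hκ₀ : 0 < κ) (hκ₁ : κ < 1) : 0 < Real.log 4 + -Real.log κ :=
  add_pos (Real.log_pos (by norm_num)) (neg_log_pos_of_mem_Ioo hκ₀ hκ₁)

lemma epochConst_mul_le_complexityConst (hB : 1 ≤ B) (hκ₀ : 0 < κ) (hκ₁ : κ < 1) :
    epochConst B κ * (Real.log 4 + -Real.log κ) ≤ complexityConst B κ := by
  have hlog := log_four_add_neg_log_pos hκ₀ hκ₁
  have hblock := blockConst_pos (epochConst_pos hB hκ₀ hκ₁) hκ₀ hκ₁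
  exact le_add_of_nonneg_right (by positivity)

lemma blockConst_mul_le_complexityConst (hB : 1 ≤ B) (hκ₀ : 0 < κ) (hκ₁ : κ < 1) :
    blockConst (epochConst B κ) κ * (Real.log 4 + -Real.log κ) * (48 * B + 1536 * B ^ 2) ≤
      complexityConst B κ := by
  have hlog := log_four_add_neg_log_pos hκ₀ hκ₁
  have hepoch := epochConst_pos hB hκ₀ hκ₁
  exact le_add_of_nonneg_left (by positivity)

lemma complexityConst_pos (hB : 1 ≤ B) (hκ₀ : 0 < κ) (hκ₁ : κ < 1) : 0 < complexityConst B κ :=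
  (mul_pos (epochConst_pos hB hκ₀ hκ₁) (log_four_add_neg_log_pos hκ₀ hκ₁)).trans_le
    (epochConst_mul_le_complexityConst hB hκ₀ hκ₁)

lemma le_epochConst_mul_neg_log {m : ℕ} (hB : 1 ≤ B) (hg : 0 < g) (hκ₀ : 0 < κ) (hκ₁ : κ < 1)
    (hε : 0 < ε) (hεκ : ε ≤ 1 - κ) (hεg : ε ≤ g ^ κ) (hm : (2 : ℝ) ^ m ≤ 2 * (B / (g * ε))) :
    (m : ℝ) ≤ epochConst B κ * -Real.log ε := by
  have hq₀ := neg_log_pos_of_mem_Ioo (sub_pos.2 hκ₁) (sub_lt_self 1 hκ₀)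
  have hq : -Real.log (1 - κ) ≤ -Real.log ε := neg_le_neg (Real.log_le_log hε hεκ)
  have hlog2 : 0 < Real.log 2 := Real.log_pos one_lt_two
  have hmlog : m * Real.log 2 ≤ Real.log 2 + (Real.log B + -Real.log g + -Real.log ε) := by
    have hlog := Real.log_le_log (by positivity) hm
    rw [Real.log_pow, Real.log_mul two_ne_zero (by positivity),
      Real.log_div (by positivity) (by positivity), Real.log_mul hg.ne' hε.ne'] at hlog
    linarith
  have hlogg : -Real.log g ≤ 1 / κ * -Real.log ε := by
    have hlog := Real.log_le_log hε hεg
    rw [Real.log_rpow hg] at hlog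
    rw [one_div_mul_eq_div, le_div_iff₀ hκ₀]
    linarith
  have hlogB : Real.log B ≤ Real.log B / -Real.log (1 - κ) * -Real.log ε := by
    rw [div_mul_eq_mul_div, le_div_iff₀ hq₀]
    exact mul_le_mul_of_nonneg_left hq (Real.log_nonneg hB)
  have hone : 1 ≤ 1 / -Real.log (1 - κ) * -Real.log ε := by
    rwa [one_div_mul_eq_div, le_div_iff₀ hq₀, one_mul]
  calc (m : ℝ) ≤ (Real.log B + -Real.log g + -Real.log ε) / Real.log 2 + 1 := by
        rw [div_add_one hlog2.ne', le_div_iff₀ hlog2]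
        linarith
    _ ≤ (Real.log B / -Real.log (1 - κ) + 1 / κ + 1) * -Real.log ε / Real.log 2 +
          1 / -Real.log (1 - κ) * -Real.log ε := by
        gcongr
        linarith
    _ = epochConst B κ * -Real.log ε := by rw [epochConst]; ring

lemma le_blockConst_mul_mul {E i q x : ℝ} (hE : 0 ≤ E) (hκ₀ : 0 < κ) (hκ₁ : κ < 1)
    (hq : -Real.log (1 - κ) ≤ q) (hx : -Real.log (1 - κ) ≤ x) (hi : i ≤ E * q) :
    2 * (i + 2) + 4 + x + -Real.log κ ≤ blockConst E κ * q * x := by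
  have hq₀ := neg_log_pos_of_mem_Ioo (sub_pos.2 hκ₁) (sub_lt_self 1 hκ₀)
  have hlogκ := neg_log_pos_of_mem_Ioo hκ₀ hκ₁
  rw [blockConst]
  set q₀ := -Real.log (1 - κ)
  have hq_div : 1 ≤ q / q₀ := (one_le_div hq₀).2 hq
  have hx_div : 1 ≤ x / q₀ := (one_le_div hq₀).2 hx
  have hqx_div : 1 ≤ q / q₀ * (x / q₀) := one_le_mul_of_one_le_of_one_le hq_div hx_div
  calc 2 * (i + 2) + 4 + x + -Real.log κ ≤ 2 * (E * q) + 8 + x + -Real.log κ := by linarith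
    _ ≤ 2 * (E * q) * (x / q₀) + 8 * (q / q₀ * (x / q₀)) + x * (q / q₀) +
          -Real.log κ * (q / q₀ * (x / q₀)) := by
        refine add_le_add (add_le_add (add_le_add ?_ ?_) ?_) ?_
        · exact le_mul_of_one_le_right (mul_nonneg zero_le_two (mul_nonneg hE (by linarith))) hx_div
        · exact le_mul_of_one_le_right (by norm_num) hqx_div
        · exact le_mul_of_one_le_right (by linarith) hq_div
        · exact le_mul_of_one_le_right hlogκ.le hqx_div
    _ = _ := by field_simp

lemma mul_two_pow_add_mul_four_pow_le {u w : ℝ} {m : ℕ} (hu : 0 ≤ u) (hw : 0 ≤ w) (hB : 0 ≤ B)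
    (hg : 0 < g) (hε : 0 < ε) (hm : (2 : ℝ) ^ m ≤ 2 * (B / (g * ε))) :
    24 * u * 2 ^ m + 384 * w * 4 ^ m ≤
      (48 * B + 1536 * B ^ 2) * (u / (g * ε) + w / (g * ε) ^ 2) := by
  have hfour : (4 : ℝ) ^ m ≤ (2 * (B / (g * ε))) ^ 2 := by
    rw [show (4 : ℝ) = 2 ^ 2 by norm_num, pow_right_comm]
    gcongr
  calc 24 * u * 2 ^ m + 384 * w * 4 ^ m ≤
        24 * u * (2 * (B / (g * ε))) + 384 * w * (2 * (B / (g * ε))) ^ 2 := by gcongr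
    _ = 48 * B * (u / (g * ε)) + 1536 * B ^ 2 * (w / (g * ε) ^ 2) := by ring
    _ ≤ (48 * B + 1536 * B ^ 2) * (u / (g * ε)) + (48 * B + 1536 * B ^ 2) * (w / (g * ε) ^ 2) := by
        gcongr
        · exact le_add_of_nonneg_right (by positivity)
        · exact le_add_of_nonneg_left (by positivity)
    _ = _ := by ring

end Constants

lemma log_twentyfour_le_four : Real.log 24 ≤ 4 := by
  calc Real.log 24 ≤ Real.log (2 ^ 5) := Real.log_le_log (by norm_num) (by norm_num)
    _ = 5 * Real.log 2 := by rw [Real.log_pow]; norm_num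
    _ ≤ 4 := by linarith [Real.log_two_lt_d9]

/-- The constant in the initial optimality gap, enlarged by the accumulated effects of the
perturbations and of the evaluation errors: the enlarged gap is at most `gapConst / (1-γ)` for
every discount factor `γ ≥ κ`. Absolute values make it at least `1` for all parameters. -/
noncomputable def gapConst (A : Type*) [Fintype A] (cbar hbar κ : ℝ) : ℝ :=
  2 * (|cbar| + |hbar|) + 3 * Real.sqrt (Real.log (Fintype.card A)) / Real.sqrt κ + 5 / 2

lemma one_le_gapConst (A : Type*) [Fintype A] (cbar hbar κ : ℝ) : 1 ≤ gapConst A cbar hbar κ := by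
  have hsqrt : 0 ≤ 3 * Real.sqrt (Real.log (Fintype.card A)) / Real.sqrt κ := by positivity
  unfold gapConst
  linarith [abs_nonneg cbar, abs_nonneg hbar]

namespace RegMDP

open MeasureTheory

variable {S A : Type*} [Fintype S] [Fintype A] {M : RegMDP S A} {π πs : S → A → ℝ} {ν : S → ℝ}
  {cbar hbar C ρ κ ε : ℝ}

lemma epoch_le (hκ : 0 < κ) (hκγ : κ ≤ M.γ) :
    (M.epoch : ℝ) ≤ (Real.log 4 + -Real.log κ) / -Real.log M.γ := by
  have hlogγ := neg_log_pos_of_mem_Ioo M.γ_pos M.γ_lt_one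
  have hnonneg : 0 ≤ Real.logb M.γ (1 / 4) := by
    rw [logb_one_div_eq_log_div_neg_log]
    positivity
  refine (Nat.ceil_lt_add_one hnonneg).le.trans ?_
  rw [logb_one_div_eq_log_div_neg_log, add_div]
  gcongr
  rw [le_div_iff₀ hlogγ, one_mul]
  exact neg_le_neg (Real.log_le_log hκ hκγ)

lemma mul_epoch_le {m : ℕ} {E : ℝ} (hκ : 0 < κ) (hκγ : κ ≤ M.γ) (hm : m ≤ E * -Real.log ε) :
    (m * M.epoch : ℝ) ≤ E * (Real.log 4 + -Real.log κ) * Real.logb M.γ ε :=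
  calc (m * M.epoch : ℝ) ≤ E * -Real.log ε * ((Real.log 4 + -Real.log κ) / -Real.log M.γ) :=
        mul_le_mul hm (epoch_le hκ hκγ) (Nat.cast_nonneg _) ((Nat.cast_nonneg _).trans hm)
    _ = _ := by rw [logb_eq_neg_log_div_neg_log]; ring

variable [DecidableEq S] [DecidableEq A]

lemma IsOptimal.f_le (hπs : M.IsOptimal πs) (hπ : M.Feasible π) (hν : ν ∈ stdSimplex ℝ S) :
    M.f ν πs ≤ M.f ν π :=
  Finset.sum_le_sum fun s _ => mul_le_mul_of_nonneg_left (hπs.2 π hπ s) (hν.1 s)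

namespace Admissible

lemma abs_f_le (h : M.Admissible cbar hbar) (hπ : M.Feasible π) (hν : ν ∈ stdSimplex ℝ S) :
    |M.f ν π| ≤ (cbar + hbar) / (1 - M.γ) := by
  have hQ := hπ.abs_Q_le (τ := 0) (b := cbar + hbar) fun z => by
    rw [stageCost, zero_mul, add_zero]
    exact (abs_add_le _ _).trans (add_le_add (h.abs_cost_le _ _) (h.abs_reg_le _ _ (hπ _)))
  exact abs_sum_mul_le_of_mem_stdSimplex hν fun s =>
    abs_sum_mul_le_of_mem_stdSimplex (hπ.mem_stdSimplex s) fun a => hQ (s, a)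

lemma gap_add_le_gapConst_div (h : M.Admissible cbar hbar) (hπs : M.Feasible πs)
    (hν : ν ∈ stdSimplex ℝ S) (hκ : 0 < κ) (hκγ : κ ≤ M.γ) :
    M.f ν (fun _ => uniformDist A) - M.f ν πs +
        3 * Real.sqrt (Real.log (Fintype.card A)) / ((1 - M.γ) * Real.sqrt M.γ) +
        5 / (2 * (1 - M.γ)) ≤ gapConst A cbar hbar κ / (1 - M.γ) := by
  have hγ := M.one_sub_γ_pos
  have hgap : M.f ν (fun _ => uniformDist A) - M.f ν πs ≤
      2 * (|cbar| + |hbar|) / (1 - M.γ) := by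
    have hunif := (abs_le.1 (h.abs_f_le h.uniform_mem hν)).2
    have hcomp := (abs_le.1 (h.abs_f_le hπs hν)).1
    have habs : (cbar + hbar) / (1 - M.γ) ≤ (|cbar| + |hbar|) / (1 - M.γ) := by
      gcongr <;> exact le_abs_self _
    rw [mul_div_assoc]
    linarith
  have hsqrt : 3 * Real.sqrt (Real.log (Fintype.card A)) / ((1 - M.γ) * Real.sqrt M.γ) ≤
      3 * Real.sqrt (Real.log (Fintype.card A)) / Real.sqrt κ / (1 - M.γ) := by
    have := Real.sqrt_pos.2 hκ
    rw [mul_comm (1 - M.γ), ← div_div]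
    gcongr
  rw [gapConst, add_div, add_div, ← div_div (5 : ℝ)]
  linarith

variable [Nontrivial A]

lemma Treal_le (h : M.Admissible cbar hbar) (k : ℕ) :
    M.Treal cbar hbar k ≤ 20 * (M.t0 * M.thetaBar cbar hbar) * 2 ^ (k / M.epoch) +
      384 * (M.sigmaFsq cbar hbar / M.Lmin ^ 2) * 4 ^ (k / M.epoch) := by
  have hθ := h.le_thetaBar
  have ht₀ := h.le_t0
  rw [Treal]
  set i := k / M.epoch
  set θ := M.thetaBar cbar hbar
  have htransient : (3 * θ * 2 ^ (i + 2)) ^ (2 / 3 : ℝ) ≤ 12 * θ * 2 ^ i := by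
    have hp : (1 : ℝ) ≤ 2 ^ i := one_le_pow₀ one_le_two
    rw [show 3 * θ * 2 ^ (i + 2) = 12 * θ * 2 ^ i by ring]
    exact Real.rpow_le_self_of_one_le (by nlinarith) (by norm_num)
  have hinit : (4 * M.t0 ^ 2 * θ ^ 2 * 4 ^ (i + 2)) ^ (1 / 2 : ℝ) = 8 * (M.t0 * θ) * 2 ^ i := by
    have hsq : 4 * M.t0 ^ 2 * θ ^ 2 * 4 ^ (i + 2) = (8 * (M.t0 * θ) * 2 ^ i) ^ 2 := by
      rw [mul_pow _ (2 ^ i), ← pow_mul, mul_comm i, pow_mul]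
      ring
    rw [hsq, ← Real.sqrt_eq_rpow, Real.sqrt_sq (by positivity)]
  calc _ ≤ M.t0 * (12 * θ * 2 ^ i) + 8 * (M.t0 * θ) * 2 ^ i +
          24 * M.sigmaFsq cbar hbar / M.Lmin ^ 2 * 4 ^ (i + 2) := by
        rw [hinit]
        gcongr
    _ = _ := by ring

lemma schedule_T_le (h : M.Admissible cbar hbar) (k : ℕ) :
    ((M.schedule cbar hbar C ρ).T k : ℝ) ≤
      24 * (M.t0 * M.thetaBar cbar hbar) * 2 ^ (k / M.epoch) +
        384 * (M.sigmaFsq cbar hbar / M.Lmin ^ 2) * 4 ^ (k / M.epoch) := by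
  have hθ := h.le_thetaBar
  have ht₀ := h.le_t0
  have hp : (1 : ℝ) ≤ 2 ^ (k / M.epoch) := one_le_pow₀ one_le_two
  have hone : 1 ≤ (M.t0 * M.thetaBar cbar hbar) * 2 ^ (k / M.epoch) :=
    one_le_mul_of_one_le_of_one_le (by nlinarith) hp
  have hceil : ((M.schedule cbar hbar C ρ).T k : ℝ) ≤ max 0 (M.Treal cbar hbar k) + 1 :=
    (Nat.cast_le.2 (Nat.ceil_le_ceil (le_max_right 0 _))).trans
      (Nat.ceil_lt_add_one (le_max_left 0 _)).le
  have hσ := h.sigmaFsq_pos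
  have hmax := max_le (by positivity) (h.Treal_le k)
  linarith

lemma alphaReal_le (h : M.Admissible cbar hbar) (hmix : M.MixingConst C ρ) (k : ℕ) :
    M.alphaReal cbar hbar C ρ k ≤
      (2 * ((k / M.epoch : ℕ) + 2) + 4 + -Real.log (M.Lmin / (C * M.Rsq cbar hbar))) /
        -Real.log ρ := by
  obtain ⟨hC, hρ₀, hρ₁, -⟩ := hmix
  have hΛ := h.Lmin_pos
  have hR := h.le_Rsq
  have hlogρ := neg_log_pos_of_mem_Ioo hρ₀ hρ₁
  have hlog2 : Real.log 2 ≤ 1 := by linarith [Real.log_two_lt_d9]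
  have hlog3 : Real.log 3 ≤ 4 :=
    (Real.log_le_log (by norm_num) (by norm_num)).trans log_twentyfour_le_four
  have hlog_div {c : ℝ} (hc : 0 < c) : -Real.log (M.Lmin / (c * C * M.Rsq cbar hbar)) =
      Real.log c + -Real.log (M.Lmin / (C * M.Rsq cbar hbar)) := by
    rw [mul_assoc, mul_comm c, ← div_div, Real.log_div (by positivity) hc.ne']
    ring
  set i : ℝ := ((k / M.epoch : ℕ) : ℝ)
  rw [alphaReal, logb_one_div_eq_log_div_neg_log, logb_eq_neg_log_div_neg_log,
    logb_eq_neg_log_div_neg_log, hlog_div (by norm_num), hlog_div (by norm_num), ← mul_div_assoc,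
    ← mul_div_assoc, ← add_div, ← add_div]
  refine max_le ?_ ?_ <;> gcongr ?_ / _
  · linarith [mul_le_of_le_one_right (by positivity : 0 ≤ 2 * (i + 2)) hlog2,
      log_twentyfour_le_four]
  · linarith [mul_le_of_le_one_right (by positivity : 0 ≤ i + 2) hlog2,
      (by positivity : 0 ≤ i + 2)]

lemma schedule_α_le (h : M.Admissible cbar hbar) (hmix : M.MixingConst C ρ) (hκ : 0 < κ)
    (hκρ : κ ≤ ρ) (hx : M.Lmin / (C * M.Rsq cbar hbar) ≤ 1) (k : ℕ) :
    ((M.schedule cbar hbar C ρ).α k : ℝ) ≤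
      (2 * ((k / M.epoch : ℕ) + 2) + 4 + -Real.log (M.Lmin / (C * M.Rsq cbar hbar)) +
        -Real.log κ) / -Real.log ρ := by
  have halpha := h.alphaReal_le hmix k
  have hlogρ := neg_log_pos_of_mem_Ioo hmix.2.1 hmix.2.2.1
  have hlogx : 0 ≤ -Real.log (M.Lmin / (C * M.Rsq cbar hbar)) :=
    neg_nonneg.2 (Real.log_nonpos (h.Lmin_div_pos hmix.1).le hx)
  have hone : 1 ≤ -Real.log κ / -Real.log ρ :=
    (one_le_div hlogρ).2 (neg_le_neg (Real.log_le_log hκ hκρ))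
  rw [add_div _ (-Real.log κ)]
  set X := (2 * ((k / M.epoch : ℕ) + 2) + 4 + -Real.log (M.Lmin / (C * M.Rsq cbar hbar))) /
    -Real.log ρ
  have hX : 0 ≤ X := by positivity
  have hceil : ((M.schedule cbar hbar C ρ).α k : ℝ) ≤ X + 1 := by
    simp only [schedule, Nat.cast_max, Nat.cast_one]
    exact max_le (by linarith)
      ((Nat.cast_le.2 (Nat.ceil_le_ceil halpha)).trans (Nat.ceil_lt_add_one hX).le)
  linarith

lemma samples_mul_epoch_le (h : M.Admissible cbar hbar) {m : ℕ} {a : ℝ} (ha₀ : 0 ≤ a)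
    (ha : ∀ k < m * M.epoch, ((M.schedule cbar hbar C ρ).α k : ℝ) ≤ a) :
    ((M.schedule cbar hbar C ρ).samples (m * M.epoch) : ℝ) ≤
      a * (M.epoch * (24 * (M.t0 * M.thetaBar cbar hbar) * 2 ^ m +
        384 * (M.sigmaFsq cbar hbar / M.Lmin ^ 2) * 4 ^ m)) := by
  have hθ := h.thetaBar_pos
  have ht₀ := h.le_t0
  have hσ := h.sigmaFsq_pos
  rw [Schedule.samples]
  push_cast
  calc ∑ j ∈ Finset.range (m * M.epoch), ((M.schedule cbar hbar C ρ).T j : ℝ) *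
        ((M.schedule cbar hbar C ρ).α j : ℝ)
      ≤ ∑ j ∈ Finset.range (m * M.epoch), (24 * (M.t0 * M.thetaBar cbar hbar) *
          2 ^ (j / M.epoch) + 384 * (M.sigmaFsq cbar hbar / M.Lmin ^ 2) * 4 ^ (j / M.epoch)) * a :=
        Finset.sum_le_sum fun j hj => mul_le_mul (h.schedule_T_le j) (ha j (Finset.mem_range.1 hj))
          (Nat.cast_nonneg _) (by positivity)
    _ = (24 * (M.t0 * M.thetaBar cbar hbar) *
          ∑ j ∈ Finset.range (m * M.epoch), 2 ^ (j / M.epoch) +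
        384 * (M.sigmaFsq cbar hbar / M.Lmin ^ 2) *
          ∑ j ∈ Finset.range (m * M.epoch), 4 ^ (j / M.epoch)) * a := by
        rw [← Finset.sum_mul, Finset.sum_add_distrib, ← Finset.mul_sum, ← Finset.mul_sum]
    _ ≤ (24 * (M.t0 * M.thetaBar cbar hbar) * (M.epoch * 2 ^ m) +
        384 * (M.sigmaFsq cbar hbar / M.Lmin ^ 2) * (M.epoch * 4 ^ m)) * a := by
        gcongr
        · exact sum_pow_div_le le_rfl M.epoch_pos m
        · exact sum_pow_div_le (by norm_num) M.epoch_pos m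
    _ = _ := by ring

end Admissible

end RegMDP

namespace RegMDP

open MeasureTheory

variable {S A Ω : Type*} [Fintype S] [DecidableEq S] [Fintype A] [DecidableEq A] [Nontrivial A]
  [MeasurableSpace Ω] {M : RegMDP S A} {μ : Measure Ω} [IsProbabilityMeasure μ]
  {Z : ℕ → Ω → S × A} {πs : S → A → ℝ} {ν : S → ℝ} {cbar hbar C ρ κ ε B : ℝ} {m : ℕ}

namespace Admissible

lemma integral_f_sub_le_of_le_two_pow (h : M.Admissible cbar hbar) (hmix : M.MixingConst C ρ)
    (hZ : M.IsTrajectory (M.schedule cbar hbar C ρ) μ Z) (hπs : M.Feasible πs)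
    (hν : M.IsStationary πs ν) (hf : M.f ν πs ≤ M.f ν fun _ => uniformDist A)
    (hκ : 0 < κ) (hκγ : κ ≤ M.γ) (hε : 0 < ε)
    (hm : gapConst A cbar hbar κ / ((1 - M.γ) * ε) ≤ 2 ^ m) :
    ∫ x, (M.f ν (M.iter (M.schedule cbar hbar C ρ) (fun n => Z n x) (m * M.epoch)) -
      M.f ν πs) ∂μ ≤ ε := by
  refine (h.integral_f_sub_le hmix hZ hπs hν hf _).trans ?_
  rw [Nat.mul_div_cancel _ M.epoch_pos]
  calc _ ≤ (1 / 2) ^ m * (gapConst A cbar hbar κ / (1 - M.γ)) := by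
        gcongr
        exact h.gap_add_le_gapConst_div hπs hν.1 hκ hκγ
    _ ≤ (1 / 2) ^ m * (2 ^ m * ε) := by
        gcongr
        rwa [← div_le_iff₀ hε, div_div]
    _ = ε := by rw [← mul_assoc, ← mul_pow]; norm_num

lemma schedule_α_le_blockConst (h : M.Admissible cbar hbar) (hmix : M.MixingConst C ρ)
    (hκ₀ : 0 < κ) (hκ₁ : κ < 1) (hκρ : κ ≤ ρ)
    (hx : M.Lmin / (C * M.Rsq cbar hbar) ≤ 1 - κ) (hε : 0 < ε) (hεκ : ε ≤ 1 - κ)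
    {E : ℝ} (hE : 0 ≤ E) (hm : m ≤ E * -Real.log ε) {k : ℕ} (hk : k < m * M.epoch) :
    ((M.schedule cbar hbar C ρ).α k : ℝ) ≤
      blockConst E κ * -Real.log ε * Real.logb ρ (M.Lmin / (C * M.Rsq cbar hbar)) := by
  have halpha := h.schedule_α_le hmix hκ₀ hκρ (hx.trans (sub_le_self 1 hκ₀.le)) k
  have hlogρ := neg_log_pos_of_mem_Ioo hmix.2.1 hmix.2.2.1
  have hepoch : ((k / M.epoch : ℕ) : ℝ) ≤ E * -Real.log ε :=
    (Nat.cast_le.2 (Nat.div_le_of_le_mul (by rw [mul_comm]; exact hk.le))).trans hm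
  rw [logb_eq_neg_log_div_neg_log, ← mul_div_assoc]
  refine halpha.trans (div_le_div_of_nonneg_right ?_ hlogρ.le)
  exact le_blockConst_mul_mul hE hκ₀ hκ₁ (neg_le_neg (Real.log_le_log hε hεκ))
    (neg_le_neg (Real.log_le_log (h.Lmin_div_pos hmix.1) hx)) hepoch

lemma samples_le_complexityConst (h : M.Admissible cbar hbar) (hmix : M.MixingConst C ρ)
    (hκ₀ : 0 < κ) (hκ₁ : κ < 1) (hκγ : κ ≤ M.γ) (hκρ : κ ≤ ρ)
    (hx : M.Lmin / (C * M.Rsq cbar hbar) ≤ 1 - κ) (hε : 0 < ε) (hεκ : ε ≤ 1 - κ)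
    (hB : 1 ≤ B) (hm : m ≤ epochConst B κ * -Real.log ε)
    (hpow : (2 : ℝ) ^ m ≤ 2 * (B / ((1 - M.γ) * ε))) :
    ((M.schedule cbar hbar C ρ).samples (m * M.epoch) : ℝ) ≤
      complexityConst B κ * (Real.logb M.γ (1 / 2) * Real.logb 2 (1 / ε) *
        Real.logb ρ (M.Lmin / (C * M.Rsq cbar hbar)) *
        (M.t0 * M.thetaBar cbar hbar / ((1 - M.γ) * ε) +
          M.sigmaFsq cbar hbar / ((1 - M.γ) ^ 2 * M.Lmin ^ 2 * ε ^ 2))) := by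
  have hγ := M.one_sub_γ_pos
  have ht₀ := h.le_t0
  have hθ := h.thetaBar_pos
  have hσ := h.sigmaFsq_pos
  have hE := epochConst_pos hB hκ₀ hκ₁
  have hblock := blockConst_pos hE hκ₀ hκ₁
  have hlog4 := log_four_add_neg_log_pos hκ₀ hκ₁
  have hlogγ := neg_log_pos_of_mem_Ioo M.γ_pos M.γ_lt_one
  have hlogε := neg_log_pos_of_mem_Ioo hε (hεκ.trans_lt (sub_lt_self 1 hκ₀))
  have hlogx : 0 < Real.logb ρ (M.Lmin / (C * M.Rsq cbar hbar)) :=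
    Real.logb_pos_of_base_lt_one hmix.2.1 hmix.2.2.1 (h.Lmin_div_pos hmix.1)
      (hx.trans_lt (sub_lt_self 1 hκ₀))
  have hupdates := mul_two_pow_add_mul_four_pow_le (u := M.t0 * M.thetaBar cbar hbar)
    (w := M.sigmaFsq cbar hbar / M.Lmin ^ 2) (by positivity) (by positivity) (by linarith) hγ hε
    hpow
  rw [div_div, show M.Lmin ^ 2 * ((1 - M.γ) * ε) ^ 2 = (1 - M.γ) ^ 2 * M.Lmin ^ 2 * ε ^ 2 by
    ring] at hupdates
  rw [logb_one_half_mul_logb_two_one_div]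
  set G := M.t0 * M.thetaBar cbar hbar / ((1 - M.γ) * ε) +
    M.sigmaFsq cbar hbar / ((1 - M.γ) ^ 2 * M.Lmin ^ 2 * ε ^ 2)
  set L := Real.logb ρ (M.Lmin / (C * M.Rsq cbar hbar))
  calc _ ≤ blockConst (epochConst B κ) κ * -Real.log ε * L *
          ((Real.log 4 + -Real.log κ) / -Real.log M.γ * ((48 * B + 1536 * B ^ 2) * G)) := by
        refine (h.samples_mul_epoch_le (by positivity) fun k hk =>
          h.schedule_α_le_blockConst hmix hκ₀ hκ₁ hκρ hx hε hεκ hE.le hm hk).trans ?_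
        gcongr
        exact epoch_le hκ₀ hκγ
    _ = blockConst (epochConst B κ) κ * (Real.log 4 + -Real.log κ) * (48 * B + 1536 * B ^ 2) *
          (-Real.log ε / -Real.log M.γ * L * G) := by ring
    _ ≤ _ := by
        gcongr
        exact blockConst_mul_le_complexityConst hB hκ₀ hκ₁

lemma exists_iterate (h : M.Admissible cbar hbar) (hmix : M.MixingConst C ρ)
    (hZ : M.IsTrajectory (M.schedule cbar hbar C ρ) μ Z) (hπs : M.Feasible πs)
    (hν : M.IsStationary πs ν) (hf : M.f ν πs ≤ M.f ν fun _ => uniformDist A)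
    (hκ₀ : 0 < κ) (hκ₁ : κ < 1) (hκγ : κ ≤ M.γ) (hε : 0 < ε) (hεκ : ε ≤ 1 - κ)
    (hεγ : ε ≤ (1 - M.γ) ^ κ) :
    ∃ k : ℕ,
      (k : ℝ) ≤ complexityConst (gapConst A cbar hbar κ) κ * Real.logb M.γ ε ∧
      ∫ x, (M.f ν (M.iter (M.schedule cbar hbar C ρ) (fun n => Z n x) k) - M.f ν πs) ∂μ ≤ ε ∧
      (κ ≤ ρ → M.Lmin / (C * M.Rsq cbar hbar) ≤ 1 - κ →
        ((M.schedule cbar hbar C ρ).samples k : ℝ) ≤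
          complexityConst (gapConst A cbar hbar κ) κ *
            (Real.logb M.γ (1 / 2) * Real.logb 2 (1 / ε) *
              Real.logb ρ (M.Lmin / (C * M.Rsq cbar hbar)) *
              (M.t0 * M.thetaBar cbar hbar / ((1 - M.γ) * ε) +
                M.sigmaFsq cbar hbar / ((1 - M.γ) ^ 2 * M.Lmin ^ 2 * ε ^ 2)))) := by
  have hγ := M.one_sub_γ_pos
  have hB := one_le_gapConst A cbar hbar κ
  have hε₁ : ε < 1 := hεκ.trans_lt (sub_lt_self 1 hκ₀)
  have hratio : 1 ≤ gapConst A cbar hbar κ / ((1 - M.γ) * ε) :=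
    (one_le_div (by positivity)).2
      ((mul_le_one₀ (by linarith [M.γ_pos]) hε.le hε₁.le).trans hB)
  obtain ⟨n, hn, hn_lt⟩ := exists_nat_pow_near hratio one_lt_two
  have hpow : (2 : ℝ) ^ (n + 1) ≤ 2 * (gapConst A cbar hbar κ / ((1 - M.γ) * ε)) := by
    rw [pow_succ']
    gcongr
  have hm := le_epochConst_mul_neg_log hB hγ hκ₀ hκ₁ hε hεκ hεγ hpow
  have hlog : 0 ≤ Real.logb M.γ ε :=
    (Real.logb_pos_of_base_lt_one M.γ_pos M.γ_lt_one hε hε₁).le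
  refine ⟨(n + 1) * M.epoch, ?_, ?_, fun hκρ hx => ?_⟩
  · rw [Nat.cast_mul]
    refine (mul_epoch_le hκ₀ hκγ hm).trans ?_
    gcongr
    exact epochConst_mul_le_complexityConst hB hκ₀ hκ₁
  · exact h.integral_f_sub_le_of_le_two_pow hmix hZ hπs hν hf hκ₀ hκγ hε hn_lt.le
  · exact h.samples_le_complexityConst hmix hκ₀ hκ₁ hκγ hκρ hx hε hεκ hB hm hpow

end Admissible

end RegMDP

theorem mainTheorem10_general (A : Type*) [Fintype A] [DecidableEq A] [Nontrivial A]
    (cbar hbar κ : ℝ) (hκ₀ : 0 < κ) (hκ₁ : κ < 1) :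
    ∃ K : ℝ, 0 < K ∧
      ∀ (S : Type*) [Fintype S] [DecidableEq S] (M : RegMDP S A),
        (∀ s a, |M.c s a| ≤ cbar) →
        (∀ s, ∀ p ∈ M.X s, |M.h s p| ≤ hbar) →
        (∀ s, uniformDist A ∈ M.X s) →
        M.Regular →
        (∃ C ρ, M.MixingConst C ρ) ∧
        ∀ C ρ, M.MixingConst C ρ →
        ∀ (Ω : Type*) [MeasurableSpace Ω] (ℙ : MeasureTheory.Measure Ω)
          [MeasureTheory.IsProbabilityMeasure ℙ] (Z : ℕ → Ω → S × A),
          M.IsTrajectory (M.schedule cbar hbar C ρ) ℙ Z →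
        ∀ πs νs, M.Feasible πs → M.IsStationary πs νs →
          M.f νs πs ≤ M.f νs (fun _ => uniformDist A) →
          (∀ k : ℕ,
            MeasureTheory.Integrable
              (fun x => M.f νs (M.iter (M.schedule cbar hbar C ρ) (fun n => Z n x) k)) ℙ ∧
            ∫ x, (M.f νs (M.iter (M.schedule cbar hbar C ρ) (fun n => Z n x) k) - M.f νs πs) ∂ℙ ≤
              (1 / 2) ^ (k / M.epoch) *
                (M.f νs (fun _ => uniformDist A) - M.f νs πs +
                  3 * Real.sqrt (Real.log (Fintype.card A)) / ((1 - M.γ) * Real.sqrt M.γ) +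
                  5 / (2 * (1 - M.γ)))) ∧
          (κ ≤ M.γ → ∀ ε : ℝ, 0 < ε → ε ≤ 1 - κ → ε ≤ (1 - M.γ) ^ κ →
            ∃ k : ℕ,
              (k : ℝ) ≤ K * Real.logb M.γ ε ∧
              ∫ x, (M.f νs (M.iter (M.schedule cbar hbar C ρ) (fun n => Z n x) k) - M.f νs πs) ∂ℙ
                ≤ ε ∧
              (κ ≤ ρ → M.Lmin / (C * M.Rsq cbar hbar) ≤ 1 - κ →
                ((M.schedule cbar hbar C ρ).samples k : ℝ) ≤
                  K * (Real.logb M.γ (1 / 2) * Real.logb 2 (1 / ε) *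
                    Real.logb ρ (M.Lmin / (C * M.Rsq cbar hbar)) *
                    (M.t0 * M.thetaBar cbar hbar / ((1 - M.γ) * ε) +
                      M.sigmaFsq cbar hbar / ((1 - M.γ) ^ 2 * M.Lmin ^ 2 * ε ^ 2))))) := by
  refine ⟨complexityConst (gapConst A cbar hbar κ) κ,
    complexityConst_pos (one_le_gapConst A cbar hbar κ) hκ₀ hκ₁, fun S _ _ M hc hh hu hM =>
    ⟨hM.exists_mixingConst hu, fun C ρ hmix Ω _ ℙ _ Z hZ πs νs hπs hνs hf => ?_⟩⟩
  have h : M.Admissible cbar hbar := ⟨nonempty_of_mem_stdSimplex hνs.1, hc, hh, hu, hM⟩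
  exact ⟨fun k => ⟨hZ.integrable_iter (M.f νs) k, h.integral_f_sub_le hmix hZ hπs hνs hf k⟩,
    fun hκγ ε hε hεκ hεγ => h.exists_iterate hmix hZ hπs hνs hf hκ₀ hκ₁ hκγ hε hεκ hεγ⟩

theorem mainTheorem10 (A : Type*) [Fintype A] [DecidableEq A] [Nontrivial A]
    (cbar hbar κ : ℝ) (hκ₀ : 0 < κ) (hκ₁ : κ < 1) :
    -- the constant hidden in the `O`-bounds
    ∃ K : ℝ, 0 < K ∧
      ∀ (S : Type*) [Fintype S] [DecidableEq S] (M : RegMDP S A),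
        (∀ s a, |M.c s a| ≤ cbar) →
        (∀ s, ∀ p ∈ M.X s, |M.h s p| ≤ hbar) →
        (∀ s, uniformDist A ∈ M.X s) →
        M.Regular →
        (∃ C ρ, M.MixingConst C ρ) ∧
        ∀ C ρ, M.MixingConst C ρ →
        ∀ (Ω : Type*) [MeasurableSpace Ω] (ℙ : MeasureTheory.Measure Ω)
          [MeasureTheory.IsProbabilityMeasure ℙ] (Z : ℕ → Ω → S × A),
          M.IsTrajectory (M.schedule cbar hbar C ρ) ℙ Z →
        ∀ πs νs, M.IsOptimal πs → M.IsStationary πs νs →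
          -- the convergence relation, for every iteration `k`
          (∀ k : ℕ,
            MeasureTheory.Integrable
              (fun x => M.f νs (M.iter (M.schedule cbar hbar C ρ) (fun n => Z n x) k)) ℙ ∧
            ∫ x, (M.f νs (M.iter (M.schedule cbar hbar C ρ) (fun n => Z n x) k) - M.f νs πs) ∂ℙ ≤
              (1 / 2) ^ (k / M.epoch) *
                (M.f νs (fun _ => uniformDist A) - M.f νs πs +
                  3 * Real.sqrt (Real.log (Fintype.card A)) / ((1 - M.γ) * Real.sqrt M.γ) +
                  5 / (2 * (1 - M.γ)))) ∧
          -- the iteration and sample complexities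
          (κ ≤ M.γ → ∀ ε : ℝ, 0 < ε → ε ≤ 1 - κ → ε ≤ (1 - M.γ) ^ κ →
            ∃ k : ℕ,
              (k : ℝ) ≤ K * Real.logb M.γ ε ∧
              ∫ x, (M.f νs (M.iter (M.schedule cbar hbar C ρ) (fun n => Z n x) k) - M.f νs πs) ∂ℙ
                ≤ ε ∧
              (κ ≤ ρ → M.Lmin / (C * M.Rsq cbar hbar) ≤ 1 - κ →
                ((M.schedule cbar hbar C ρ).samples k : ℝ) ≤
                  K * (Real.logb M.γ (1 / 2) * Real.logb 2 (1 / ε) *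
                    Real.logb ρ (M.Lmin / (C * M.Rsq cbar hbar)) *
                    (M.t0 * M.thetaBar cbar hbar / ((1 - M.γ) * ε) +
                      M.sigmaFsq cbar hbar / ((1 - M.γ) ^ 2 * M.Lmin ^ 2 * ε ^ 2)))))
  := by
  obtain ⟨K, hK, hmain⟩ := mainTheorem10_general A cbar hbar κ hκ₀ hκ₁
  exact ⟨K, hK, fun S _ _ M hc hh hu hM => (hmain S M hc hh hu hM).imp_right
    fun h C ρ hmix Ω _ ℙ _ Z hZ πs νs hπs hνs =>
      h C ρ hmix Ω ℙ Z hZ πs νs hπs.1 hνs (hπs.f_le hu hνs.1)⟩
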